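/- Let $X$ be a complex Banach space and let $I\subset\mathbb{R}$ be an interval (bounded or unbounded) that does not contain a left end point, e.g. $I=(a,b]$ or $I=\mathbb{R}$. Let $C_0(I,X)$ be the space, with the sup norm, of continuous functions $I\to X$ that vanish at infinity and at the finite end points of $I$ not belonging to $I$. For $1\le p<\infty$ put $E_p=L^p(I,X)$, and put $E_\infty=C_0(I,X)$. Let $W^{1,p}_0(I,X)$ be the set of $f\in E_p$ with weak derivative $f'\in E_p$ whose continuous representative lies in $C_0(I,X)$ (for $p=\infty$: the $C^1$ functions with $f,f'\in C_0(I,X)$). Let $A(t)$, $t\in I$, be generators of strongly continuous semigroups on $X$ that are Kato-stable with constants $M>0$, $w\in\mathbb{R}$: $(w,\infty)\subset\rho(A(t))$ for all $t\in I$, and $$\|R(\lambda,A(t_k))\cdots R(\lambda,A(t_1))\|\le M(\lambda-w)^{-k}$$ for all $\lambda>w$, $k\in\mathbb{N}$ and $t_1\le\dots\le t_k$ in $I$, where $R(\lambda,B)=(\lambda-B)^{-1}$. Assume that $t\mapsto R(w',A(t))$ is strongly continuous on $I$ for some $w'>w$. Let $1\le p\le\infty$ and define on $E_p$ the operator $$G_0=-\tfrac{d}{dt}+A(\cdot),\qquad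 D(G_0)=F_p=\{f\in W^{1,p}_0(I,X): f(t)\in D(A(t))\text{ for a.e. }t\in I,\ A(\cdot)f(\cdot)\in E_p\}.$$ Assume that $(w'-G_0)F_p$ is dense in $E_p$, that $F_p$ is dense in $E_p$, and that $F_p$ (regarded as a set of continuous functions) is dense in $C_0(I,X)$. Then $G_0$ is closable in $E_p$, and its closure $G$ generates a strongly continuous semigroup $T(\cdot)$ on $E_p$ which is an evolution semigroup given by an evolution family: there are bounded operators $U(t,s)$ on $X$ ($t\ge s$ in $I$) with $U(t,t)=1$, $U(t,r)U(r,s)=U(t,s)$ for $t\ge r\ge s$, $(t,s)\mapsto U(t,s)$ strongly continuous, and $\|U(t,s)\|\le M'e^{\omega(t-s)}$ for some constants $M',\omega$, such that for all $\sigma\ge0$, $f\in E_p$ and a.e. $t\in I$, $$(T(\sigma)f)(t)=\begin{cases}U(t,t-\sigma)f(t-\sigma), & t-\sigma\in I,\\ 0,& t-\sigma\notin I.\end{cases}$$ -/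

import Mathlib

open MeasureTheory Set Filter Topology
open scoped ENNReal ZeroAtInfty

noncomputable section

namespace EvolutionSemigroup

/-! ### Resolvents, strongly continuous semigroups and their generators -/

section Abstract

variable {E : Type*} [NormedAddCommGroup E] [NormedSpace ℂ E]

/-- The bounded operator `R` is a two-sided inverse of `z - B : D(B) → E`. -/
def IsResolventAt (B : E →ₗ.[ℂ] E) (z : ℂ) (R : E →L[ℂ] E) : Prop :=
  (∀ x : E, ∃ h : R x ∈ B.domain, z • R x - B ⟨R x, h⟩ = x) ∧
    ∀ y : B.domain, R (z • (y : E) - B y) = y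

/-- The resolvent set `ρ(B)` of an unbounded operator. -/
def resolventSetOf (B : E →ₗ.[ℂ] E) : Set ℂ :=
  {z | ∃ R : E →L[ℂ] E, IsResolventAt B z R}

open Classical in
/-- The resolvent `R(z, B) = (z - B)⁻¹` for `z ∈ ρ(B)` (and `0` for other `z`). -/
def resolventOf (B : E →ₗ.[ℂ] E) (z : ℂ) : E →L[ℂ] E :=
  if h : z ∈ resolventSetOf B then h.choose else 0

/-- `R(z, B)` is the only inverse of `z - B`. -/
theorem resolventOf_eq {B : E →ₗ.[ℂ] E} {z : ℂ} {R : E →L[ℂ] E} (hR : IsResolventAt B z R) :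
    resolventOf B z = R := by
  have h : z ∈ resolventSetOf B := ⟨R, hR⟩
  have h1 : IsResolventAt B z (resolventOf B z) := by
    rw [resolventOf, dif_pos h]
    exact h.choose_spec
  ext x
  obtain ⟨hx, hx'⟩ := hR.1 x
  have := h1.2 ⟨R x, hx⟩
  rwa [hx'] at this

/-- A strongly continuous semigroup `(T(σ))_{σ ≥ 0}` of bounded operators on `E`
(only the values `T σ` with `0 ≤ σ` matter). -/
structure IsC0Semigroup (T : ℝ → E →L[ℂ] E) : Prop where
  map_zero : T 0 = ContinuousLinearMap.id ℂ E
  map_add : ∀ σ τ : ℝ, 0 ≤ σ → 0 ≤ τ → T (σ + τ) = (T σ).comp (T τ)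
  strong_cont : ∀ x : E, ContinuousOn (fun σ => T σ x) (Ici 0)

/-- `B` is the generator of `T`: the pairs `(x, y)` with `x ∈ D(B)`, `B x = y` are exactly those
with `(T(σ) x - x) / σ → y` as `σ → 0+`. -/
def IsGeneratorOf (B : E →ₗ.[ℂ] E) (T : ℝ → E →L[ℂ] E) : Prop :=
  ∀ x y : E, (x, y) ∈ B.graph ↔
    Tendsto (fun σ : ℝ => ((σ⁻¹ : ℝ) : ℂ) • (T σ x - x)) (𝓝[>] 0) (𝓝 y)

/-- `B` generates some strongly continuous semigroup. -/
def GeneratesC0Semigroup (B : E →ₗ.[ℂ] E) : Prop :=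
  ∃ T : ℝ → E →L[ℂ] E, IsC0Semigroup T ∧ IsGeneratorOf B T

/-- The generators `A(t)`, `t ∈ I`, form a Kato-stable family with constants `(M, w)`: for
`t₁ ≤ ⋯ ≤ t_k` in `I` and `l > w`, the time-ordered product satisfies
`‖R(l, A(t_k)) ⋯ R(l, A(t₁))‖ ≤ M (l - w)^{-k}`.
The list `ts` is `[t_k, …, t₁]`. -/
structure IsKatoStable (I : Set ℝ) (A : ℝ → E →ₗ.[ℂ] E) (M w : ℝ) : Prop where
  generates : ∀ t ∈ I, GeneratesC0Semigroup (A t)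
  pos : 0 < M
  mem_resolventSet : ∀ t ∈ I, ∀ l : ℝ, w < l → (l : ℂ) ∈ resolventSetOf (A t)
  bound : ∀ l : ℝ, w < l → ∀ ts : List ℝ, (∀ t ∈ ts, t ∈ I) → ts.Pairwise (· ≥ ·) →
    ‖(ts.map fun t => resolventOf (A t) (l : ℂ)).prod‖ ≤ M * ((l - w)⁻¹) ^ ts.length

/-- A strongly continuous, exponentially bounded evolution family `U(t, s)`, `t ≥ s` in `I`
(only these values matter). -/
structure IsEvolutionFamily (I : Set ℝ) (U : ℝ → ℝ → E →L[ℂ] E) : Prop where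
  refl : ∀ t ∈ I, U t t = ContinuousLinearMap.id ℂ E
  comp : ∀ t ∈ I, ∀ r ∈ I, ∀ s ∈ I, s ≤ r → r ≤ t → (U t r).comp (U r s) = U t s
  strong_cont : ∀ x : E,
    ContinuousOn (fun q : ℝ × ℝ => U q.1 q.2 x) {q | q.1 ∈ I ∧ q.2 ∈ I ∧ q.2 ≤ q.1}
  exp_bound : ∃ M w : ℝ, ∀ t ∈ I, ∀ s ∈ I, s ≤ t → ‖U t s‖ ≤ M * Real.exp (w * (t - s))

end Abstract

/-! ### Function spaces on an interval -/

section Spaces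

variable {X : Type*} [NormedAddCommGroup X]

/-- `f` agrees a.e. on `I` with the function `u ∈ C₀(I, X)`. Membership in `C₀(I, X)` means
continuous on `I`, vanishing at infinity and at the finite end points of `I` not in `I`. -/
def AEEqC0 (I : Set ℝ) (f : ℝ → X) (u : C₀(I, X)) : Prop :=
  ∀ᵐ t ∂(volume.restrict I), ∀ h : t ∈ I, f t = u ⟨t, h⟩

variable [NormedSpace ℂ X]

/-- `g` is the weak (distributional) derivative of `f` on the interior of `I`. -/
def IsWeakDeriv (I : Set ℝ) (f g : ℝ → X) : Prop :=
  ∀ φ : ℝ → ℝ, ContDiff ℝ (⊤ : ℕ∞) φ → HasCompactSupport φ → tsupport φ ⊆ interior I →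
    ∫ t in I, deriv φ t • f t = -∫ t in I, φ t • g t

variable (X) in
/-- The space `E_p`: all of `L^p(I, X)` for `p < ∞`, and `E_∞ = C₀(I, X)` with the sup norm,
realized as the subspace of those classes in `L^∞(I, X)` that have a representative
in `C₀(I, X)`. -/
def Ep (I : Set ℝ) (p : ℝ≥0∞) : Submodule ℂ (Lp X p (volume.restrict I)) where
  carrier := {f | p = ⊤ → ∃ u : C₀(I, X), AEEqC0 I f u}
  zero_mem' _ := ⟨0, by
    filter_upwards [Lp.coeFn_zero X p (volume.restrict I)] with t ht _
    rw [ht]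
    rfl⟩
  add_mem' {f g} hf hg hp := by
    obtain ⟨u, hu⟩ := hf hp
    obtain ⟨v, hv⟩ := hg hp
    refine ⟨u + v, ?_⟩
    filter_upwards [Lp.coeFn_add f g, hu, hv] with t ht h1 h2 h
    rw [ht, Pi.add_apply, h1 h, h2 h]
    rfl
  smul_mem' c f hf hp := by
    obtain ⟨u, hu⟩ := hf hp
    refine ⟨c • u, ?_⟩
    filter_upwards [Lp.coeFn_smul c f, hu] with t ht h1 h
    rw [ht, Pi.smul_apply, h1 h]
    rfl

/-- A representative of a class in `E_p`. -/
def rep {I : Set ℝ} {p : ℝ≥0∞} (f : Ep X I p) : ℝ → X :=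
  ((f : Lp X p (volume.restrict I)) : ℝ → X)

theorem Ep_ext {I : Set ℝ} {p : ℝ≥0∞} {f g : Ep X I p}
    (h : (rep f) =ᵐ[volume.restrict I] (rep g)) : f = g :=
  Subtype.ext (Lp.ext h)

theorem Ep_rep_zero {I : Set ℝ} {p : ℝ≥0∞} :
    (rep (0 : Ep X I p)) =ᵐ[volume.restrict I] 0 :=
  Lp.coeFn_zero X p (volume.restrict I)

theorem Ep_rep_add {I : Set ℝ} {p : ℝ≥0∞} (f g : Ep X I p) :
    (rep (f + g)) =ᵐ[volume.restrict I] (rep f) + (rep g) :=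
  Lp.coeFn_add (f : Lp X p (volume.restrict I)) g

theorem Ep_rep_smul {I : Set ℝ} {p : ℝ≥0∞} (c : ℂ) (f : Ep X I p) :
    (rep (c • f)) =ᵐ[volume.restrict I] c • (rep f) :=
  Lp.coeFn_smul c (f : Lp X p (volume.restrict I))

theorem Ep_integrable_smul {I : Set ℝ} {p : ℝ≥0∞} [hp : Fact (1 ≤ p)] (f : Ep X I p)
    {φ : ℝ → ℝ} (hφ : Continuous φ) (hc : HasCompactSupport φ) :
    Integrable (fun t => φ t • (rep f) t) (volume.restrict I) :=
  ((Lp.memLp (f : Lp X p (volume.restrict I))).locallyIntegrable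
    hp.out).integrable_smul_left_of_hasCompactSupport hφ hc

/-! ### The operators `d/dt` and `A(·)` and their sum -/

/-- The graph of `d/dt` with domain `W₀^{1,p}(I, X)`: pairs `(f, f')` in `E_p × E_p`, where `f'` is
the weak derivative of `f`, and (the continuous representative of) `f` vanishes at infinity and at
the finite end points of `I` not in `I`. For `p = ∞` the domain consists of the `C¹` functions `f`
such that `f` and `f'` belong to `C₀(I, X)`. -/
def derivGraph (I : Set ℝ) (p : ℝ≥0∞) [Fact (1 ≤ p)] :
    Submodule ℂ (Ep X I p × Ep X I p) where
  carrier := {q | IsWeakDeriv I (rep q.1) (rep q.2) ∧ ∃ u : C₀(I, X), AEEqC0 I (rep q.1) u}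
  zero_mem' := by
    refine ⟨fun φ _ _ _ => ?_, 0, ?_⟩
    · have h0 : (rep (0 : Ep X I p × Ep X I p).1) =ᵐ[volume.restrict I] 0 := Ep_rep_zero
      have h0' : (rep (0 : Ep X I p × Ep X I p).2) =ᵐ[volume.restrict I] 0 := Ep_rep_zero
      rw [integral_eq_zero_of_ae (by filter_upwards [h0] with t ht; rw [ht]; simp),
        integral_eq_zero_of_ae (by filter_upwards [h0'] with t ht; rw [ht]; simp), neg_zero]
    · have h0 : (rep (0 : Ep X I p × Ep X I p).1) =ᵐ[volume.restrict I] 0 := Ep_rep_zero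
      filter_upwards [h0] with t ht _
      rw [ht]
      rfl
  add_mem' {a b} ha hb := by
    obtain ⟨ha, u, hu⟩ := ha
    obtain ⟨hb, v, hv⟩ := hb
    refine ⟨fun φ h1 h2 h3 => ?_, u + v, ?_⟩
    · have hd : Continuous (deriv φ) := h1.continuous_deriv (by simp)
      have e1 : (fun t => deriv φ t • (rep (a + b).1) t) =ᵐ[volume.restrict I]
          fun t => deriv φ t • (rep a.1) t + deriv φ t • (rep b.1) t := by
        filter_upwards [Ep_rep_add a.1 b.1] with t ht
        rw [Prod.fst_add, ht, Pi.add_apply, smul_add]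
      have e2 : (fun t => φ t • (rep (a + b).2) t) =ᵐ[volume.restrict I]
          fun t => φ t • (rep a.2) t + φ t • (rep b.2) t := by
        filter_upwards [Ep_rep_add a.2 b.2] with t ht
        rw [Prod.snd_add, ht, Pi.add_apply, smul_add]
      rw [integral_congr_ae e1, integral_congr_ae e2,
        integral_add (Ep_integrable_smul a.1 hd h2.deriv) (Ep_integrable_smul b.1 hd h2.deriv),
        integral_add (Ep_integrable_smul a.2 h1.continuous h2)
          (Ep_integrable_smul b.2 h1.continuous h2),
        ha φ h1 h2 h3, hb φ h1 h2 h3, neg_add]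
    · filter_upwards [Ep_rep_add a.1 b.1, hu, hv] with t ht h1 h2 h
      rw [Prod.fst_add, ht, Pi.add_apply, h1 h, h2 h]
      rfl
  smul_mem' c a ha := by
    obtain ⟨ha, u, hu⟩ := ha
    refine ⟨fun φ h1 h2 h3 => ?_, c • u, ?_⟩
    · have e1 : (fun t => deriv φ t • (rep (c • a).1) t) =ᵐ[volume.restrict I]
          fun t => c • (deriv φ t • (rep a.1) t) := by
        filter_upwards [Ep_rep_smul c a.1] with t ht
        rw [Prod.smul_fst, ht, Pi.smul_apply, smul_comm]
      have e2 : (fun t => φ t • (rep (c • a).2) t) =ᵐ[volume.restrict I]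
          fun t => c • (φ t • (rep a.2) t) := by
        filter_upwards [Ep_rep_smul c a.2] with t ht
        rw [Prod.smul_snd, ht, Pi.smul_apply, smul_comm]
      rw [integral_congr_ae e1, integral_congr_ae e2, integral_smul, integral_smul,
        ha φ h1 h2 h3, smul_neg]
    · filter_upwards [Ep_rep_smul c a.1, hu] with t ht h1 h
      rw [Prod.smul_fst, ht, Pi.smul_apply, h1 h]
      rfl

/-- The operator `d/dt` on `E_p` with domain `W₀^{1,p}(I, X)`. -/
def derivOp (I : Set ℝ) (p : ℝ≥0∞) [Fact (1 ≤ p)] : Ep X I p →ₗ.[ℂ] Ep X I p :=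
  (derivGraph I p).toLinearPMap

/-- The graph of the multiplication operator `A(·)` on its maximal domain
`{f ∈ E_p : f(t) ∈ D(A(t)) for a.e. t ∈ I, A(·) f(·) ∈ E_p}`. -/
def mulGraph (I : Set ℝ) (A : ℝ → X →ₗ.[ℂ] X) (p : ℝ≥0∞) :
    Submodule ℂ (Ep X I p × Ep X I p) where
  carrier := {q | ∀ᵐ t ∂(volume.restrict I),
    ∃ h : (rep q.1) t ∈ (A t).domain, A t ⟨(rep q.1) t, h⟩ = (rep q.2) t}
  zero_mem' := by
    have h0 : (rep (0 : Ep X I p × Ep X I p).1) =ᵐ[volume.restrict I] 0 := Ep_rep_zero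
    have h0' : (rep (0 : Ep X I p × Ep X I p).2) =ᵐ[volume.restrict I] 0 := Ep_rep_zero
    filter_upwards [h0, h0'] with t h1 h2
    have hz : (rep (0 : Ep X I p × Ep X I p).1) t ∈ (A t).domain := by
      rw [h1]
      exact zero_mem _
    refine ⟨hz, ?_⟩
    have : (⟨_, hz⟩ : (A t).domain) = 0 := Subtype.ext h1
    rw [this, LinearPMap.map_zero, h2]
    rfl
  add_mem' {a b} ha hb := by
    filter_upwards [ha, hb, Ep_rep_add a.1 b.1, Ep_rep_add a.2 b.2]
      with t ⟨ha, ha'⟩ ⟨hb, hb'⟩ h1 h2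
    have hs : (rep (a + b).1) t ∈ (A t).domain := by
      rw [Prod.fst_add, h1]
      exact add_mem ha hb
    refine ⟨hs, ?_⟩
    have : (⟨_, hs⟩ : (A t).domain) = ⟨_, ha⟩ + ⟨_, hb⟩ := Subtype.ext h1
    rw [this, LinearPMap.map_add, ha', hb', Prod.snd_add, h2]
    rfl
  smul_mem' c a ha := by
    filter_upwards [ha, Ep_rep_smul c a.1, Ep_rep_smul c a.2] with t ⟨ha, ha'⟩ h1 h2
    have hs : (rep (c • a).1) t ∈ (A t).domain := by
      rw [Prod.smul_fst, h1]
      exact Submodule.smul_mem _ c ha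
    refine ⟨hs, ?_⟩
    have : (⟨_, hs⟩ : (A t).domain) = c • ⟨_, ha⟩ := Subtype.ext h1
    rw [this, LinearPMap.map_smul, ha', Prod.smul_snd, h2]
    rfl

/-- The multiplication operator `A(·)` on `E_p` with its maximal domain. -/
def mulOp (I : Set ℝ) (A : ℝ → X →ₗ.[ℂ] X) (p : ℝ≥0∞) : Ep X I p →ₗ.[ℂ] Ep X I p :=
  (mulGraph I A p).toLinearPMap

/-- The operator `G₀ = -d/dt + A(·)` on `E_p` with domain
`F_p = W₀^{1,p}(I, X) ∩ D(A(·))`; the sum of partial maps lives on the intersection of the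
domains. -/
def G0 (I : Set ℝ) (A : ℝ → X →ₗ.[ℂ] X) (p : ℝ≥0∞) [Fact (1 ≤ p)] :
    Ep X I p →ₗ.[ℂ] Ep X I p :=
  -derivOp I p + mulOp I A p

/-- The space `F_p`. -/
def Fp (I : Set ℝ) (A : ℝ → X →ₗ.[ℂ] X) (p : ℝ≥0∞) [Fact (1 ≤ p)] :
    Submodule ℂ (Ep X I p) :=
  (G0 I A p).domain

/-- A weak derivative in `E_p` is unique, so `d/dt` is single-valued. -/
theorem derivOp_graph [CompleteSpace X] (I : Set ℝ) [hI : I.OrdConnected] (p : ℝ≥0∞) [hp : Fact (1 ≤ p)] :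
    (derivOp I p : Ep X I p →ₗ.[ℂ] Ep X I p).graph = derivGraph I p := by
  refine Submodule.toLinearPMap_graph_eq _ ?_
  rintro ⟨f, g⟩ ⟨hq, -⟩ hf
  change f = 0 at hf
  change g = 0
  subst hf
  refine Ep_ext (EventuallyEq.trans ?_ Ep_rep_zero.symm)
  have hloc : LocallyIntegrable (rep g) (volume.restrict I) :=
    (Lp.memLp (g : Lp X p (volume.restrict I))).locallyIntegrable hp.out
  have key := isOpen_interior.ae_eq_zero_of_integral_contDiff_smul_eq_zero (U := interior I)
    (μ := volume.restrict I) (f := (rep g)) (hloc.locallyIntegrableOn _) (by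
      intro φ h1 h2 h3
      have h := hq φ h1 h2 h3
      rw [integral_eq_zero_of_ae (by
        filter_upwards [Ep_rep_zero (X := X) (I := I) (p := p)] with t ht
        simp [ht])] at h
      exact neg_eq_zero.1 h.symm)
  have hnull : volume (frontier I) = 0 := hI.convex.addHaar_frontier volume
  have hfr : ∀ᵐ t ∂(volume.restrict I), t ∉ frontier I :=
    ae_restrict_of_ae (measure_eq_zero_iff_ae_notMem.1 hnull)
  filter_upwards [key, hfr, ae_restrict_mem hI.measurableSet] with t h1 h2 h3
  refine h1 ?_
  by_contra h4
  exact h2 ⟨subset_closure h3, h4⟩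

/-- The multiplication operator `A(·)` is single-valued. -/
theorem mulOp_graph (I : Set ℝ) (A : ℝ → X →ₗ.[ℂ] X) (p : ℝ≥0∞) :
    (mulOp I A p).graph = mulGraph I A p := by
  refine Submodule.toLinearPMap_graph_eq _ ?_
  rintro ⟨f, g⟩ hq hf
  change f = 0 at hf
  change g = 0
  subst hf
  refine Ep_ext (EventuallyEq.trans ?_ Ep_rep_zero.symm)
  have hq' : ∀ᵐ t ∂(volume.restrict I), ∃ h : (rep (0 : Ep X I p)) t ∈ (A t).domain,
    A t ⟨(rep (0 : Ep X I p)) t, h⟩ = (rep g) t := hq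
  filter_upwards [hq', Ep_rep_zero (X := X) (I := I) (p := p)] with t ⟨h, ht⟩ h0
  have : (⟨_, h⟩ : (A t).domain) = 0 := Subtype.ext h0
  rw [← ht, this, LinearPMap.map_zero]
  rfl

/-- `(f, g)` is in the graph of `G₀` iff `f ∈ W₀^{1,p} ∩ D(A(·))` and `g = -f' + A(·) f`. -/
theorem mem_G0_graph [CompleteSpace X] (I : Set ℝ) [I.OrdConnected] (A : ℝ → X →ₗ.[ℂ] X)
    (p : ℝ≥0∞) [Fact (1 ≤ p)] (f g : Ep X I p) :
    (f, g) ∈ (G0 I A p).graph ↔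
      ∃ f' a : Ep X I p, (f, f') ∈ derivGraph I p ∧ (f, a) ∈ mulGraph I A p ∧ g = -f' + a := by
  rw [← derivOp_graph I p, ← mulOp_graph I A p]
  simp only [LinearPMap.mem_graph_iff]
  constructor
  · rintro ⟨y, hy, rfl⟩
    exact ⟨derivOp I p ⟨y, y.2.1⟩, mulOp I A p ⟨y, y.2.2⟩, ⟨_, hy, rfl⟩, ⟨_, hy, rfl⟩, rfl⟩
  · rintro ⟨f', a, ⟨y, hy, rfl⟩, ⟨z, hz, rfl⟩, rfl⟩
    obtain ⟨y, hy'⟩ := y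
    obtain ⟨z, hz'⟩ := z
    simp only at hy hz
    subst hy
    subst hz
    exact ⟨⟨z, hy', hz'⟩, rfl, rfl⟩

/-! ### Evolution semigroups -/

open Classical in
/-- `T` is the evolution semigroup on `E_p` given by the family `U`:
`(T(σ) f)(t) = U(t, t - σ) f(t - σ)` if `t - σ ∈ I`, and `0` otherwise, for a.e. `t ∈ I`. -/
def IsGivenBy (I : Set ℝ) (p : ℝ≥0∞) [Fact (1 ≤ p)] (T : ℝ → Ep X I p →L[ℂ] Ep X I p)
    (U : ℝ → ℝ → X →L[ℂ] X) : Prop :=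
  ∀ σ : ℝ, 0 ≤ σ → ∀ f : Ep X I p, ∀ᵐ t ∂(volume.restrict I),
    (rep (T σ f)) t = if t - σ ∈ I then U t (t - σ) ((rep f) (t - σ)) else 0

end Spaces

end EvolutionSemigroup

end

open MeasureTheory Set Filter Topology
open scoped ENNReal ZeroAtInfty

noncomputable section

namespace EvolutionSemigroup

/-! ### Uniformly bounded families of operators and dense sets -/

section Density

variable {E F : Type*} [NormedAddCommGroup E] [NormedSpace ℂ E]
  [NormedAddCommGroup F] [NormedSpace ℂ F]

/-! The semigroup is obtained from the product approximations `V(τ)f(t) = (1 - τA(t))⁻¹ f(t - τ)`.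
The power `V(τ)^k` is a translation by `kτ` weighted by a time-ordered product of resolvents, so
Kato stability bounds it, in norm and even pointwise, by `M exp(v k τ)` for any `v > w` and small
`τ`. On `F_p` the quotients `τ⁻¹(V(τ)f - f)` converge to `G₀ f` (`IsKatoStable.consistent`).
Chernoff's theorem (`exists_semigroup_of_consistent`) then shows that the closure of `G₀` generates
`T` and that `V(σ/n)^n f → T(σ)f`. For `p = ∞` the operators `V(τ)` need not preserve `C₀(I, X)`,
for instance when `I` has an open finite right end, so Chernoff's theorem is proved for operators
acting on a larger ambient space, here all of `L^p(I, X)`.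

Chernoff's theorem itself rests on the bounded operators `(l - (V(τ) - 1)/τ)⁻¹`. Their powers
satisfy `M / l^k`, they converge strongly to the resolvents of the closure, and the bounds survive
in the limit. Backward Euler with repeatedly halved step sizes turns these resolvent bounds into a
semigroup, and a telescoping argument identifies it as the limit of the products.

The pointwise bound also survives: `‖(T(σ)f)(t)‖ ≤ M exp(vσ) ‖f(t - σ)‖`, with value zero when `t -
σ` is outside `I` (`IsDominated`). Averaging this over times in a unit interval gives the
Sobolev-type estimate `‖f‖_∞ ≤ C(‖f‖ + ‖Gf‖)` on `D(G₀)` (`IsDominated.norm_le_of_aeEqC0`), hence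
the domain of the closure consists of `C₀` functions. For these the domination holds everywhere, so
`(T(t - s)f)(t)` depends only on `f(s)`, linearly and boundedly. Since `F_p` is dense in `C₀(I, X)`,
the values `f(s)` are dense in `X`, and `U(t, s)` is the continuous extension of `f(s) ↦ (T(t -
s)f)(t)` (`exists_evolutionFamily`). -/

theorem tendsto_of_mem_closure {α : Type*} {l : Filter α} {f : α → E →L[ℂ] F}
    {g : E →L[ℂ] F} {C : ℝ} (hC : ∀ᶠ i in l, ‖f i‖ ≤ C) {D : Set E}
    (h : ∀ x ∈ D, Tendsto (fun i => f i x) l (𝓝 (g x))) {x : E} (hx : x ∈ closure D) :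
    Tendsto (fun i => f i x) l (𝓝 (g x)) := by
  rw [Metric.tendsto_nhds]
  intro ε hε
  have hK : 0 < |C| + ‖g‖ + 1 := by positivity
  obtain ⟨y, hy, hxy⟩ := Metric.mem_closure_iff.1 hx (ε / (2 * (|C| + ‖g‖ + 1))) (by positivity)
  filter_upwards [hC, Metric.tendsto_nhds.1 (h y hy) (ε / 2) (by positivity)] with i h1 h2
  rw [dist_eq_norm] at *
  have e : f i x - g x = f i (x - y) + (f i y - g y) - g (x - y) := by simp
  have h3 : ‖f i (x - y)‖ ≤ |C| * ‖x - y‖ :=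
    ((f i).le_opNorm _).trans (by gcongr; exact h1.trans (le_abs_self C))
  have h4 : ‖g (x - y)‖ ≤ ‖g‖ * ‖x - y‖ := g.le_opNorm _
  have h5 : (|C| + ‖g‖ + 1) * ‖x - y‖ < ε / 2 := by
    rw [lt_div_iff₀ (by positivity)] at hxy
    linarith
  have h6 : ‖f i x - g x‖ ≤ ‖f i (x - y)‖ + ‖f i y - g y‖ + ‖g (x - y)‖ := by
    rw [e]
    exact (norm_sub_le _ _).trans (by gcongr; exact norm_add_le _ _)
  nlinarith [norm_nonneg (x - y)]

theorem tendsto_of_tendsto_on_dense {α : Type*} {l : Filter α} {f : α → E →L[ℂ] F}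
    {g : E →L[ℂ] F} {C : ℝ} (hC : ∀ᶠ i in l, ‖f i‖ ≤ C) {D : Set E} (hD : Dense D)
    (h : ∀ x ∈ D, Tendsto (fun i => f i x) l (𝓝 (g x))) (x : E) :
    Tendsto (fun i => f i x) l (𝓝 (g x)) :=
  tendsto_of_mem_closure hC h (hD x)

theorem cauchySeq_of_cauchySeq_on_dense {f : ℕ → E →L[ℂ] F} {C : ℝ} (hC : ∀ i, ‖f i‖ ≤ C)
    {D : Set E} (hD : Dense D) (h : ∀ x ∈ D, CauchySeq fun i => f i x) (x : E) :
    CauchySeq fun i => f i x := by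
  rw [Metric.cauchySeq_iff]
  intro ε hε
  have hC0 : 0 ≤ C := (norm_nonneg _).trans (hC 0)
  obtain ⟨y, hy, hxy⟩ := hD.exists_dist_lt x (ε := ε / (4 * (C + 1))) (by positivity)
  obtain ⟨N, hN⟩ := Metric.cauchySeq_iff.1 (h y hy) (ε / 2) (by positivity)
  refine ⟨N, fun m hm n hn => ?_⟩
  have h1 := hN m hm n hn
  rw [dist_eq_norm] at *
  have e : f m x - f n x = f m (x - y) + (f m y - f n y) - f n (x - y) := by simp
  have h3 : ∀ i, ‖f i (x - y)‖ ≤ C * ‖x - y‖ := fun i => (f i).le_of_opNorm_le (hC i) _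
  have h5 : (C + 1) * ‖x - y‖ < ε / 4 := by
    rw [lt_div_iff₀ (by positivity)] at hxy
    linarith
  have h6 : ‖f m x - f n x‖ ≤ ‖f m (x - y)‖ + ‖f m y - f n y‖ + ‖f n (x - y)‖ := by
    rw [e]
    exact (norm_sub_le _ _).trans (by gcongr; exact norm_add_le _ _)
  nlinarith [norm_nonneg (x - y), h3 m, h3 n]

end Density

/-! ### Generation of bounded semigroups by the backward Euler scheme -/

section Euler

variable {E : Type*} [NormedAddCommGroup E] [NormedSpace ℂ E]

/-- The operators `r j` are the inverses of `1 - h j • Γ`, where `Γ` is the graph of an operator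
and `h j = h 0 / 2 ^ j`, and their powers are bounded by `M`. -/
structure IsEulerFamily (Γ : Submodule ℂ (E × E)) (M : ℝ) (h : ℕ → ℝ) (r : ℕ → E →L[ℂ] E) :
    Prop where
  pos : ∀ j, 0 < h j
  half : ∀ j, h j = 2 * h (j + 1)
  mem : ∀ j x, (r j x, (h j)⁻¹ • (r j x - x)) ∈ Γ
  inv : ∀ j x y, (x, y) ∈ Γ → r j (x - h j • y) = x
  bound : ∀ j k, ‖(r j) ^ k‖ ≤ M
  dense : Dense {x | ∃ y, (x, y) ∈ Γ}

namespace IsEulerFamily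

variable {Γ : Submodule ℂ (E × E)} {M : ℝ} {h : ℕ → ℝ} {r : ℕ → E →L[ℂ] E}

theorem nonneg (H : IsEulerFamily Γ M h r) : 0 ≤ M := (norm_nonneg _).trans (H.bound 0 0)

theorem pow_le (H : IsEulerFamily Γ M h r) (j k : ℕ) (x : E) : ‖((r j) ^ k) x‖ ≤ M * ‖x‖ :=
  ((r j) ^ k).le_of_opNorm_le (H.bound j k) x

theorem one_le (H : IsEulerFamily Γ M h r) (j : ℕ) (x : E) : ‖r j x‖ ≤ M * ‖x‖ := by
  simpa using H.pow_le j 1 x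

theorem h_eq (H : IsEulerFamily Γ M h r) (j : ℕ) : h j = h 0 / 2 ^ j := by
  induction j with
  | zero => simp
  | succ j ih =>
    have := H.half j
    rw [pow_succ, ← div_div, ← ih, this]
    ring

theorem h_tendsto (H : IsEulerFamily Γ M h r) : Tendsto h atTop (𝓝 0) := by
  have : h = fun j => h 0 * (1 / 2) ^ j := by
    ext j
    rw [H.h_eq j]
    simp [div_eq_mul_inv]
  rw [this]
  simpa using (tendsto_pow_atTop_nhds_zero_of_lt_one (r := (1 / 2 : ℝ)) (by norm_num)
    (by norm_num)).const_mul (h 0)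

theorem step (H : IsEulerFamily Γ M h r) (j : ℕ) {x y : E} (hxy : (x, y) ∈ Γ) :
    r j x = x + h j • r j y := by
  have := H.inv j x y hxy
  rw [map_sub, ContinuousLinearMap.map_smul_of_tower, sub_eq_iff_eq_add] at this
  exact this

/-- By `step`, the quotient `(h j)⁻¹ • (r j x - x)` supplied by `mem` equals `r j y`: resolvents
commute with their operator. -/
theorem map_mem (H : IsEulerFamily Γ M h r) (j : ℕ) {x y : E} (hxy : (x, y) ∈ Γ) :
    (r j x, r j y) ∈ Γ := by
  have := H.mem j x
  rwa [H.step j hxy, add_sub_cancel_left, smul_smul, inv_mul_cancel₀ (H.pos j).ne', one_smul,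
    ← H.step j hxy] at this

theorem commute (H : IsEulerFamily Γ M h r) (i j : ℕ) : Commute (r i) (r j) := by
  ext x
  have h1 := H.inv j _ _ (H.map_mem i (H.mem j x))
  rw [ContinuousLinearMap.map_smul_of_tower, smul_smul, mul_inv_cancel₀ (H.pos j).ne', one_smul,
    ← map_sub (r i), sub_sub_cancel] at h1
  exact h1.symm

/-- The step from `n` to `n + 1` adds `h j • (r j)^(n+1) y`, and the power bound applies to each
increment separately, so `M` occurs only to the first power. -/
theorem pow_sub_le (H : IsEulerFamily Γ M h r) (j n : ℕ) {x y : E} (hxy : (x, y) ∈ Γ) :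
    ‖((r j) ^ n) x - x‖ ≤ n * h j * M * ‖y‖ := by
  induction n with
  | zero => simp
  | succ n ih =>
    have e : ((r j) ^ (n + 1)) x - x = h j • ((r j) ^ (n + 1)) y + (((r j) ^ n) x - x) := by
      rw [pow_succ, mul_apply_eq_comp, H.step j hxy, map_add, ContinuousLinearMap.map_smul_of_tower,
        mul_apply_eq_comp]
      abel
    rw [e]
    refine (norm_add_le _ _).trans ?_
    rw [norm_smul, Real.norm_of_nonneg (H.pos j).le]
    have := H.pow_le j (n + 1) y
    rw [Nat.cast_succ]
    nlinarith [H.pos j]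

theorem tendsto_id (H : IsEulerFamily Γ M h r) (x : E) :
    Tendsto (fun j => r j x) atTop (𝓝 x) := by
  refine tendsto_of_tendsto_on_dense (g := ContinuousLinearMap.id ℂ E) (C := M)
    (Eventually.of_forall fun j => by simpa using H.bound j 1) H.dense ?_ x
  rintro x ⟨y, hxy⟩
  rw [tendsto_iff_norm_sub_tendsto_zero]
  refine squeeze_zero (fun _ => norm_nonneg _) (fun j => by simpa using H.pow_sub_le j 1 hxy) ?_
  simpa using (H.h_tendsto.mul_const M).mul_const ‖y‖

/-- For `x` in the domain, `r j x` lies in the domain of the square and tends to `x`. -/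
theorem dense_sq (H : IsEulerFamily Γ M h r) :
    Dense {x | ∃ y z, (x, y) ∈ Γ ∧ (y, z) ∈ Γ} := by
  have key : {x | ∃ y, (x, y) ∈ Γ} ⊆ closure {x | ∃ y z, (x, y) ∈ Γ ∧ (y, z) ∈ Γ} := by
    rintro x ⟨y, hxy⟩
    refine mem_closure_of_tendsto (H.tendsto_id x) (Eventually.of_forall fun j => ?_)
    exact ⟨r j y, _, H.map_mem j hxy, H.mem j y⟩
  have := H.dense.mono key
  rwa [dense_closure] at this

/-- With `a = h (j + 1)`, one step of length `2a` and two steps of length `a` share the expansion `x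
+ 2a y`. The second-order remainders are `4a² r_j z` and `2a² s z + a² s² z`, whence `7 = 4 + 2 +
1`. -/
theorem refine_step (H : IsEulerFamily Γ M h r) (j : ℕ) {x y z : E} (hxy : (x, y) ∈ Γ)
    (hyz : (y, z) ∈ Γ) :
    ‖(r j - (r (j + 1)) ^ 2) x‖ ≤ 7 * M * (h (j + 1)) ^ 2 * ‖z‖ := by
  set a := h (j + 1) with ha
  set s := r (j + 1) with hs
  have e1 : s x = x + a • s y := H.step (j + 1) hxy
  have e2 : s y = y + a • s z := H.step (j + 1) hyz
  have e3 : r j x = x + (2 * a) • r j y := by rw [H.step j hxy, H.half j]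
  have e4 : r j y = y + (2 * a) • r j z := by rw [H.step j hyz, H.half j]
  have e5 : s (s y) = s y + a • s (s z) := by
    conv_lhs => rw [e2, map_add, ContinuousLinearMap.map_smul_of_tower]
  have e6 : s (s x) = s x + a • s (s y) := by
    conv_lhs => rw [e1, map_add, ContinuousLinearMap.map_smul_of_tower]
  have e : (r j - s ^ 2) x = (a ^ 2) • ((4 : ℝ) • r j z - (2 : ℝ) • s z - (s ^ 2) z) := by
    rw [sub_apply, pow_two, mul_apply_eq_comp,
      mul_apply_eq_comp, e6, e5, e1, e2, e3, e4]
    module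
  have b1 := H.one_le j z
  have b2 := H.one_le (j + 1) z
  have b3 := H.pow_le (j + 1) 2 z
  rw [← hs] at b2 b3
  rw [e, norm_smul, Real.norm_of_nonneg (by positivity)]
  have : ‖(4 : ℝ) • r j z - (2 : ℝ) • s z - (s ^ 2) z‖ ≤ 4 * ‖r j z‖ + 2 * ‖s z‖ + ‖(s ^ 2) z‖ := by
    refine (norm_sub_le _ _).trans ?_
    gcongr
    refine (norm_sub_le _ _).trans ?_
    rw [norm_smul, norm_smul]
    norm_num
  nlinarith [sq_nonneg a]

/-- Commuting `a, b` satisfy `a^n - b^n = ∑ a^i b^(n-1-i) (a - b)`. Each of the `n` terms is of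
second order in the step, so the total is (elapsed time) × (step size). -/
theorem refine_pow (H : IsEulerFamily Γ M h r) (j n : ℕ) {x y z : E} (hxy : (x, y) ∈ Γ)
    (hyz : (y, z) ∈ Γ) :
    ‖((r j) ^ n) x - ((r (j + 1)) ^ (2 * n)) x‖ ≤
      n * (M * (M * (7 * M * (h (j + 1)) ^ 2 * ‖z‖))) := by
  have hc : Commute (r j) ((r (j + 1)) ^ 2) := (H.commute j (j + 1)).pow_right 2
  have e := hc.geom_sum₂_mul n
  rw [← pow_mul] at e
  have e' : ((r j) ^ n) x - ((r (j + 1)) ^ (2 * n)) x =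
      ∑ i ∈ Finset.range n, ((r j) ^ i) ((((r (j + 1)) ^ 2) ^ (n - 1 - i))
        ((r j - (r (j + 1)) ^ 2) x)) := by
    rw [← sub_apply, ← e]
    simp [Finset.sum_mul]
  rw [e']
  refine (norm_sum_le_of_le _ (f := fun i => _) (n := fun _ =>
    (M * (M * (7 * M * (h (j + 1)) ^ 2 * ‖z‖)))) fun i _ => ?_).trans (by simp)
  refine (H.pow_le j i _).trans (mul_le_mul_of_nonneg_left ?_ H.nonneg)
  rw [← pow_mul]
  exact (H.pow_le _ _ _).trans (mul_le_mul_of_nonneg_left (H.refine_step j hxy hyz) H.nonneg)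

/-- The backward Euler approximations of the semigroup. -/
def approx (h : ℕ → ℝ) (r : ℕ → E →L[ℂ] E) (j : ℕ) (t : ℝ) : E →L[ℂ] E := (r j) ^ ⌊t / h j⌋₊

theorem floor_mul_le (H : IsEulerFamily Γ M h r) (j : ℕ) {t : ℝ} (ht : 0 ≤ t) :
    (⌊t / h j⌋₊ : ℝ) * h j ≤ t := by
  rw [← le_div_iff₀ (H.pos j)]
  exact Nat.floor_le (div_nonneg ht (H.pos j).le)

/-- Halving the step changes the approximation by `O(2^{-j})`: `refine_pow` compares `n` coarse with
`2n` fine steps, and at most one fine step is left over. -/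
theorem cauchySeq_approx_of_mem (H : IsEulerFamily Γ M h r) {t : ℝ} (ht : 0 ≤ t) {x y z : E}
    (hxy : (x, y) ∈ Γ) (hyz : (y, z) ∈ Γ) : CauchySeq fun j => approx h r j t x := by
  refine cauchySeq_of_le_geometric (1 / 2)
    (M * (M * (7 * M * h 0 * ‖z‖)) * t + M * (h 0 * M * ‖y‖)) (by norm_num) fun j => ?_
  have hM := H.nonneg
  set n := ⌊t / h j⌋₊ with hn
  have hp := H.pos (j + 1)
  have hj : h (j + 1) ≤ h 0 * (1 / 2) ^ j := by
    have := H.h_eq j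
    have h2 := H.half j
    have h3 := H.pos j
    rw [one_div, inv_pow, ← div_eq_mul_inv, ← this]
    linarith
  have hnt : (n : ℝ) * (2 * h (j + 1)) ≤ t := by
    rw [← H.half j]
    exact H.floor_mul_le j ht
  have hq : t / h (j + 1) = 2 * (t / h j) := by
    rw [H.half j]
    field_simp
  have h0 : 0 ≤ t / h j := div_nonneg ht (H.pos j).le
  -- Rounding down on the finer grid may gain one step over twice the coarse count; that step costs
  -- only `O(h (j + 1))`.
  have hcase : ⌊t / h (j + 1)⌋₊ = 2 * n ∨ ⌊t / h (j + 1)⌋₊ = 2 * n + 1 := by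
    have l1 := Nat.floor_le h0
    have l2 := Nat.lt_floor_add_one (t / h j)
    have u1 : 2 * n ≤ ⌊t / h (j + 1)⌋₊ := Nat.le_floor (by push_cast; rw [hq]; linarith)
    have u2 : ⌊t / h (j + 1)⌋₊ < 2 * n + 2 := by
      rw [Nat.floor_lt (by rw [hq]; positivity)]
      push_cast
      rw [hq]
      linarith
    omega
  have b1 : ‖((r j) ^ n) x - ((r (j + 1)) ^ (2 * n)) x‖ ≤
      M * (M * (7 * M * h 0 * ‖z‖)) * t * (1 / 2) ^ j := by
    refine (H.refine_pow j n hxy hyz).trans ?_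
    have e : (n : ℝ) * (M * (M * (7 * M * h (j + 1) ^ 2 * ‖z‖))) =
      (M * (M * (7 * M * ‖z‖))) * ((n : ℝ) * h (j + 1)) * h (j + 1) := by ring
    have e' : M * (M * (7 * M * h 0 * ‖z‖)) * t * (1 / 2) ^ j =
      (M * (M * (7 * M * ‖z‖))) * t * (h 0 * (1 / 2) ^ j) := by ring
    rw [e, e']
    have : 0 ≤ (n : ℝ) * h (j + 1) := by positivity
    gcongr
    linarith
  have b2 : ‖((r (j + 1)) ^ (2 * n)) x - approx h r (j + 1) t x‖ ≤
      M * (h 0 * M * ‖y‖) * (1 / 2) ^ j := by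
    have hpos0 := H.pos 0
    rcases hcase with hc | hc
    · rw [approx, hc, sub_self, norm_zero]
      positivity
    · rw [approx, hc, pow_succ, mul_apply_eq_comp, ← map_sub]
      refine (H.pow_le _ _ _).trans ?_
      have := H.pow_sub_le (j + 1) 1 hxy
      rw [pow_one, norm_sub_rev] at this
      have e : M * (h 0 * M * ‖y‖) * (1 / 2) ^ j = M * ((h 0 * (1 / 2) ^ j) * M * ‖y‖) := by ring
      rw [e]
      refine mul_le_mul_of_nonneg_left (this.trans ?_) hM
      rw [Nat.cast_one, one_mul]
      gcongr
  rw [dist_eq_norm, approx, add_mul]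
  exact (norm_sub_le_norm_sub_add_norm_sub _ _ _).trans (add_le_add b1 b2)

end IsEulerFamily
end Euler

/-! ### The limit of the Euler approximations and its generator -/

section Euler2

variable {E : Type*} [NormedAddCommGroup E] [NormedSpace ℂ E]
namespace IsEulerFamily

variable {Γ : Submodule ℂ (E × E)} {M : ℝ} {h : ℕ → ℝ} {r : ℕ → E →L[ℂ] E}

theorem exists_limit [CompleteSpace E] (H : IsEulerFamily Γ M h r) :
    ∃ T : ℝ → E →L[ℂ] E, ∀ t, 0 ≤ t → ∀ x,
      Tendsto (fun j => approx h r j t x) atTop (𝓝 (T t x)) := by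
  have key : ∀ t : ℝ, ∃ S : E →L[ℂ] E, 0 ≤ t → ∀ x,
      Tendsto (fun j => approx h r j t x) atTop (𝓝 (S x)) := by
    intro t
    by_cases ht : 0 ≤ t
    · have hc : ∀ x, ∃ y, Tendsto (fun j => approx h r j t x) atTop (𝓝 y) := fun x =>
        cauchySeq_tendsto_of_complete (cauchySeq_of_cauchySeq_on_dense
          (fun j => H.bound j _) H.dense_sq
          (fun x ⟨y, z, hxy, hyz⟩ => H.cauchySeq_approx_of_mem ht hxy hyz) x)
      choose g hg using hc
      refine ⟨continuousLinearMapOfTendsto (𝕜₁ := ℂ) (𝕜₂ := ℂ) (σ₁₂ := RingHom.id ℂ)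
        (fun j => approx h r j t) (l := atTop) (f := g) (tendsto_pi_nhds.2 hg), fun _ => hg⟩
    · exact ⟨0, fun h => absurd h ht⟩
  choose T hT using key
  exact ⟨T, hT⟩

variable {T : ℝ → E →L[ℂ] E}

theorem limit_bound (H : IsEulerFamily Γ M h r) (hT : ∀ t, 0 ≤ t → ∀ x,
    Tendsto (fun j => approx h r j t x) atTop (𝓝 (T t x))) {t : ℝ} (ht : 0 ≤ t) : ‖T t‖ ≤ M :=
  ContinuousLinearMap.opNorm_le_bound _ H.nonneg fun x =>
    le_of_tendsto (hT t ht x).norm (Eventually.of_forall fun j => H.pow_le j _ x)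

theorem limit_zero (hT : ∀ t, 0 ≤ t → ∀ x,
    Tendsto (fun j => approx h r j t x) atTop (𝓝 (T t x))) : T 0 = ContinuousLinearMap.id ℂ E := by
  ext x
  refine tendsto_nhds_unique (hT 0 le_rfl x) ?_
  simp [approx]

/-- The semigroup law holds for the approximations up to one surplus Euler step caused by the
floors, and `r j → 1` strongly. -/
theorem limit_add (H : IsEulerFamily Γ M h r) (hT : ∀ t, 0 ≤ t → ∀ x,
    Tendsto (fun j => approx h r j t x) atTop (𝓝 (T t x))) {s t : ℝ} (hs : 0 ≤ s) (ht : 0 ≤ t) :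
    T (s + t) = (T s).comp (T t) := by
  ext x
  have h1 : Tendsto (fun j => approx h r j s (approx h r j t x)) atTop (𝓝 (T s (T t x))) := by
    have a1 : Tendsto (fun j => approx h r j s (approx h r j t x - T t x)) atTop (𝓝 0) := by
      refine squeeze_zero_norm (fun j => H.pow_le j _ _) ?_
      simpa using ((tendsto_iff_norm_sub_tendsto_zero.1 (hT t ht x)).const_mul M)
    have := a1.add (hT s hs (T t x))
    simpa using this
  have h2 : Tendsto (fun j => approx h r j (s + t) x - approx h r j s (approx h r j t x)) atTop
      (𝓝 0) := by
    refine squeeze_zero_norm (a := fun j => M * ‖r j x - x‖) (fun j => ?_) ?_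
    · have hj := H.pos j
      have hs' : 0 ≤ s / h j := by positivity
      have ht' : 0 ≤ t / h j := by positivity
      have hc : ⌊(s + t) / h j⌋₊ = ⌊s / h j⌋₊ + ⌊t / h j⌋₊ ∨
          ⌊(s + t) / h j⌋₊ = ⌊s / h j⌋₊ + ⌊t / h j⌋₊ + 1 := by
        rw [add_div]
        have l1 := Nat.floor_le hs'
        have l2 := Nat.lt_floor_add_one (s / h j)
        have l3 := Nat.floor_le ht'
        have l4 := Nat.lt_floor_add_one (t / h j)
        have u1 : ⌊s / h j⌋₊ + ⌊t / h j⌋₊ ≤ ⌊s / h j + t / h j⌋₊ :=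
          Nat.le_floor (by push_cast; linarith)
        have u2 : ⌊s / h j + t / h j⌋₊ < ⌊s / h j⌋₊ + ⌊t / h j⌋₊ + 2 := by
          rw [Nat.floor_lt (by positivity)]
          push_cast
          linarith
        omega
      have hM := H.nonneg
      rcases hc with hc | hc
      · rw [approx, hc, pow_add, mul_apply_eq_comp, approx, approx, sub_self, norm_zero]
        positivity
      · rw [approx, hc, pow_succ, approx, approx, mul_apply_eq_comp,
          ← mul_apply_eq_comp ((r j) ^ ⌊s / h j⌋₊), ← pow_add, ← map_sub]
        exact H.pow_le _ _ _
    · simpa using ((tendsto_iff_norm_sub_tendsto_zero.1 (H.tendsto_id x)).const_mul M)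
  have h3 := h2.add h1
  simp only [sub_add_cancel, zero_add] at h3
  exact tendsto_nhds_unique (hT (s + t) (add_nonneg hs ht) x) h3

theorem limit_sub_le (H : IsEulerFamily Γ M h r) (hT : ∀ t, 0 ≤ t → ∀ x,
    Tendsto (fun j => approx h r j t x) atTop (𝓝 (T t x))) {t : ℝ} (ht : 0 ≤ t) {x y : E}
    (hxy : (x, y) ∈ Γ) : ‖T t x - x‖ ≤ t * M * ‖y‖ := by
  have hM := H.nonneg
  refine le_of_tendsto ((hT t ht x).sub_const x).norm (Eventually.of_forall fun j => ?_)
  refine (H.pow_sub_le j _ hxy).trans ?_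
  gcongr
  exact H.floor_mul_le j ht

theorem limit_tendsto_zero (H : IsEulerFamily Γ M h r) (hT : ∀ t, 0 ≤ t → ∀ x,
    Tendsto (fun j => approx h r j t x) atTop (𝓝 (T t x))) (x : E) :
    Tendsto (fun t => T t x) (𝓝[≥] 0) (𝓝 x) := by
  refine tendsto_of_tendsto_on_dense (g := ContinuousLinearMap.id ℂ E) (C := M) ?_ H.dense ?_ x
  · filter_upwards [self_mem_nhdsWithin] with t ht using H.limit_bound hT ht
  · rintro x ⟨y, hxy⟩
    rw [tendsto_iff_norm_sub_tendsto_zero]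
    refine squeeze_zero' (Eventually.of_forall fun _ => norm_nonneg _) (g := fun t => t * M * ‖y‖) ?_ ?_
    · filter_upwards [self_mem_nhdsWithin] with t ht using H.limit_sub_le hT ht hxy
    · have : Tendsto (fun t : ℝ => t * M * ‖y‖) (𝓝 0) (𝓝 (0 * M * ‖y‖)) :=
        (Continuous.tendsto (by fun_prop) 0)
      simp only [zero_mul] at this
      exact this.mono_left nhdsWithin_le_nhds

theorem isC0Semigroup (H : IsEulerFamily Γ M h r) (hT : ∀ t, 0 ≤ t → ∀ x,
    Tendsto (fun j => approx h r j t x) atTop (𝓝 (T t x))) : IsC0Semigroup T where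
  map_zero := limit_zero hT
  map_add _ _ hs ht := H.limit_add hT hs ht
  strong_cont x := by
    -- By the semigroup law and the uniform bound, continuity at every time, from both sides,
    -- reduces to right continuity at `0`.
    have key : ∀ s t, 0 ≤ s → s ≤ t → ‖T t x - T s x‖ ≤ M * ‖T (t - s) x - x‖ := by
      intro s t hs hst
      have := H.limit_add hT hs (sub_nonneg.2 hst)
      rw [add_sub_cancel] at this
      rw [this, ContinuousLinearMap.comp_apply, ← map_sub]
      exact (T s).le_of_opNorm_le (H.limit_bound hT hs) _
    intro t ht
    rw [Metric.continuousWithinAt_iff]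
    intro ε hε
    obtain ⟨δ, hδ, hd⟩ := Metric.tendsto_nhdsWithin_nhds.1 (H.limit_tendsto_zero hT x)
      (ε / (M + 1)) (div_pos hε (by linarith [H.nonneg]))
    have hM := H.nonneg
    refine ⟨δ, hδ, fun {s} hs hst => ?_⟩
    have fin : ∀ a b, 0 ≤ a → a ≤ b → |b - a| < δ → ‖T b x - T a x‖ < ε := by
      intro a b ha hab hlt
      have h1 := hd (sub_nonneg.2 hab : b - a ∈ Ici (0:ℝ)) (by simpa [Real.dist_eq] using hlt)
      rw [dist_eq_norm, lt_div_iff₀ (by positivity)] at h1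
      have := key a b ha hab
      nlinarith [norm_nonneg (T (b - a) x - x)]
    rw [dist_eq_norm]
    rw [Real.dist_eq] at hst
    rcases le_total s t with hle | hle
    · rw [norm_sub_rev]
      exact fin s t hs hle (by rwa [abs_sub_comm])
    · exact fin t s ht hle hst

/-- First-order Taylor expansion for `x` merely in the domain: as `y` need not lie in it, `y` is
compared with an element `y₀` that does, at the price `(M + 1)‖y - y₀‖`. -/
theorem approx_taylor (H : IsEulerFamily Γ M h r) (j n : ℕ) {x y y₀ z : E} (hxy : (x, y) ∈ Γ)
    (hyz : (y₀, z) ∈ Γ) :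
    ‖((r j) ^ n) x - x - ((n : ℝ) * h j) • y‖ ≤
      (n * h j) * ((M + 1) * ‖y - y₀‖ + (n * h j) * M * ‖z‖) := by
  have hM := H.nonneg
  have hj := H.pos j
  induction n with
  | zero => simp
  | succ n ih =>
    have e : ((r j) ^ (n + 1)) x - x - (((n + 1 : ℕ) : ℝ) * h j) • y =
        (((r j) ^ n) x - x - ((n : ℝ) * h j) • y) + h j • (((r j) ^ (n + 1)) y - y) := by
      have : ((r j) ^ (n + 1)) x = ((r j) ^ n) x + h j • ((r j) ^ (n + 1)) y := by
        rw [pow_succ, mul_apply_eq_comp, H.step j hxy, map_add,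
          ContinuousLinearMap.map_smul_of_tower, mul_apply_eq_comp]
      rw [this]
      push_cast
      module
    have h1 : ‖((r j) ^ (n + 1)) y - y‖ ≤
        (M + 1) * ‖y - y₀‖ + (((n + 1 : ℕ) : ℝ) * h j) * M * ‖z‖ := by
      have e2 : ((r j) ^ (n + 1)) y - y =
        ((r j) ^ (n + 1)) (y - y₀) - (y - y₀) + (((r j) ^ (n + 1)) y₀ - y₀) := by
        rw [map_sub]
        abel
      rw [e2]
      refine (norm_add_le _ _).trans ?_
      gcongr
      · refine (norm_sub_le _ _).trans ?_
        have := H.pow_le j (n + 1) (y - y₀)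
        linarith
      · exact H.pow_sub_le j (n + 1) hyz
    rw [e]
    refine (norm_add_le _ _).trans ?_
    rw [norm_smul, Real.norm_of_nonneg hj.le]
    have h2 : (n * h j) * ((M + 1) * ‖y - y₀‖ + (n * h j) * M * ‖z‖) ≤
        (n * h j) * ((M + 1) * ‖y - y₀‖ + (((n + 1 : ℕ) : ℝ) * h j) * M * ‖z‖) := by
      gcongr
      simp
    have h3 := mul_le_mul_of_nonneg_left h1 hj.le
    have e3 : (((n + 1 : ℕ) : ℝ) * h j) = n * h j + h j := by push_cast; ring
    rw [e3] at h2 h3 ⊢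
    nlinarith

theorem limit_taylor (H : IsEulerFamily Γ M h r) (hT : ∀ t, 0 ≤ t → ∀ x,
    Tendsto (fun j => approx h r j t x) atTop (𝓝 (T t x))) {t : ℝ} (ht : 0 ≤ t) {x y y₀ z : E}
    (hxy : (x, y) ∈ Γ) (hyz : (y₀, z) ∈ Γ) :
    ‖T t x - x - t • y‖ ≤ t * ((M + 1) * ‖y - y₀‖ + t * M * ‖z‖) := by
  have hM := H.nonneg
  have h1 : Tendsto (fun j => (⌊t / h j⌋₊ : ℝ) * h j) atTop (𝓝 t) := by
    have h2 : Tendsto (fun j => t - h j) atTop (𝓝 t) := by simpa using H.h_tendsto.const_sub t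
    refine tendsto_of_tendsto_of_tendsto_of_le_of_le h2 tendsto_const_nhds (fun j => ?_)
      (fun j => H.floor_mul_le j ht)
    have := Nat.lt_floor_add_one (t / h j)
    rw [div_lt_iff₀ (H.pos j)] at this
    simp only
    linarith
  refine le_of_tendsto (((hT t ht x).sub_const x).sub (h1.smul_const y)).norm
    (Eventually.of_forall fun j => ?_)
  refine (H.approx_taylor j _ hxy hyz).trans ?_
  have := H.floor_mul_le j ht
  have := H.pos j
  gcongr

/-- One direction is `limit_taylor` with `y₀` close to `y`. For the converse, `r 0` commutes with
`T`, so differentiating the orbit of `r 0 x` in two ways gives `r 0 y = (h 0)⁻¹ • (r 0 x - x)`.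
Hence `x = r 0 (x - h 0 • y)` is in the range of `r 0`, that is, in the domain, with image `y`. -/
theorem limit_generator (H : IsEulerFamily Γ M h r) (hT : ∀ t, 0 ≤ t → ∀ x,
    Tendsto (fun j => approx h r j t x) atTop (𝓝 (T t x))) (x y : E) :
    (x, y) ∈ Γ ↔ Tendsto (fun σ : ℝ => σ⁻¹ • (T σ x - x)) (𝓝[>] 0) (𝓝 y) := by
  have hM := H.nonneg
  have fwd : ∀ x y : E, (x, y) ∈ Γ →
      Tendsto (fun σ : ℝ => σ⁻¹ • (T σ x - x)) (𝓝[>] 0) (𝓝 y) := by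
    intro x y hxy
    rw [Metric.tendsto_nhds]
    intro ε hε
    obtain ⟨y₀, ⟨z, hz⟩, hy⟩ := H.dense.exists_dist_lt y (ε := ε / (2 * (M + 1))) (by positivity)
    have h1 : Tendsto (fun t : ℝ => t * M * ‖z‖) (𝓝[>] 0) (𝓝 0) := by
      have : Tendsto (fun t : ℝ => t * M * ‖z‖) (𝓝 0) (𝓝 (0 * M * ‖z‖)) :=
        (Continuous.tendsto (by fun_prop) 0)
      simp only [zero_mul] at this
      exact this.mono_left nhdsWithin_le_nhds
    filter_upwards [h1.eventually_lt_const (half_pos hε), self_mem_nhdsWithin] with t h2 (ht : 0 < t)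
    have h3 := H.limit_taylor hT ht.le hxy hz
    rw [dist_eq_norm, lt_div_iff₀ (by positivity)] at hy
    rw [dist_eq_norm]
    have e : t⁻¹ • (T t x - x) - y = t⁻¹ • (T t x - x - t • y) := by
      rw [smul_sub t⁻¹ _ (t • y), smul_smul, inv_mul_cancel₀ ht.ne', one_smul]
    rw [e, norm_smul, Real.norm_of_nonneg (by positivity), inv_mul_lt_iff₀ ht]
    nlinarith
  refine ⟨fwd x y, fun hxy => ?_⟩
  have comm : ∀ σ, 0 ≤ σ → ∀ x, T σ (r 0 x) = r 0 (T σ x) := by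
    intro σ hσ x
    refine tendsto_nhds_unique (hT σ hσ (r 0 x)) ?_
    have := ((r 0).continuous.tendsto _).comp (hT σ hσ x)
    refine this.congr fun j => ?_
    have := (H.commute 0 j).pow_right ⌊σ / h j⌋₊
    exact congrArg (fun S : E →L[ℂ] E => S x) this
  have h1 : Tendsto (fun σ : ℝ => σ⁻¹ • (T σ (r 0 x) - r 0 x)) (𝓝[>] 0) (𝓝 (r 0 y)) := by
    refine (((r 0).continuous.tendsto _).comp hxy).congr' ?_
    filter_upwards [self_mem_nhdsWithin] with σ (hσ : 0 < σ)
    simp only [Function.comp, ContinuousLinearMap.map_smul_of_tower, map_sub, comm σ hσ.le]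
  have h2 := tendsto_nhds_unique (fwd _ _ (H.mem 0 x)) h1
  have h3 := H.mem 0 (x - h 0 • y)
  have h4 : r 0 (x - h 0 • y) = x := by
    rw [map_sub, ContinuousLinearMap.map_smul_of_tower, ← h2, smul_smul,
      mul_inv_cancel₀ (H.pos 0).ne', one_smul, sub_sub_cancel]
  rwa [h4, sub_sub_cancel, smul_smul, inv_mul_cancel₀ (H.pos 0).ne', one_smul] at h3

theorem commute_limit (H : IsEulerFamily Γ M h r) (hT : ∀ t, 0 ≤ t → ∀ x,
    Tendsto (fun j => approx h r j t x) atTop (𝓝 (T t x))) {t : ℝ} (ht : 0 ≤ t) {x y : E}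
    (hxy : (x, y) ∈ Γ) (hΓ : IsClosed (Γ : Set (E × E))) : (T t x, T t y) ∈ Γ := by
  have : Tendsto (fun j => (approx h r j t x, approx h r j t y)) atTop (𝓝 (T t x, T t y)) :=
    (hT t ht x).prodMk_nhds (hT t ht y)
  refine hΓ.mem_of_tendsto this (Eventually.of_forall fun j => ?_)
  have : ∀ n, (((r j) ^ n) x, ((r j) ^ n) y) ∈ Γ := by
    intro n
    induction n with
    | zero => exact hxy
    | succ n ih =>
      rw [pow_succ', mul_apply_eq_comp, mul_apply_eq_comp]
      exact H.map_mem j ih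
  exact this _

end IsEulerFamily
end Euler2

/-! ### Resolvents of the difference quotients of a power bounded operator -/

section PowerBounded

variable {B : Type*} [NormedAddCommGroup B] [NormedSpace ℂ B]

/-- Although `‖W‖` may exceed `c`, some power of `a = c⁻¹ • W` has norm below one. Then `1 - a^n` is
invertible, and `1 - a` is one of its two commuting factors. -/
theorem isUnit_sub_of_pow_le [CompleteSpace B] {W : B →L[ℂ] B} {M : ℝ}
    (hW : ∀ k, ‖W ^ k‖ ≤ M) {c : ℝ} (hc : 1 < c) : IsUnit (c • (1 : B →L[ℂ] B) - W) := by
  have hc0 : c ≠ 0 := by positivity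
  set a := c⁻¹ • W with ha
  have ht : Tendsto (fun n : ℕ => (c⁻¹) ^ n * M) atTop (𝓝 0) := by
    simpa using (tendsto_pow_atTop_nhds_zero_of_lt_one (r := c⁻¹) (by positivity)
      (inv_lt_one_of_one_lt₀ hc)).mul_const M
  obtain ⟨n, hn⟩ := (ht.eventually_lt_const one_pos).exists
  have h1 : ‖a ^ n‖ < 1 := by
    rw [ha, smul_pow, norm_smul, norm_pow, Real.norm_of_nonneg (by positivity)]
    exact (mul_le_mul_of_nonneg_left (hW n) (by positivity)).trans_lt hn
  have h2 : IsUnit (1 - a ^ n) := isUnit_one_sub_of_norm_lt_one h1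
  rw [← mul_neg_geom_sum a n] at h2
  have hcomm : Commute (1 - a) (∑ i ∈ Finset.range n, a ^ i) := by
    refine Commute.sum_right _ _ _ fun i _ => ?_
    exact ((Commute.one_left a).sub_left (Commute.refl a)).pow_right i
  have h3 := (hcomm.isUnit_mul_iff.1 h2).1
  have e : c • (1 : B →L[ℂ] B) - W = (c • (1 : B →L[ℂ] B)) * (1 - a) := by
    rw [ha, mul_sub, mul_one, smul_mul_assoc, one_mul, smul_smul, mul_inv_cancel₀ hc0, one_smul]
  rw [e]
  refine IsUnit.mul ?_ h3
  refine ⟨⟨c • 1, c⁻¹ • 1, ?_, ?_⟩, rfl⟩ <;>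
  simp [smul_smul, hc0]

/-- The operator `(l - (W - 1) / τ)⁻¹`. -/
def stepRes (W : B →L[ℂ] B) (τ l : ℝ) : B →L[ℂ] B :=
  τ • Ring.inverse ((1 + l * τ) • (1 : B →L[ℂ] B) - W)

variable {W : B →L[ℂ] B} {M τ l : ℝ}

theorem stepRes_left [CompleteSpace B] (hW : ∀ k, ‖W ^ k‖ ≤ M) (hτ : 0 < τ) (hl : 0 < l) (x : B) :
    stepRes W τ l (l • x - τ⁻¹ • (W x - x)) = x := by
  have hu := isUnit_sub_of_pow_le hW (c := 1 + l * τ) (by nlinarith [mul_pos hl hτ])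
  have e := congrArg (fun S : B →L[ℂ] B => S x) (Ring.inverse_mul_cancel _ hu)
  have e2 : l • x - τ⁻¹ • (W x - x) = τ⁻¹ • (((1 + l * τ) • (1 : B →L[ℂ] B) - W) x) := by
    simp only [sub_apply, smul_apply, one_apply_eq_self]
    rw [smul_sub, smul_sub, smul_smul, mul_add, mul_comm l τ, ← mul_assoc,
      inv_mul_cancel₀ hτ.ne', add_smul]
    simp only [one_mul, mul_one]
    abel
  rw [e2, stepRes, smul_apply, ContinuousLinearMap.map_smul_of_tower, smul_smul,
    mul_inv_cancel₀ hτ.ne', one_smul]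
  exact e

theorem stepRes_right [CompleteSpace B] (hW : ∀ k, ‖W ^ k‖ ≤ M) (hτ : 0 < τ) (hl : 0 < l) (x : B) :
    l • stepRes W τ l x - τ⁻¹ • (W (stepRes W τ l x) - stepRes W τ l x) = x := by
  have hu := isUnit_sub_of_pow_le hW (c := 1 + l * τ) (by nlinarith [mul_pos hl hτ])
  have e := congrArg (fun S : B →L[ℂ] B => S x) (Ring.mul_inverse_cancel _ hu)
  set y := Ring.inverse ((1 + l * τ) • (1 : B →L[ℂ] B) - W) x with hy
  have e' : (1 + l * τ) • y - W y = x := e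
  have hs : stepRes W τ l x = τ • y := rfl
  rw [hs, ContinuousLinearMap.map_smul_of_tower, ← smul_sub, smul_smul τ⁻¹,
    inv_mul_cancel₀ hτ.ne', one_smul]
  conv_rhs => rw [← e']
  module

/-- In the equivalent norm `sup_k ‖W^k x‖` the operator `W` is a contraction, so the resolvent of
`(W - 1)/τ` has norm at most `1 / l`. Concretely, apply `W^k` to `(1 + lτ)x = τy + Wx` and take
suprema: `(1 + lτ)s ≤ τc + s`. -/
theorem orbit_le_of_eq (hW : ∀ k, ‖W ^ k‖ ≤ M) (hτ : 0 < τ) (hl : 0 < l) {x y : B} {c : ℝ}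
    (hxy : l • x - τ⁻¹ • (W x - x) = y) (hc : ∀ k, ‖(W ^ k) y‖ ≤ c) (k : ℕ) :
    ‖(W ^ k) x‖ ≤ c / l := by
  have bdd : BddAbove (range fun k => ‖(W ^ k) x‖) := by
    refine ⟨M * ‖x‖, ?_⟩
    rintro _ ⟨k, rfl⟩
    exact (W ^ k).le_of_opNorm_le (hW k) x
  set s := ⨆ k, ‖(W ^ k) x‖ with hs
  have hk : ∀ k, ‖(W ^ k) x‖ ≤ s := fun k => le_ciSup bdd k
  have e : (1 + l * τ) • x = τ • y + W x := by
    rw [← hxy, smul_sub, smul_smul τ τ⁻¹, mul_inv_cancel₀ hτ.ne']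
    module
  have h1 : ∀ k, ‖(W ^ k) x‖ ≤ (τ * c + s) / (1 + l * τ) := by
    intro k
    have hpos : 0 < 1 + l * τ := by positivity
    rw [le_div_iff₀' hpos]
    have e2 : (1 + l * τ) • (W ^ k) x = τ • (W ^ k) y + (W ^ (k + 1)) x := by
      rw [← ContinuousLinearMap.map_smul_of_tower, e, map_add,
        ContinuousLinearMap.map_smul_of_tower, pow_succ, mul_apply_eq_comp]
    have e3 := congrArg norm e2
    rw [norm_smul, Real.norm_of_nonneg hpos.le] at e3
    rw [e3]
    refine (norm_add_le _ _).trans ?_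
    rw [norm_smul, Real.norm_of_nonneg hτ.le]
    gcongr
    · exact hc k
    · exact hk (k + 1)
  have h2 : s ≤ (τ * c + s) / (1 + l * τ) := ciSup_le h1
  rw [le_div_iff₀ (by positivity)] at h2
  refine (hk k).trans ?_
  rw [le_div_iff₀ hl]
  have : τ * (s * l) ≤ τ * c := by linarith
  exact le_of_mul_le_mul_left this hτ

/-- The induction runs on the bound for whole orbits, so `M` enters once, at `m = 0`, and is not
raised to the power `m`. -/
theorem stepRes_pow_le [CompleteSpace B] (hW : ∀ k, ‖W ^ k‖ ≤ M) (hτ : 0 < τ) (hl : 0 < l)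
    (m : ℕ) : ‖(stepRes W τ l) ^ m‖ ≤ M / l ^ m := by
  have hM : 0 ≤ M := (norm_nonneg _).trans (hW 0)
  refine ContinuousLinearMap.opNorm_le_bound _ (by positivity) fun y => ?_
  have key : ∀ k, ‖(W ^ k) (((stepRes W τ l) ^ m) y)‖ ≤ M * ‖y‖ / l ^ m := by
    induction m with
    | zero =>
      intro k
      simpa using (W ^ k).le_of_opNorm_le (hW k) y
    | succ m ih =>
      intro k
      rw [pow_succ' (stepRes W τ l), mul_apply_eq_comp, pow_succ, ← div_div]
      exact orbit_le_of_eq hW hτ hl (stepRes_right hW hτ hl _) ih k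
  have := key 0
  rw [pow_zero, one_apply_eq_self] at this
  calc _ ≤ _ := this
    _ = _ := by ring

theorem stepRes_le [CompleteSpace B] (hW : ∀ k, ‖W ^ k‖ ≤ M) (hτ : 0 < τ) (hl : 0 < l) :
    ‖stepRes W τ l‖ ≤ M / l := by
  simpa using stepRes_pow_le hW hτ hl 1

end PowerBounded

/-! ### Chernoff's product formula in an ambient space -/

section Chernoff

variable {E B : Type*} [NormedAddCommGroup E] [NormedSpace ℂ E]
  [NormedAddCommGroup B] [NormedSpace ℂ B]

theorem isometry_map_real_smul (i : E →ₗᵢ[ℂ] B) (c : ℝ) (x : E) : i (c • x) = c • i x :=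
  LinearMap.map_smul_of_tower i.toLinearMap c x

/-- The power bounded operators `V τ` on the space `B` are consistent with the operator whose graph
is `Γ₀`, which acts in a space `E` embedded in `B`; its domain and the range of `m - Γ₀` are
dense in `E`. -/
structure IsChernoffFamily (Γ₀ : Submodule ℂ (E × E)) (i : E →ₗᵢ[ℂ] B) (V : ℝ → B →L[ℂ] B)
    (M m : ℝ) : Prop where
  bound : ∀ᶠ τ in 𝓝[>] (0 : ℝ), ∀ k, ‖(V τ) ^ k‖ ≤ M
  consistent : ∀ x y, (x, y) ∈ Γ₀ →
    Tendsto (fun τ : ℝ => τ⁻¹ • (V τ (i x) - i x)) (𝓝[>] 0) (𝓝 (i y))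
  dense : Dense {x | ∃ y, (x, y) ∈ Γ₀}
  pos : 0 < m
  dense_range : Dense {z | ∃ x y, (x, y) ∈ Γ₀ ∧ m • x - y = z}

namespace IsChernoffFamily

variable {Γ₀ : Submodule ℂ (E × E)} {i : E →ₗᵢ[ℂ] B} {V : ℝ → B →L[ℂ] B} {M m : ℝ}

theorem nonneg (H : IsChernoffFamily Γ₀ i V M m) : 0 ≤ M := by
  obtain ⟨τ, h⟩ := H.bound.exists
  exact (norm_nonneg _).trans (h 0)

theorem eventually_bound (H : IsChernoffFamily Γ₀ i V M m) :
    ∀ᶠ τ in 𝓝[>] (0 : ℝ), 0 < τ ∧ ∀ k, ‖(V τ) ^ k‖ ≤ M := by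
  filter_upwards [H.bound, self_mem_nhdsWithin] with τ h1 h2 using ⟨h2, h1⟩

/-- Every `(V τ - 1)/τ` satisfies this estimate through `stepRes_le`; consistency carries it over to
`Γ₀` as `τ → 0`. -/
theorem estimate_of_mem [CompleteSpace B] (H : IsChernoffFamily Γ₀ i V M m) {l : ℝ} (hl : 0 < l)
    {x y : E} (hxy : (x, y) ∈ Γ₀) : ‖x‖ ≤ M / l * ‖l • x - y‖ := by
  have h1 : Tendsto (fun τ : ℝ => M / l * ‖l • i x - τ⁻¹ • (V τ (i x) - i x)‖) (𝓝[>] 0)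
      (𝓝 (M / l * ‖l • i x - i y‖)) := ((H.consistent x y hxy).const_sub _).norm.const_mul _
  have e : ‖l • i x - i y‖ = ‖l • x - y‖ := by
    rw [← i.norm_map (l • x - y), map_sub, isometry_map_real_smul]
  rw [e] at h1
  refine ge_of_tendsto h1 ?_
  filter_upwards [H.eventually_bound] with τ ⟨hτ, hW⟩
  have := (stepRes (V τ) τ l).le_of_opNorm_le (stepRes_le hW hτ hl) (l • i x - τ⁻¹ • (V τ (i x) - i x))
  rwa [stepRes_left hW hτ hl, i.norm_map] at this

end IsChernoffFamily
end Chernoff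

/-! ### Resolvents of the closure of a consistent operator -/

section Chernoff2
variable {E B : Type*} [NormedAddCommGroup E] [NormedSpace ℂ E]
  [NormedAddCommGroup B] [NormedSpace ℂ B]

/-- The operator `R` is an inverse of `l - Γ`, where `Γ` is the graph of an operator. -/
structure IsGraphResolvent (Γ : Submodule ℂ (E × E)) (l : ℝ) (R : E →L[ℂ] E) : Prop where
  mem : ∀ z, (R z, l • R z - z) ∈ Γ
  inv : ∀ x y, (x, y) ∈ Γ → R (l • x - y) = x

namespace IsChernoffFamily

variable {Γ₀ : Submodule ℂ (E × E)} {i : E →ₗᵢ[ℂ] B} {V : ℝ → B →L[ℂ] B} {M m : ℝ}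

theorem estimate [CompleteSpace B] (H : IsChernoffFamily Γ₀ i V M m) {l : ℝ} (hl : 0 < l)
    {x y : E} (hxy : (x, y) ∈ Γ₀.topologicalClosure) : ‖x‖ ≤ M / l * ‖l • x - y‖ := by
  have hc : IsClosed {q : E × E | ‖q.1‖ ≤ M / l * ‖l • q.1 - q.2‖} :=
    isClosed_le (by fun_prop) (by fun_prop)
  exact closure_minimal (fun q hq => H.estimate_of_mem hl hq) hc hxy

theorem eq_of_sub_eq [CompleteSpace B] (H : IsChernoffFamily Γ₀ i V M m) {l : ℝ} (hl : 0 < l)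
    {x y x' y' : E} (h : (x, y) ∈ Γ₀.topologicalClosure) (h' : (x', y') ∈ Γ₀.topologicalClosure)
    (e : l • x - y = l • x' - y') : x = x' := by
  have h1 := H.estimate hl (Submodule.sub_mem _ h h')
  have h2 : l • (x - x') - (y - y') = 0 := by
    rw [smul_sub, sub_sub_sub_comm, e, sub_self]
  rw [h2, norm_zero, mul_zero] at h1
  exact sub_eq_zero.1 (norm_le_zero_iff.1 h1)

/-- On `Γ₀` the error equals `stepRes` applied to the consistency error `τ⁻¹(V τ (i x) - i x) - i
y`. Viewed as maps of the pair `(x, y)` the operators are uniformly bounded, so convergence extends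
to the closure. -/
theorem stepRes_tendsto [CompleteSpace B] (H : IsChernoffFamily Γ₀ i V M m) {l : ℝ} (hl : 0 < l)
    {x y : E} (hxy : (x, y) ∈ Γ₀.topologicalClosure) :
    Tendsto (fun τ => stepRes (V τ) τ l (i (l • x - y))) (𝓝[>] 0) (𝓝 (i x)) := by
  let L : E × E →L[ℂ] B := i.toContinuousLinearMap.comp
    (l • ContinuousLinearMap.fst ℂ E E - ContinuousLinearMap.snd ℂ E E)
  have := H.nonneg
  refine tendsto_of_mem_closure (C := M / l * ‖L‖) (f := fun τ => (stepRes (V τ) τ l).comp L)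
    (g := i.toContinuousLinearMap.comp (ContinuousLinearMap.fst ℂ E E))
    (D := (Γ₀ : Set (E × E))) ?_ ?_ hxy
  · filter_upwards [H.eventually_bound] with τ ⟨hτ, hW⟩
    refine (ContinuousLinearMap.opNorm_comp_le _ _).trans ?_
    gcongr
    exact stepRes_le hW hτ hl
  · rintro ⟨x, y⟩ hxy
    rw [tendsto_iff_norm_sub_tendsto_zero]
    have h1 : Tendsto (fun τ : ℝ => M / l * ‖τ⁻¹ • (V τ (i x) - i x) - i y‖) (𝓝[>] 0) (𝓝 0) := by
      simpa using (tendsto_iff_norm_sub_tendsto_zero.1 (H.consistent x y hxy)).const_mul (M / l)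
    refine squeeze_zero' (Eventually.of_forall fun _ => norm_nonneg _) ?_ h1
    filter_upwards [H.eventually_bound] with τ ⟨hτ, hW⟩
    have e : (stepRes (V τ) τ l).comp L (x, y) - i x =
        stepRes (V τ) τ l (τ⁻¹ • (V τ (i x) - i x) - i y) := by
      conv_lhs => rw [← stepRes_left hW hτ hl (i x)]
      rw [ContinuousLinearMap.comp_apply, ← map_sub]
      congr 1
      change i (l • x - y) - _ = _
      rw [map_sub, isometry_map_real_smul]
      abel
    change ‖(stepRes (V τ) τ l).comp L (x, y) - i x‖ ≤ _
    rw [e]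
    exact ContinuousLinearMap.le_of_opNorm_le _ (stepRes_le hW hτ hl) _

theorem exists_resolvent [CompleteSpace B] (H : IsChernoffFamily Γ₀ i V M m) {l : ℝ} (hl : 0 < l)
    (hs : ∀ z, ∃ x y, (x, y) ∈ Γ₀.topologicalClosure ∧ l • x - y = z) :
    ∃ R, IsGraphResolvent Γ₀.topologicalClosure l R ∧ ‖R‖ ≤ M / l := by
  have hs' : ∀ z, ∃ x, (x, l • x - z) ∈ Γ₀.topologicalClosure := by
    intro z
    obtain ⟨x, y, h, rfl⟩ := hs z
    exact ⟨x, by rwa [sub_sub_cancel]⟩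
  choose R hR using hs'
  have uniq : ∀ {x z}, (x, l • x - z) ∈ Γ₀.topologicalClosure → R z = x := fun {x z} h =>
    H.eq_of_sub_eq hl (hR z) h (by simp)
  let R' : E →ₗ[ℂ] E :=
    { toFun := R
      map_add' := fun z z' => uniq (by
        have := Submodule.add_mem _ (hR z) (hR z')
        rwa [Prod.mk_add_mk, sub_add_sub_comm, ← smul_add] at this)
      map_smul' := fun c z => uniq (by
        have := Submodule.smul_mem _ c (hR z)
        rwa [Prod.smul_mk, smul_sub, smul_comm c l] at this) }
  have hb : ∀ z, ‖R' z‖ ≤ M / l * ‖z‖ := fun z => by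
    have := H.estimate hl (hR z)
    rwa [sub_sub_cancel] at this
  have := H.nonneg
  refine ⟨R'.mkContinuous (M / l) hb, ⟨hR, fun x y hxy => ?_⟩, ?_⟩
  · exact uniq (by rwa [sub_sub_cancel])
  · exact LinearMap.mkContinuous_norm_le _ (by positivity) hb

/-- By `estimate`, the map `(x, y) ↦ m • x - y` is bounded below on the complete space given by the
closed graph, so its range is closed; it is dense by hypothesis. -/
theorem surj_base [CompleteSpace E] [CompleteSpace B] (H : IsChernoffFamily Γ₀ i V M m) (z : E) :
    ∃ x y, (x, y) ∈ Γ₀.topologicalClosure ∧ m • x - y = z := by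
  let Γ := Γ₀.topologicalClosure
  have hΓ : IsClosed (Γ : Set (E × E)) := Γ₀.isClosed_topologicalClosure
  have : CompleteSpace Γ := hΓ.completeSpace_coe
  have hm := H.pos
  have hM := H.nonneg
  let L : Γ →L[ℂ] E :=
    (m • ContinuousLinearMap.fst ℂ E E - ContinuousLinearMap.snd ℂ E E).comp Γ.subtypeL
  have hL : ∀ q : Γ, L q = m • q.1.1 - q.1.2 := fun q => rfl
  have hb : ∀ q : Γ, ‖q‖ ≤ (M / m + M + 1 : ℝ) * ‖L q‖ := by
    rintro ⟨⟨x, y⟩, hq⟩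
    have h1 : ‖x‖ ≤ M / m * ‖m • x - y‖ := H.estimate hm hq
    have h2 : ‖y‖ ≤ m * ‖x‖ + ‖m • x - y‖ := by
      have : y = m • x - (m • x - y) := by abel
      conv_lhs => rw [this]
      refine (norm_sub_le _ _).trans ?_
      rw [norm_smul, Real.norm_of_nonneg hm.le]
    have h3 : m * ‖x‖ ≤ M * ‖m • x - y‖ := by
      calc m * ‖x‖ ≤ m * (M / m * ‖m • x - y‖) := by gcongr
        _ = _ := by field_simp
    have h4 : 0 ≤ M / m * ‖m • x - y‖ := by positivity
    have h5 : 0 ≤ M * ‖m • x - y‖ := by positivity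
    rw [hL]
    refine max_le ?_ ?_
    · change ‖x‖ ≤ (M / m + M + 1) * ‖m • x - y‖
      nlinarith [norm_nonneg (m • x - y)]
    · change ‖y‖ ≤ (M / m + M + 1) * ‖m • x - y‖
      nlinarith [norm_nonneg (m • x - y)]
  have hcl : IsClosed (range L) := by
    have := AddMonoidHomClass.antilipschitz_of_bound L (K := ⟨M / m + M + 1, by positivity⟩) hb
    exact this.isClosed_range L.uniformContinuous
  have hd : Dense (range L) := by
    refine H.dense_range.mono ?_
    rintro _ ⟨x, y, hxy, rfl⟩
    exact ⟨⟨(x, y), subset_closure hxy⟩, rfl⟩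
  have : range L = univ := by rw [← hcl.closure_eq, hd.closure_eq]
  obtain ⟨⟨⟨x, y⟩, hq⟩, hz⟩ := (this ▸ mem_univ z : z ∈ range L)
  exact ⟨x, y, hq, hz⟩

/-- Neumann series: `(l' - B) R = 1 - (l - l') R`, and `‖R‖ ≤ M / l`. -/
theorem surj_step [CompleteSpace E] [CompleteSpace B] (H : IsChernoffFamily Γ₀ i V M m) {l l' : ℝ}
    (hl : 0 < l)
    (hll : |l' - l| * M < l)
    (hs : ∀ z, ∃ x y, (x, y) ∈ Γ₀.topologicalClosure ∧ l • x - y = z) (z : E) :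
    ∃ x y, (x, y) ∈ Γ₀.topologicalClosure ∧ l' • x - y = z := by
  obtain ⟨R, hR, hRn⟩ := H.exists_resolvent hl hs
  have hn : ‖(l - l') • R‖ < 1 := by
    rw [norm_smul, Real.norm_eq_abs, abs_sub_comm]
    calc |l' - l| * ‖R‖ ≤ |l' - l| * (M / l) := by gcongr
      _ = |l' - l| * M / l := by ring
      _ < 1 := (div_lt_one hl).2 hll
  have hu : IsUnit (1 - (l - l') • R) := isUnit_one_sub_of_norm_lt_one hn
  obtain ⟨u, hu⟩ := hu
  set y := (↑u⁻¹ : E →L[ℂ] E) z with hy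
  have h1 : y - (l - l') • R y = z := by
    have : (u : E →L[ℂ] E) ((↑u⁻¹ : E →L[ℂ] E) z) = z := by
      rw [← mul_apply_eq_comp, Units.mul_inv, one_apply_eq_self]
    rw [hu] at this
    exact this
  refine ⟨R y, l • R y - y, hR.mem y, ?_⟩
  rw [← h1]
  module

theorem surj [CompleteSpace E] [CompleteSpace B] (H : IsChernoffFamily Γ₀ i V M m) {l : ℝ}
    (hl : m ≤ l) (z : E) : ∃ x y, (x, y) ∈ Γ₀.topologicalClosure ∧ l • x - y = z := by
  have hM := H.nonneg
  have hm := H.pos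
  -- As `(q - 1) M < 1`, `surj_step` always allows `l` to grow by this fixed factor, so finitely
  -- many steps from `m` reach any larger `l`.
  set q := 1 + 1 / (2 * (M + 1)) with hq
  have hq1 : 1 < q := by rw [hq]; simp; positivity
  have key : ∀ n : ℕ, ∀ l, m ≤ l → l ≤ m * q ^ n → ∀ z, ∃ x y,
      (x, y) ∈ Γ₀.topologicalClosure ∧ l • x - y = z := by
    intro n
    induction n with
    | zero =>
      intro l h1 h2 z
      rw [pow_zero, mul_one] at h2
      rw [le_antisymm h2 h1]
      exact H.surj_base z
    | succ n ih =>
      intro l h1 h2 z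
      rcases le_total l (m * q ^ n) with h3 | h3
      · exact ih l h1 h3 z
      · have h0 : m ≤ m * q ^ n := le_mul_of_one_le_right hm.le (one_le_pow₀ hq1.le)
        refine H.surj_step (hm.trans_le h0) ?_ (ih _ h0 le_rfl) z
        rw [abs_of_nonneg (sub_nonneg.2 h3)]
        have h4 : l - m * q ^ n ≤ m * q ^ n * (1 / (2 * (M + 1))) := by
          rw [pow_succ] at h2
          have : q = 1 + 1 / (2 * (M + 1)) := hq
          calc l - m * q ^ n ≤ m * (q ^ n * q) - m * q ^ n := by linarith
            _ = m * q ^ n * (q - 1) := by ring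
            _ = _ := by rw [this]; ring
        have h5 : 0 < m * q ^ n := hm.trans_le h0
        calc (l - m * q ^ n) * M ≤ m * q ^ n * (1 / (2 * (M + 1))) * M := by gcongr
          _ = m * q ^ n * (M / (2 * (M + 1))) := by ring
          _ < m * q ^ n * 1 := by
            gcongr
            rw [div_lt_one (by positivity)]
            linarith
          _ = _ := mul_one _
  obtain ⟨n, hn⟩ := pow_unbounded_of_one_lt (l / m) hq1
  rw [div_lt_iff₀' hm] at hn
  exact key n l hl hn.le z

theorem stepRes_tendsto_resolvent [CompleteSpace B] (H : IsChernoffFamily Γ₀ i V M m) {l : ℝ}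
    (hl : 0 < l) {R : E →L[ℂ] E} (hR : IsGraphResolvent Γ₀.topologicalClosure l R) (z : E) :
    Tendsto (fun τ => stepRes (V τ) τ l (i z)) (𝓝[>] 0) (𝓝 (i (R z))) := by
  have := H.stepRes_tendsto hl (hR.mem z)
  rwa [sub_sub_cancel] at this

/-- The powers of `stepRes` converge strongly on the image of `i` to the powers of `R`. As `stepRes`
may leave that image, the induction replaces its innermost factor by `R` and controls the error by
the bound on the remaining power. -/
theorem resolvent_pow_le [CompleteSpace B] (H : IsChernoffFamily Γ₀ i V M m) {l : ℝ}
    (hl : 0 < l) {R : E →L[ℂ] E} (hR : IsGraphResolvent Γ₀.topologicalClosure l R) (k : ℕ) :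
    ‖R ^ k‖ ≤ M / l ^ k := by
  have hM := H.nonneg
  have key : ∀ k z, Tendsto (fun τ => ((stepRes (V τ) τ l) ^ k) (i z)) (𝓝[>] 0)
      (𝓝 (i ((R ^ k) z))) := by
    intro k
    induction k with
    | zero => intro z; simp
    | succ k ih =>
      intro z
      have h1 : Tendsto (fun τ => ((stepRes (V τ) τ l) ^ k)
          (stepRes (V τ) τ l (i z) - i (R z))) (𝓝[>] 0) (𝓝 0) := by
        refine squeeze_zero_norm' (a := fun τ => M / l ^ k * ‖stepRes (V τ) τ l (i z) - i (R z)‖)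
          ?_ ?_
        · filter_upwards [H.eventually_bound] with τ ⟨hτ, hW⟩
          exact ContinuousLinearMap.le_of_opNorm_le _ (stepRes_pow_le hW hτ hl k) _
        · simpa using (tendsto_iff_norm_sub_tendsto_zero.1
            (H.stepRes_tendsto_resolvent hl hR z)).const_mul (M / l ^ k)
      have h2 := h1.add (ih (R z))
      simp only [pow_succ, mul_apply_eq_comp]
      simpa using h2
  refine ContinuousLinearMap.opNorm_le_bound _ (by positivity) fun z => ?_
  rw [← i.norm_map]
  refine le_of_tendsto (key k z).norm ?_
  filter_upwards [H.eventually_bound] with τ ⟨hτ, hW⟩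
  have := ContinuousLinearMap.le_of_opNorm_le _ (stepRes_pow_le hW hτ hl k) (i z)
  rwa [i.norm_map] at this

/-- With `h j = 1 / l` and `l = m 2^j`, the operator `l R(l)` inverts `1 - h j • B`, and `‖R(l)^k‖ ≤
M / l^k` is exactly the power bound required. -/
theorem exists_eulerFamily [CompleteSpace E] [CompleteSpace B] (H : IsChernoffFamily Γ₀ i V M m) :
    ∃ h r, IsEulerFamily Γ₀.topologicalClosure M h r := by
  have hm := H.pos
  have hl : ∀ j : ℕ, m ≤ m * 2 ^ j := fun j =>
    le_mul_of_one_le_right hm.le (one_le_pow₀ (by norm_num))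
  have hl0 : ∀ j : ℕ, 0 < m * 2 ^ j := fun j => hm.trans_le (hl j)
  choose R hR _ using fun j => H.exists_resolvent (hl0 j) (H.surj (hl j))
  refine ⟨fun j => (m * 2 ^ j)⁻¹, fun j => (m * 2 ^ j) • R j, ⟨fun j => inv_pos.2 (hl0 j),
    fun j => ?_, fun j x => ?_, fun j x y hxy => ?_, fun j k => ?_, ?_⟩⟩
  · rw [pow_succ]
    field_simp
  · rw [inv_inv, smul_apply]
    exact (Γ₀.topologicalClosure.restrictScalars ℝ).smul_mem (m * 2 ^ j) ((hR j).mem x)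
  · rw [smul_apply, ← ContinuousLinearMap.map_smul_of_tower, smul_sub, smul_smul,
      mul_inv_cancel₀ (hl0 j).ne', one_smul]
    exact (hR j).inv x y hxy
  · rw [smul_pow, norm_smul, norm_pow, Real.norm_of_nonneg (hl0 j).le]
    have := H.resolvent_pow_le (hl0 j) (hR j) k
    rwa [le_div_iff₀' (pow_pos (hl0 j) k)] at this
  · refine H.dense.mono ?_
    rintro x ⟨y, hxy⟩
    exact ⟨y, subset_closure hxy⟩

end IsChernoffFamily
end Chernoff2

/-! ### Convergence of the products to the semigroup -/

section Chernoff3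
variable {E B : Type*} [NormedAddCommGroup E] [NormedSpace ℂ E]
  [NormedAddCommGroup B] [NormedSpace ℂ B]

/-- Strong convergence of bounded families is uniform on compact sets; it is applied to an orbit
segment of the semigroup. -/
theorem eventually_forall_of_isCompact {α : Type*} {l : Filter α} {f : α → E →L[ℂ] B}
    {g : E →L[ℂ] B} {C : ℝ} (hC : ∀ᶠ a in l, ‖f a‖ ≤ C)
    (h : ∀ x, Tendsto (fun a => f a x) l (𝓝 (g x))) {K : Set E} (hK : IsCompact K) {ε : ℝ}
    (hε : 0 < ε) : ∀ᶠ a in l, ∀ x ∈ K, ‖f a x - g x‖ ≤ ε := by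
  refine hK.induction_on (p := fun s => ∀ᶠ a in l, ∀ x ∈ s, ‖f a x - g x‖ ≤ ε) (by simp) ?_ ?_ ?_
  · intro s t hst ht
    filter_upwards [ht] with a ha x hx using ha x (hst hx)
  · intro s t hs ht
    filter_upwards [hs, ht] with a h1 h2 x hx using hx.elim (h1 x) (h2 x)
  · intro x _
    have hpos : 0 < |C| + ‖g‖ + 1 := by positivity
    refine ⟨Metric.ball x (ε / (2 * (|C| + ‖g‖ + 1))),
      mem_nhdsWithin_of_mem_nhds (Metric.ball_mem_nhds _ (by positivity)), ?_⟩
    filter_upwards [hC, Metric.tendsto_nhds.1 (h x) (ε / 2) (by positivity)] with a h1 h2 y hy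
    rw [mem_ball_iff_norm, lt_div_iff₀ (by positivity)] at hy
    rw [dist_eq_norm] at h2
    have e : f a y - g y = f a (y - x) + (f a x - g x) - g (y - x) := by
      rw [map_sub, map_sub]
      abel
    have h3 : ‖f a (y - x)‖ ≤ |C| * ‖y - x‖ :=
      (f a).le_of_opNorm_le (h1.trans (le_abs_self C)) _
    have h4 := g.le_opNorm (y - x)
    have h5 : ‖f a y - g y‖ ≤ ‖f a (y - x)‖ + ‖f a x - g x‖ + ‖g (y - x)‖ := by
      rw [e]
      exact (norm_sub_le _ _).trans (by gcongr; exact norm_add_le _ _)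
    nlinarith [norm_nonneg (y - x)]

namespace IsChernoffFamily

variable {Γ₀ : Submodule ℂ (E × E)} {i : E →ₗᵢ[ℂ] B} {V : ℝ → B →L[ℂ] B} {M m : ℝ}
  {T : ℝ → E →L[ℂ] E}

/-- `V τ` acts on `B` and `T` on `E`, so the two are compared through `S = stepRes (V τ) τ m`, for
which `V τ S = S + τ(m S - 1)`. One step then has the error `τ(S i v - i R v)` with `v = m • xk -
yk`, minus `S` of the Taylor remainder of `T τ`. The extra power `(V τ)^j` lets the induction use
power bounds instead of multiplying norms. -/
theorem telescope [CompleteSpace B] (H : IsChernoffFamily Γ₀ i V M m)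
    {R : E →L[ℂ] E} (hR : IsGraphResolvent Γ₀.topologicalClosure m R)
    (hT : IsC0Semigroup T) (hTM : ∀ t, 0 ≤ t → ‖T t‖ ≤ M)
    (hTΓ : ∀ t, 0 ≤ t → ∀ x y, (x, y) ∈ Γ₀.topologicalClosure →
      (T t x, T t y) ∈ Γ₀.topologicalClosure)
    {τ : ℝ} (hτ : 0 < τ) (hW : ∀ k, ‖(V τ) ^ k‖ ≤ M) {x y : E}
    (hxy : (x, y) ∈ Γ₀.topologicalClosure) {σ ε δ : ℝ}
    (hε : ∀ s ∈ Icc 0 σ, ‖stepRes (V τ) τ m (i (T s (m • x - y))) - i (R (T s (m • x - y)))‖ ≤ ε)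
    (hδ : ‖T τ x - x - τ • y‖ ≤ τ * δ) (n : ℕ) (hn : n * τ ≤ σ) (j : ℕ) :
    ‖((V τ) ^ j) (((V τ) ^ n) (stepRes (V τ) τ m (i x)) - stepRes (V τ) τ m (i (T (n * τ) x)))‖ ≤
      n * (M * (τ * ε + M / m * (M * (τ * δ)))) := by
  have hM := H.nonneg
  have hm := H.pos
  set S := stepRes (V τ) τ m with hS
  induction n generalizing j with
  | zero => simp [hT.map_zero]
  | succ n ih =>
    have hle : (n : ℝ) * τ ≤ ((n + 1 : ℕ) : ℝ) * τ := by gcongr; simp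
    have h0 : 0 ≤ (n : ℝ) * τ := by positivity
    have h1 := ih (hle.trans hn) (j + 1)
    set xk := T (n * τ) x with hxk
    set yk := T (n * τ) y with hyk
    have hk : (xk, yk) ∈ Γ₀.topologicalClosure := hTΓ _ h0 _ _ hxy
    have hv : T (n * τ) (m • x - y) = m • xk - yk := by
      rw [map_sub, ContinuousLinearMap.map_smul_of_tower]
    have hRv : R (m • xk - yk) = xk := hR.inv _ _ hk
    have hT1 : T (((n + 1 : ℕ) : ℝ) * τ) x = T (n * τ) (T τ x) := by
      rw [← ContinuousLinearMap.comp_apply, ← hT.map_add _ _ h0 hτ.le]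
      push_cast
      ring_nf
    have e1 : V τ (S (i xk)) = S (i xk) + τ • (m • S (i xk) - i xk) := by
      have e := stepRes_right hW hτ hm (i xk)
      rw [← hS] at e
      have e2 : m • S (i xk) - i xk = τ⁻¹ • (V τ (S (i xk)) - S (i xk)) := by
        rw [sub_eq_iff_eq_add, add_comm, ← sub_eq_iff_eq_add]
        exact e
      rw [e2, smul_smul, mul_inv_cancel₀ hτ.ne', one_smul]
      abel
    have e2 : V τ (S (i xk)) - S (i (T (((n + 1 : ℕ) : ℝ) * τ) x)) =
        τ • (S (i (m • xk - yk)) - i (R (m • xk - yk))) - S (i (T (n * τ) (T τ x - x - τ • y))) := by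
      rw [e1, hT1, hRv]
      simp only [map_sub, ContinuousLinearMap.map_smul_of_tower, isometry_map_real_smul,
        ← hxk, ← hyk]
      module
    have h2 : ‖V τ (S (i xk)) - S (i (T (((n + 1 : ℕ) : ℝ) * τ) x))‖ ≤
        τ * ε + M / m * (M * (τ * δ)) := by
      rw [e2]
      refine (norm_sub_le _ _).trans (add_le_add ?_ ?_)
      · rw [norm_smul, Real.norm_of_nonneg hτ.le]
        have := hε (n * τ) ⟨h0, hle.trans hn⟩
        rw [hv] at this
        gcongr
      · refine (S.le_of_opNorm_le (stepRes_le hW hτ hm) _).trans ?_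
        rw [i.norm_map]
        gcongr
        refine ((T _).le_of_opNorm_le (hTM _ h0) _).trans ?_
        gcongr
    have e3 : ((V τ) ^ j) (((V τ) ^ (n + 1)) (S (i x)) - S (i (T (((n + 1 : ℕ) : ℝ) * τ) x))) =
        ((V τ) ^ (j + 1)) (((V τ) ^ n) (S (i x)) - S (i xk)) +
        ((V τ) ^ j) (V τ (S (i xk)) - S (i (T (((n + 1 : ℕ) : ℝ) * τ) x))) := by
      rw [pow_succ (V τ) j, mul_apply_eq_comp, ← map_add, map_sub (V τ), pow_succ' (V τ) n,
        mul_apply_eq_comp, sub_add_sub_cancel]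
    rw [e3]
    refine (norm_add_le _ _).trans ?_
    have h3 := (((V τ) ^ j).le_of_opNorm_le (hW j) _).trans (mul_le_mul_of_nonneg_left h2 hM)
    refine (add_le_add h1 h3).trans_eq ?_
    push_cast
    ring

theorem tendsto_div_nat {σ : ℝ} (hσ : 0 < σ) :
    Tendsto (fun n : ℕ => σ / n) atTop (𝓝[>] 0) := by
  refine tendsto_nhdsWithin_iff.2 ⟨tendsto_const_div_atTop_nhds_zero_nat σ, ?_⟩
  filter_upwards [eventually_gt_atTop 0] with n hn
  have : (0 : ℝ) < n := by exact_mod_cast hn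
  exact div_pos hσ this

/-- It suffices to treat the dense set of vectors `R x` with `x` in the domain. The start vector `i
(R x)` may be replaced by `stepRes (i x)`, `telescope` leads to `stepRes (i (T σ x))`, and this
tends to `i (R (T σ x)) = i (T σ (R x))`. -/
theorem product_formula [CompleteSpace B] (H : IsChernoffFamily Γ₀ i V M m)
    {R : E →L[ℂ] E} (hR : IsGraphResolvent Γ₀.topologicalClosure m R)
    (hT : IsC0Semigroup T) (hTM : ∀ t, 0 ≤ t → ‖T t‖ ≤ M)
    (hTΓ : ∀ t, 0 ≤ t → ∀ x y, (x, y) ∈ Γ₀.topologicalClosure →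
      (T t x, T t y) ∈ Γ₀.topologicalClosure)
    (hTg : ∀ x y, (x, y) ∈ Γ₀.topologicalClosure →
      Tendsto (fun σ : ℝ => σ⁻¹ • (T σ x - x)) (𝓝[>] 0) (𝓝 y))
    {σ : ℝ} (hσ : 0 < σ) (x : E) :
    Tendsto (fun n : ℕ => ((V (σ / n)) ^ n) (i x)) atTop (𝓝 (i (T σ x))) := by
  have hM := H.nonneg
  have hm := H.pos
  have hlim := tendsto_div_nat hσ
  have hbd := hlim.eventually H.eventually_bound
  have hres : ∀ z, Tendsto (fun n : ℕ => stepRes (V (σ / n)) (σ / n) m (i z)) atTop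
      (𝓝 (i (R z))) := fun z => (H.stepRes_tendsto_resolvent hm hR z).comp hlim
  -- convergence of the conjugated products on the domain
  have main : ∀ x y, (x, y) ∈ Γ₀.topologicalClosure →
      Tendsto (fun n : ℕ => ((V (σ / n)) ^ n) (stepRes (V (σ / n)) (σ / n) m (i x)) -
        stepRes (V (σ / n)) (σ / n) m (i (T σ x))) atTop (𝓝 0) := by
    intro x y hxy
    rw [Metric.tendsto_nhds]
    intro ε hε
    set C := σ * (M * (1 + M / m * M)) with hC
    have hC0 : 0 ≤ C := by positivity
    set η := ε / (2 * (C + 1)) with hη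
    have hη0 : 0 < η := by positivity
    -- The resolvent error has to be small uniformly along the orbit, since it is summed over `n`
    -- steps of length `σ / n`.
    have hK : IsCompact ((fun s => T s (m • x - y)) '' Icc 0 σ) :=
      isCompact_Icc.image_of_continuousOn
        ((hT.strong_cont _).mono fun s hs => hs.1)
    have hbS : ∀ᶠ n : ℕ in atTop,
        ‖(stepRes (V (σ / n)) (σ / n) m).comp i.toContinuousLinearMap‖ ≤ M / m := by
      filter_upwards [hbd] with n ⟨h1, h2⟩
      refine ContinuousLinearMap.opNorm_le_bound _ (by positivity) fun z => ?_
      have := ContinuousLinearMap.le_of_opNorm_le _ (stepRes_le h2 h1 hm) (i z)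
      rwa [i.norm_map] at this
    have hcpt := eventually_forall_of_isCompact
      (f := fun n : ℕ => (stepRes (V (σ / n)) (σ / n) m).comp i.toContinuousLinearMap)
      (g := i.toContinuousLinearMap.comp R) hbS hres hK hη0
    have hgen := hlim.eventually (Metric.tendsto_nhds.1 (hTg x y hxy) η hη0)
    filter_upwards [hbd, hcpt, hgen, eventually_gt_atTop 0] with n ⟨h1, h2⟩ h3 h4 hn
    have hn0 : (n : ℝ) ≠ 0 := by exact_mod_cast hn.ne'
    have hnσ : (n : ℝ) * (σ / n) = σ := by field_simp
    have hδ : ‖T (σ / n) x - x - (σ / n) • y‖ ≤ (σ / n) * η := by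
      rw [dist_eq_norm] at h4
      have e : T (σ / n) x - x - (σ / n) • y =
          (σ / n) • ((σ / n)⁻¹ • (T (σ / n) x - x) - y) := by
        rw [smul_sub, smul_smul, mul_inv_cancel₀ h1.ne', one_smul]
      rw [e, norm_smul, Real.norm_of_nonneg h1.le]
      gcongr
    have := H.telescope hR hT hTM hTΓ h1 h2 hxy (σ := σ) (ε := η)
      (fun s hs => h3 _ ⟨s, hs, rfl⟩) hδ n hnσ.le 0
    rw [hnσ, pow_zero, one_apply_eq_self] at this
    rw [dist_zero_right]
    refine this.trans_lt ?_
    have e : (n : ℝ) * (M * (σ / n * η + M / m * (M * (σ / n * η)))) = C * η := by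
      rw [hC]
      field_simp
    rw [e, hη]
    calc C * (ε / (2 * (C + 1))) = (C / (C + 1)) * (ε / 2) := by field_simp
      _ ≤ 1 * (ε / 2) := by
        gcongr
        rw [div_le_one (by positivity)]
        linarith
      _ < ε := by linarith
  have hRT : ∀ x y, (x, y) ∈ Γ₀.topologicalClosure → R (T σ x) = T σ (R x) := by
    intro x y _
    have h1 := hTΓ σ hσ.le _ _ (hR.mem x)
    have h2 := hR.inv _ _ h1
    rwa [map_sub (T σ), (T σ).map_smul_of_tower, sub_sub_cancel] at h2
  have hdense : Dense (R '' {x | ∃ y, (x, y) ∈ Γ₀.topologicalClosure}) := by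
    have hd : Dense {x | ∃ y, (x, y) ∈ Γ₀.topologicalClosure} := by
      refine H.dense.mono ?_
      rintro x ⟨y, hxy⟩
      exact ⟨y, subset_closure hxy⟩
    have hsub : {x | ∃ y, (x, y) ∈ Γ₀.topologicalClosure} ⊆ range R := by
      rintro x ⟨y, hxy⟩
      exact ⟨_, hR.inv _ _ hxy⟩
    have h1 : DenseRange R := hd.mono hsub
    exact h1.dense_image R.continuous hd
  refine tendsto_of_tendsto_on_dense (C := M)
    (f := fun n : ℕ => ((V (σ / n)) ^ n).comp i.toContinuousLinearMap)
    (g := i.toContinuousLinearMap.comp (T σ)) ?_ hdense ?_ x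
  · filter_upwards [hbd] with n ⟨_, h2⟩
    refine ContinuousLinearMap.opNorm_le_bound _ hM fun z => ?_
    have := ContinuousLinearMap.le_of_opNorm_le _ (h2 n) (i z)
    rwa [i.norm_map] at this
  · rintro _ ⟨x, ⟨y, hxy⟩, rfl⟩
    have h1 : Tendsto (fun n : ℕ => ((V (σ / n)) ^ n)
        (i (R x) - stepRes (V (σ / n)) (σ / n) m (i x))) atTop (𝓝 0) := by
      refine squeeze_zero_norm' (a := fun n : ℕ =>
        M * ‖i (R x) - stepRes (V (σ / n)) (σ / n) m (i x)‖) ?_ ?_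
      · filter_upwards [hbd] with n ⟨_, h2⟩
        exact ContinuousLinearMap.le_of_opNorm_le _ (h2 n) _
      · have := ((hres x).const_sub (i (R x))).norm.const_mul M
        simpa using this
    have h2 := (h1.add (main x y hxy)).add (hres (T σ x))
    rw [hRT x y hxy, zero_add, zero_add] at h2
    refine h2.congr fun n => ?_
    rw [map_sub]
    change _ = ((V (σ / n)) ^ n) (i (R x))
    abel

/-- Chernoff's theorem for uniformly power bounded operators. -/
theorem generation [CompleteSpace E] [CompleteSpace B] (H : IsChernoffFamily Γ₀ i V M m) :
    ∃ T : ℝ → E →L[ℂ] E, IsC0Semigroup T ∧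
      (∀ x y, (x, y) ∈ Γ₀.topologicalClosure ↔
        Tendsto (fun σ : ℝ => σ⁻¹ • (T σ x - x)) (𝓝[>] 0) (𝓝 y)) ∧
      (∀ t, 0 ≤ t → ∀ x y, (x, y) ∈ Γ₀.topologicalClosure →
        (T t x, T t y) ∈ Γ₀.topologicalClosure) ∧
      ∀ σ, 0 < σ → ∀ x,
        Tendsto (fun n : ℕ => ((V (σ / n)) ^ n) (i x)) atTop (𝓝 (i (T σ x))) := by
  obtain ⟨h, r, hr⟩ := H.exists_eulerFamily
  obtain ⟨T, hT⟩ := hr.exists_limit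
  obtain ⟨R, hR, -⟩ := H.exists_resolvent H.pos (H.surj le_rfl)
  have hcl : IsClosed (Γ₀.topologicalClosure : Set (E × E)) := Γ₀.isClosed_topologicalClosure
  have hΓ : ∀ t, 0 ≤ t → ∀ x y, (x, y) ∈ Γ₀.topologicalClosure →
        (T t x, T t y) ∈ Γ₀.topologicalClosure := fun t ht x y hxy =>
    hr.commute_limit hT ht hxy hcl
  refine ⟨T, hr.isC0Semigroup hT, hr.limit_generator hT, hΓ, fun σ hσ x => ?_⟩
  exact H.product_formula hR (hr.isC0Semigroup hT) (fun t ht => hr.limit_bound hT ht) hΓ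
    (fun x y => (hr.limit_generator hT x y).1) hσ x

end IsChernoffFamily
end Chernoff3

/-! ### Reduction of exponential growth to the power bounded case -/

section Rescaling
variable {E B : Type*} [NormedAddCommGroup E] [NormedSpace ℂ E]
  [NormedAddCommGroup B] [NormedSpace ℂ B]

/-- The map `(x, y) ↦ (x, y + c x)` on pairs. -/
def graphShift (c : ℝ) : E × E ≃ₜ E × E where
  toFun q := (q.1, q.2 + c • q.1)
  invFun q := (q.1, q.2 - c • q.1)
  left_inv q := by simp
  right_inv q := by simp

/-- The graph of `B - c`, where `Γ` is the graph of `B`. -/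
def shiftedGraph (Γ : Submodule ℂ (E × E)) (c : ℝ) : Submodule ℂ (E × E) where
  carrier := graphShift c ⁻¹' Γ
  zero_mem' := by simp [graphShift, Prod.mk_zero_zero]
  add_mem' {a b} ha hb := by
    have := Γ.add_mem ha hb
    simpa [graphShift, add_add_add_comm] using this
  smul_mem' z a ha := by
    have := Γ.smul_mem z ha
    simpa [graphShift, smul_comm c z] using this

theorem mem_shiftedGraph {Γ : Submodule ℂ (E × E)} {c : ℝ} {x y : E} :
    (x, y) ∈ shiftedGraph Γ c ↔ (x, y + c • x) ∈ Γ := Iff.rfl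

theorem mem_closure_shiftedGraph {Γ : Submodule ℂ (E × E)} {c : ℝ} {x y : E} :
    (x, y) ∈ (shiftedGraph Γ c).topologicalClosure ↔ (x, y + c • x) ∈ Γ.topologicalClosure := by
  change (x, y) ∈ closure (graphShift c ⁻¹' (Γ : Set (E × E))) ↔ _
  rw [← Homeomorph.preimage_closure]
  rfl

theorem tendsto_exp_sub_one_div (c : ℝ) :
    Tendsto (fun σ : ℝ => σ⁻¹ * (Real.exp (c * σ) - 1)) (𝓝[>] 0) (𝓝 c) := by
  have h1 : HasDerivAt (fun σ : ℝ => Real.exp (c * σ)) c 0 := by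
    have := ((hasDerivAt_id (0 : ℝ)).const_mul c).exp
    simpa using this
  have h2 := h1.tendsto_slope_zero_right
  simpa using h2

theorem tendsto_exp_one (c : ℝ) :
    Tendsto (fun σ : ℝ => Real.exp (c * σ)) (𝓝[>] 0) (𝓝 1) := by
  have : Tendsto (fun σ : ℝ => Real.exp (c * σ)) (𝓝 0) (𝓝 (Real.exp (c * 0))) :=
    Continuous.tendsto (by fun_prop) 0
  rw [mul_zero, Real.exp_zero] at this
  exact this.mono_left nhdsWithin_le_nhds

theorem tendsto_quotient_exp_smul (c : ℝ) {S : ℝ → B} {x y : B}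
    (h : Tendsto (fun σ : ℝ => σ⁻¹ • (S σ - x)) (𝓝[>] 0) (𝓝 y)) :
    Tendsto (fun σ : ℝ => σ⁻¹ • (Real.exp (c * σ) • S σ - x)) (𝓝[>] 0) (𝓝 (y + c • x)) := by
  have h1 := ((tendsto_exp_one c).smul h).add ((tendsto_exp_sub_one_div c).smul_const x)
  rw [one_smul] at h1
  refine h1.congr fun σ => ?_
  module

/-- Chernoff's theorem for families of exponential type. -/
theorem exists_semigroup_of_consistent [CompleteSpace E] [CompleteSpace B]
    {Γ₀ : Submodule ℂ (E × E)} {i : E →ₗᵢ[ℂ] B} {V : ℝ → B →L[ℂ] B} {M w m : ℝ}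
    (hV : ∀ᶠ τ in 𝓝[>] (0 : ℝ), ∀ k : ℕ, ‖(V τ) ^ k‖ ≤ M * Real.exp (w * (k * τ)))
    (hcons : ∀ x y, (x, y) ∈ Γ₀ →
      Tendsto (fun τ : ℝ => τ⁻¹ • (V τ (i x) - i x)) (𝓝[>] 0) (𝓝 (i y)))
    (hdense : Dense {x | ∃ y, (x, y) ∈ Γ₀}) (hm : w < m)
    (hrange : Dense {z | ∃ x y, (x, y) ∈ Γ₀ ∧ m • x - y = z}) :
    ∃ T : ℝ → E →L[ℂ] E, IsC0Semigroup T ∧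
      (∀ x y, (x, y) ∈ Γ₀.topologicalClosure ↔
        Tendsto (fun σ : ℝ => σ⁻¹ • (T σ x - x)) (𝓝[>] 0) (𝓝 y)) ∧
      (∀ t, 0 ≤ t → ∀ x y, (x, y) ∈ Γ₀.topologicalClosure →
        (T t x, T t y) ∈ Γ₀.topologicalClosure) ∧
      ∀ σ, 0 < σ → ∀ x,
        Tendsto (fun n : ℕ => ((V (σ / n)) ^ n) (i x)) atTop (𝓝 (i (T σ x))) := by
  -- The factor `exp(-wτ)` cancels the growth in the power bounds and shifts the consistent operator
  -- by `-w`, which moves the range condition from `m` to `m - w > 0`.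
  have H : IsChernoffFamily (shiftedGraph Γ₀ w) i (fun τ => Real.exp (-w * τ) • V τ) M (m - w) := by
    refine ⟨?_, fun x y hxy => ?_, ?_, sub_pos.2 hm, ?_⟩
    · filter_upwards [hV] with τ hτ k
      rw [smul_pow, norm_smul, Real.norm_of_nonneg (by positivity), ← Real.exp_nat_mul]
      calc _ ≤ Real.exp (k * (-w * τ)) * (M * Real.exp (w * (k * τ))) := by
            gcongr
            exact hτ k
        _ = M * (Real.exp (k * (-w * τ)) * Real.exp (w * (k * τ))) := by ring
        _ = M := by
            rw [← Real.exp_add]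
            ring_nf
            simp
    · have := tendsto_quotient_exp_smul (-w) (hcons _ _ (mem_shiftedGraph.1 hxy))
      rw [map_add, isometry_map_real_smul, neg_smul, add_neg_cancel_right] at this
      exact this
    · refine hdense.mono ?_
      rintro x ⟨y, hxy⟩
      exact ⟨y - w • x, by rwa [mem_shiftedGraph, sub_add_cancel]⟩
    · refine hrange.mono ?_
      rintro z ⟨x, y, hxy, rfl⟩
      refine ⟨x, y - w • x, by rwa [mem_shiftedGraph, sub_add_cancel], ?_⟩
      module
  obtain ⟨T, hT, hg, hΓ, hp⟩ := H.generation
  have hexp : ∀ t : ℝ, Real.exp (-w * t) * Real.exp (w * t) = 1 := fun t => by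
    rw [← Real.exp_add]
    simp
  have hexp' : ∀ t : ℝ, Real.exp (w * t) * Real.exp (-w * t) = 1 := fun t => by
    rw [mul_comm, hexp]
  refine ⟨fun t => Real.exp (w * t) • T t, ⟨?_, fun σ τ hσ hτ => ?_, fun x => ?_⟩,
    fun x y => ?_, fun t ht x y hxy => ?_, fun σ hσ x => ?_⟩
  · simp [hT.map_zero]
  · rw [hT.map_add σ τ hσ hτ, mul_add, Real.exp_add]
    ext x
    simp [smul_smul, mul_comm]
  · have h : ContinuousOn (fun σ => Real.exp (w * σ)) (Ici 0) := by fun_prop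
    exact h.smul (hT.strong_cont x)
  · have e : (x, y) ∈ Γ₀.topologicalClosure ↔
        (x, y - w • x) ∈ (shiftedGraph Γ₀ w).topologicalClosure := by
      rw [mem_closure_shiftedGraph, sub_add_cancel]
    rw [e, hg]
    constructor
    · intro h
      have := tendsto_quotient_exp_smul w h
      rwa [sub_add_cancel] at this
    · intro h
      have := tendsto_quotient_exp_smul (-w) h
      rw [neg_smul, ← sub_eq_add_neg] at this
      refine this.congr fun σ => ?_
      rw [smul_apply, smul_smul, hexp, one_smul]
  · have h1 := hΓ t ht x (y - w • x) (by rwa [mem_closure_shiftedGraph, sub_add_cancel])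
    rw [mem_closure_shiftedGraph, map_sub, ContinuousLinearMap.map_smul_of_tower,
      sub_add_cancel] at h1
    exact (Γ₀.topologicalClosure.restrictScalars ℝ).smul_mem (Real.exp (w * t)) h1
  · have h1 := (hp σ hσ x).const_smul (Real.exp (w * σ))
    rw [smul_apply, isometry_map_real_smul]
    refine h1.congr' ?_
    filter_upwards [eventually_gt_atTop 0] with n hn
    have hn0 : (n : ℝ) ≠ 0 := by exact_mod_cast hn.ne'
    rw [smul_pow, smul_apply, smul_smul, ← Real.exp_nat_mul,
      show (n : ℝ) * (-w * (σ / n)) = -w * σ by field_simp, hexp', one_smul]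

end Rescaling

/-! ### Almost everywhere statements on intervals without a left end point -/

section Interval

theorem exists_lt_mem_of_not_isLeast {J : Set ℝ} (hJ : ∀ a, ¬ IsLeast J a) {t : ℝ} (ht : t ∈ J) :
    ∃ s ∈ J, s < t := by
  by_contra! h
  exact hJ t ⟨ht, h⟩

/-- Without a least element, `J` contains a nondegenerate interval ending at each of its points. A
violation at `t` would persist on a short interval to the left of `t`, which has positive measure.
This is how a.e. statements become pointwise ones. -/
theorem mem_of_ae_mem {Y : Type*} [TopologicalSpace Y] {J : Set ℝ} (hJc : J.OrdConnected)
    (hJ : ∀ a, ¬ IsLeast J a) {φ : ℝ → Y} (hφ : ContinuousOn φ J) {C : Set Y} (hC : IsClosed C)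
    (h : ∀ᵐ t ∂(volume.restrict J), φ t ∈ C) {t : ℝ} (ht : t ∈ J) : φ t ∈ C := by
  by_contra hn
  obtain ⟨s, hs, hst⟩ := exists_lt_mem_of_not_isLeast hJ ht
  have h1 : ∀ᶠ r in 𝓝[J] t, φ r ∈ Cᶜ := hφ t ht (hC.isOpen_compl.mem_nhds hn)
  obtain ⟨ε, hε, h2⟩ := Metric.mem_nhdsWithin_iff.1 h1
  rw [ae_restrict_iff' hJc.measurableSet] at h
  have h3 : volume (Ioo (max s (t - ε)) t) ≠ 0 := by
    rw [Real.volume_Ioo]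
    simp [hst, hε]
  obtain ⟨r, hr, hr'⟩ := nonempty_of_measure_ne_zero (μ := volume)
    (s := Ioo (max s (t - ε)) t ∩ {r | r ∈ J → φ r ∈ C}) (by
      rwa [measure_inter_conull (mem_ae_iff.1 h)])
  have hrJ : r ∈ J := hJc.out hs ht ⟨(le_max_left _ _).trans hr.1.le, hr.2.le⟩
  refine h2 ⟨?_, hrJ⟩ (hr' hrJ)
  have := (le_max_right s (t - ε)).trans_lt hr.1
  rw [Metric.mem_ball, Real.dist_eq, abs_lt]
  constructor <;> linarith [hr.2]

theorem ae_restrict_sub {J : Set ℝ} (hJ : MeasurableSet J) {P : ℝ → Prop}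
    (h : ∀ᵐ t ∂(volume.restrict J), P t) (τ : ℝ) : ∀ᵐ t : ℝ, t - τ ∈ J → P (t - τ) := by
  rw [ae_restrict_iff' hJ] at h
  exact (measurePreserving_sub_right volume τ).quasiMeasurePreserving.ae h

end Interval

/-! ### Continuous representatives -/

section ZeroExtension

variable {X : Type*} [NormedAddCommGroup X]

open Classical in
/-- The extension of a function on `I` by zero. -/
def zext {I : Set ℝ} (u : C₀(I, X)) (t : ℝ) : X := if h : t ∈ I then u ⟨t, h⟩ else 0

variable {I : Set ℝ}

theorem zext_of_mem (u : C₀(I, X)) {t : ℝ} (ht : t ∈ I) : zext u t = u ⟨t, ht⟩ := dif_pos ht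

theorem zext_of_notMem (u : C₀(I, X)) {t : ℝ} (ht : t ∉ I) : zext u t = 0 := dif_neg ht

theorem zext_add (u v : C₀(I, X)) (t : ℝ) : zext (u + v) t = zext u t + zext v t := by
  by_cases ht : t ∈ I
  · simp [zext_of_mem _ ht]
  · simp [zext_of_notMem _ ht]

theorem zext_sub (u v : C₀(I, X)) (t : ℝ) : zext (u - v) t = zext u t - zext v t := by
  by_cases ht : t ∈ I
  · simp [zext_of_mem _ ht]
  · simp [zext_of_notMem _ ht]

theorem zext_smul [NormedSpace ℂ X] (c : ℂ) (u : C₀(I, X)) (t : ℝ) :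
    zext (c • u) t = c • zext u t := by
  by_cases ht : t ∈ I
  · simp [zext_of_mem _ ht]
  · simp [zext_of_notMem _ ht]

theorem norm_zext_le (u : C₀(I, X)) (t : ℝ) : ‖zext u t‖ ≤ ‖u‖ := by
  by_cases ht : t ∈ I
  · rw [zext_of_mem _ ht]
    exact u.toBCF.norm_coe_le_norm ⟨t, ht⟩
  · simp [zext_of_notMem _ ht]

theorem norm_le_of_zext {u : C₀(I, X)} {C : ℝ} (hC : 0 ≤ C) (h : ∀ t ∈ I, ‖zext u t‖ ≤ C) :
    ‖u‖ ≤ C :=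
  (BoundedContinuousFunction.norm_le hC (f := u.toBCF)).2 fun t => by
    have := h t t.2
    rwa [zext_of_mem _ t.2] at this

theorem continuousOn_zext (u : C₀(I, X)) : ContinuousOn (zext u) I := by
  rw [continuousOn_iff_continuous_domRestrict]
  convert u.continuous using 1
  ext t
  exact zext_of_mem u t.2

theorem aeEqC0_iff [I.OrdConnected] {f : ℝ → X} {u : C₀(I, X)} :
    AEEqC0 I f u ↔ f =ᵐ[volume.restrict I] zext u := by
  have hI : MeasurableSet I := (‹I.OrdConnected› : I.OrdConnected).measurableSet
  constructor
  · intro h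
    filter_upwards [h, ae_restrict_mem hI] with t h1 h2
    rw [h1 h2, zext_of_mem]
  · intro h
    filter_upwards [h] with t h1 h2
    rw [h1, zext_of_mem]

theorem zext_tendsto {u : ℕ → C₀(I, X)} {v : C₀(I, X)} (h : Tendsto u atTop (𝓝 v)) (t : ℝ) :
    Tendsto (fun n => zext (u n) t) atTop (𝓝 (zext v t)) := by
  rw [tendsto_iff_norm_sub_tendsto_zero] at h ⊢
  refine squeeze_zero (fun _ => norm_nonneg _) (fun n => ?_) h
  rw [← zext_sub]
  exact norm_zext_le _ _

theorem aeEqC0_of_tendsto [I.OrdConnected] {p : ℝ≥0∞} [Fact (1 ≤ p)]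
    {f : ℕ → Lp X p (volume.restrict I)} {g : Lp X p (volume.restrict I)}
    (hf : Tendsto f atTop (𝓝 g)) {u : ℕ → C₀(I, X)} {v : C₀(I, X)} (hu : Tendsto u atTop (𝓝 v))
    (h : ∀ n, AEEqC0 I (f n) (u n)) : AEEqC0 I g v := by
  obtain ⟨ns, hns, hae⟩ := (tendstoInMeasure_of_tendsto_Lp hf).exists_seq_tendsto_ae
  rw [aeEqC0_iff]
  have h' : ∀ᵐ t ∂(volume.restrict I), ∀ n, (f n : ℝ → X) t = zext (u n) t :=
    ae_all_iff.2 fun n => aeEqC0_iff.1 (h n)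
  filter_upwards [hae, h'] with t h1 h2
  refine tendsto_nhds_unique h1 ?_
  simp_rw [h2]
  exact (zext_tendsto hu t).comp hns.tendsto_atTop

theorem zext_eq_of_aeEqC0 [I.OrdConnected] (hI : ∀ a, ¬ IsLeast I a) {f : ℝ → X} {u v : C₀(I, X)}
    (hu : AEEqC0 I f u) (hv : AEEqC0 I f v) : u = v := by
  have hc : ContinuousOn (fun t => zext u t - zext v t) I :=
    (continuousOn_zext u).sub (continuousOn_zext v)
  ext ⟨t, ht⟩
  have := mem_of_ae_mem ‹I.OrdConnected› hI hc (isClosed_singleton (x := (0 : X))) (by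
    filter_upwards [aeEqC0_iff.1 hu, aeEqC0_iff.1 hv] with t h1 h2
    rw [← h1, ← h2]
    simp) ht
  rw [zext_of_mem _ ht, zext_of_mem _ ht] at this
  exact sub_eq_zero.1 this

end ZeroExtension

/-! ### Completeness of `E_p` -/

section Complete

variable {X : Type*} [NormedAddCommGroup X] [NormedSpace ℂ X] [CompleteSpace X]

/-- Only `p = ∞` needs an argument: a.e. bounds of continuous functions hold everywhere on `I`, so
convergence in `L^∞` makes the `C₀` representatives Cauchy in the sup norm. -/
theorem isClosed_Ep {I : Set ℝ} [I.OrdConnected] (hI : ∀ a, ¬ IsLeast I a) {p : ℝ≥0∞}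
    [hp : Fact (1 ≤ p)] : IsClosed (Ep X I p : Set (Lp X p (volume.restrict I))) := by
  by_cases hp' : p = ⊤
  · subst hp'
    refine isSeqClosed_iff_isClosed.1 fun f g hf hg _ => ?_
    choose u hu using fun n => hf n rfl
    have hle : ∀ m n, ‖u m - u n‖ ≤ ‖f m - f n‖ := by
      intro m n
      refine norm_le_of_zext (norm_nonneg _) fun t ht => ?_
      have hc : ContinuousOn (fun t => ‖zext (u m - u n) t‖) I := (continuousOn_zext _).norm
      refine mem_of_ae_mem ‹I.OrdConnected› hI hc (isClosed_Iic (a := ‖f m - f n‖)) ?_ ht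
      have h1 : ∀ᵐ t ∂(volume.restrict I), ‖(f m - f n : Lp X ⊤ (volume.restrict I)) t‖ₑ ≤
          eLpNormEssSup (f m - f n : Lp X ⊤ (volume.restrict I)) (volume.restrict I) :=
        ae_le_eLpNormEssSup
      filter_upwards [h1, aeEqC0_iff.1 (hu m), aeEqC0_iff.1 (hu n), Lp.coeFn_sub (f m) (f n)]
        with t h1 h2 h3 h4
      rw [mem_Iic, zext_sub, ← h2, ← h3, ← Pi.sub_apply, ← h4, Lp.norm_def, eLpNorm_exponent_top,
        ← toReal_enorm]
      refine ENNReal.toReal_mono ?_ h1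
      rw [← eLpNorm_exponent_top]
      exact Lp.eLpNorm_ne_top _
    have hcu : CauchySeq u := by
      rw [Metric.cauchySeq_iff]
      intro ε hε
      obtain ⟨N, hN⟩ := Metric.cauchySeq_iff.1 hg.cauchySeq ε hε
      refine ⟨N, fun m hm n hn => ?_⟩
      have := hN m hm n hn
      rw [dist_eq_norm] at this ⊢
      exact (hle m n).trans_lt this
    obtain ⟨v, hv⟩ := cauchySeq_tendsto_of_complete hcu
    exact ⟨v, aeEqC0_of_tendsto hg hv hu⟩
  · have : (Ep X I p : Set (Lp X p (volume.restrict I))) = univ :=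
      eq_univ_of_forall fun f h => absurd h hp'
    rw [this]
    exact isClosed_univ

theorem completeSpace_Ep {I : Set ℝ} [I.OrdConnected] (hI : ∀ a, ¬ IsLeast I a) {p : ℝ≥0∞}
    [hp : Fact (1 ≤ p)] : CompleteSpace (Ep X I p) :=
  (isClosed_Ep hI).completeSpace_coe

end Complete

/-! ### Weighted translations -/

section Translation

variable {X : Type*} [NormedAddCommGroup X] {I : Set ℝ}

theorem aestronglyMeasurable_indicator_sub (hI : MeasurableSet I) {f : ℝ → X}
    (hf : AEStronglyMeasurable f (volume.restrict I)) (τ : ℝ) :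
    AEStronglyMeasurable (fun t => I.indicator f (t - τ)) volume :=
  ((aestronglyMeasurable_indicator_iff hI).2 hf).comp_measurePreserving
    (measurePreserving_sub_right volume τ)

theorem eLpNorm_indicator_sub_le (hI : MeasurableSet I) {f : ℝ → X}
    (hf : AEStronglyMeasurable f (volume.restrict I)) (τ : ℝ) (p : ℝ≥0∞) :
    eLpNorm (fun t => I.indicator f (t - τ)) p (volume.restrict I) ≤
      eLpNorm f p (volume.restrict I) := by
  refine (eLpNorm_mono_measure _ Measure.restrict_le_self).trans ?_
  rw [← eLpNorm_indicator_eq_eLpNorm_restrict hI]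
  exact (eLpNorm_comp_measurePreserving (g := I.indicator f) (f := fun t => t - τ)
    ((aestronglyMeasurable_indicator_iff hI).2 hf) (measurePreserving_sub_right volume τ)).le

theorem ae_indicator_sub (hI : MeasurableSet I) {f g : ℝ → X} (h : f =ᵐ[volume.restrict I] g)
    (τ : ℝ) : ∀ᵐ t ∂(volume.restrict I), I.indicator f (t - τ) = I.indicator g (t - τ) := by
  filter_upwards [ae_restrict_of_ae (ae_restrict_sub hI h τ)] with t ht
  by_cases h' : t - τ ∈ I
  · simp [h', ht h']
  · simp [h']

end Translation

/-! ### Weighted translation operators and their powers -/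

section Weighted

variable {X : Type*} [NormedAddCommGroup X] [NormedSpace ℂ X]

/-- A bounded strongly continuous family of operators on `I`. -/
structure IsWeight (I : Set ℝ) (K : ℝ → X →L[ℂ] X) (C : ℝ) : Prop where
  cont : ∀ x, ContinuousOn (fun t => K t x) I
  nonneg : 0 ≤ C
  bound : ∀ t ∈ I, ‖K t‖ ≤ C

/-- The function `t ↦ K(t) f(t - τ)`, where `f` is extended from `I` by zero. -/
def wtFun (I : Set ℝ) (K : ℝ → X →L[ℂ] X) (τ : ℝ) (f : ℝ → X) (t : ℝ) : X :=
  K t (I.indicator f (t - τ))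

variable {I : Set ℝ} {K : ℝ → X →L[ℂ] X} {C : ℝ}

theorem IsWeight.continuous_uncurry (hK : IsWeight I K C) :
    Continuous fun q : I × X => K q.1 q.2 := by
  rw [continuous_iff_continuousAt]
  rintro ⟨t, x⟩
  have h1 : Tendsto (fun q : I × X => K q.1 x) (𝓝 (t, x)) (𝓝 (K t x)) := by
    have := (continuousOn_iff_continuous_domRestrict.1 (hK.cont x)).tendsto t
    exact this.comp (continuous_fst.tendsto (t, x))
  have h2 : Tendsto (fun q : I × X => K q.1 (q.2 - x)) (𝓝 (t, x)) (𝓝 0) := by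
    refine squeeze_zero_norm (a := fun q : I × X => C * ‖q.2 - x‖)
      (fun q => (K q.1).le_of_opNorm_le (hK.bound q.1 q.1.2) _) ?_
    have : Continuous fun q : I × X => C * ‖q.2 - x‖ := by fun_prop
    simpa using this.tendsto (t, x)
  have h3 := h2.add h1
  simpa [ContinuousAt] using h3

theorem IsWeight.aestronglyMeasurable (hK : IsWeight I K C) (hI : MeasurableSet I) {g : ℝ → X}
    (hg : AEStronglyMeasurable g (volume.restrict I)) :
    AEStronglyMeasurable (fun t => K t (g t)) (volume.restrict I) := by
  have e := map_comap_subtype_coe hI (volume : Measure ℝ)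
  rw [← e] at hg ⊢
  rw [(MeasurableEmbedding.subtype_coe hI).aestronglyMeasurable_map_iff] at hg ⊢
  exact hK.continuous_uncurry.comp_aestronglyMeasurable
    (f := fun t : I => (t, g t)) (aestronglyMeasurable_id.prodMk hg)

theorem IsWeight.eLpNorm_wtFun_le (hK : IsWeight I K C) (hI : MeasurableSet I) {f : ℝ → X}
    (hf : AEStronglyMeasurable f (volume.restrict I)) (τ : ℝ) (p : ℝ≥0∞) :
    eLpNorm (wtFun I K τ f) p (volume.restrict I) ≤
      ENNReal.ofReal C * eLpNorm f p (volume.restrict I) := by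
  have h1 : ∀ᵐ t ∂(volume.restrict I), ‖wtFun I K τ f t‖ ≤ C * ‖I.indicator f (t - τ)‖ := by
    filter_upwards [ae_restrict_mem hI] with t ht
    exact (K t).le_of_opNorm_le (hK.bound t ht) _
  refine (eLpNorm_le_mul_eLpNorm_of_ae_le_mul h1 p).trans ?_
  gcongr
  exact eLpNorm_indicator_sub_le hI hf τ p

theorem IsWeight.memLp_wtFun (hK : IsWeight I K C) (hI : MeasurableSet I) {p : ℝ≥0∞} {f : ℝ → X}
    (hf : MemLp f p (volume.restrict I)) (τ : ℝ) : MemLp (wtFun I K τ f) p (volume.restrict I) :=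
  ⟨hK.aestronglyMeasurable hI (aestronglyMeasurable_indicator_sub hI hf.1 τ).restrict,
    (hK.eLpNorm_wtFun_le hI hf.1 τ p).trans_lt (ENNReal.mul_lt_top ENNReal.ofReal_lt_top hf.2)⟩

theorem wtFun_congr (hI : MeasurableSet I) {f g : ℝ → X} (h : f =ᵐ[volume.restrict I] g) (τ : ℝ) :
    wtFun I K τ f =ᵐ[volume.restrict I] wtFun I K τ g := by
  filter_upwards [ae_indicator_sub hI h τ] with t ht
  rw [wtFun, ht, wtFun]

/-- The operator `(f(t))ₜ ↦ (K(t) f(t - τ))ₜ` on `L^p(I, X)`. -/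
def wtOp (I : Set ℝ) [hI : I.OrdConnected] (p : ℝ≥0∞) [Fact (1 ≤ p)] {K : ℝ → X →L[ℂ] X} {C : ℝ}
    (hK : IsWeight I K C) (τ : ℝ) :
    Lp X p (volume.restrict I) →L[ℂ] Lp X p (volume.restrict I) :=
  LinearMap.mkContinuous
    { toFun := fun f => (hK.memLp_wtFun hI.measurableSet (Lp.memLp f) τ).toLp _
      map_add' := fun f g => by
        apply Lp.ext
        filter_upwards [MemLp.coeFn_toLp (hK.memLp_wtFun hI.measurableSet (Lp.memLp (f + g)) τ),
          MemLp.coeFn_toLp (hK.memLp_wtFun hI.measurableSet (Lp.memLp f) τ),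
          MemLp.coeFn_toLp (hK.memLp_wtFun hI.measurableSet (Lp.memLp g) τ),
          wtFun_congr (K := K) hI.measurableSet (Lp.coeFn_add f g) τ,
          Lp.coeFn_add (MemLp.toLp _ (hK.memLp_wtFun hI.measurableSet (Lp.memLp f) τ))
            (MemLp.toLp _ (hK.memLp_wtFun hI.measurableSet (Lp.memLp g) τ))] with t h1 h2 h3 h4 h5
        rw [h1, h5, h4, Pi.add_apply, h2, h3, wtFun, wtFun, wtFun, indicator_add', Pi.add_apply,
          map_add]
      map_smul' := fun c f => by
        apply Lp.ext
        filter_upwards [MemLp.coeFn_toLp (hK.memLp_wtFun hI.measurableSet (Lp.memLp (c • f)) τ),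
          MemLp.coeFn_toLp (hK.memLp_wtFun hI.measurableSet (Lp.memLp f) τ),
          wtFun_congr (K := K) hI.measurableSet (Lp.coeFn_smul c f) τ,
          Lp.coeFn_smul c (MemLp.toLp _ (hK.memLp_wtFun hI.measurableSet (Lp.memLp f) τ))]
          with t h1 h2 h4 h5
        rw [RingHom.id_apply, h1, h5, h4, Pi.smul_apply, h2, wtFun, wtFun]
        have : I.indicator (c • ⇑f) (t - τ) = c • I.indicator f (t - τ) :=
          congrFun (indicator_const_smul I c f) (t - τ)
        rw [this, map_smul] }
    C fun f => by
      change ‖MemLp.toLp _ (hK.memLp_wtFun hI.measurableSet (Lp.memLp f) τ)‖ ≤ _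
      rw [Lp.norm_toLp, Lp.norm_def, ← ENNReal.toReal_ofReal hK.nonneg, ← ENNReal.toReal_mul]
      exact ENNReal.toReal_mono (ENNReal.mul_ne_top ENNReal.ofReal_ne_top (Lp.eLpNorm_ne_top f))
        (hK.eLpNorm_wtFun_le hI.measurableSet (Lp.memLp f).1 τ p)

variable [hI : I.OrdConnected] {p : ℝ≥0∞} [Fact (1 ≤ p)]

theorem wtOp_coeFn (hK : IsWeight I K C) (τ : ℝ) (f : Lp X p (volume.restrict I)) :
    (wtOp I p hK τ f : ℝ → X) =ᵐ[volume.restrict I] wtFun I K τ f :=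
  MemLp.coeFn_toLp (hK.memLp_wtFun hI.measurableSet (Lp.memLp f) τ)

theorem norm_wtOp_le (hK : IsWeight I K C) (τ : ℝ) : ‖wtOp I p hK τ‖ ≤ C :=
  LinearMap.mkContinuous_norm_le _ hK.nonneg _

/-- The product `K(t) K(t - τ) ⋯ K(t - (k - 1) τ)`. -/
def wtProd (K : ℝ → X →L[ℂ] X) (τ : ℝ) (k : ℕ) (t : ℝ) : X →L[ℂ] X :=
  ((List.range k).map fun i : ℕ => K (t - i * τ)).prod

theorem wtProd_succ (K : ℝ → X →L[ℂ] X) (τ : ℝ) (k : ℕ) (t : ℝ) :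
    wtProd K τ (k + 1) t = K t * wtProd K τ k (t - τ) := by
  rw [wtProd, List.range_succ_eq_map, List.map_cons, List.prod_cons, List.map_map, wtProd]
  congr 3
  · simp
  · ext i : 1
    simp only [Function.comp, Nat.succ_eq_add_one, Nat.cast_add, Nat.cast_one]
    ring_nf

theorem wtOp_pow_coeFn (hK : IsWeight I K C) {τ : ℝ} (hτ : 0 ≤ τ) (k : ℕ)
    (f : Lp X p (volume.restrict I)) :
    ∀ᵐ t ∂(volume.restrict I), ((wtOp I p hK τ ^ k) f : ℝ → X) t =
      wtProd K τ k t (I.indicator f (t - k * τ)) := by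
  induction k with
  | zero =>
    filter_upwards [ae_restrict_mem hI.measurableSet] with t ht
    simp [wtProd, ht]
  | succ k ih =>
    rw [pow_succ', mul_apply_eq_comp]
    filter_upwards [wtOp_coeFn hK τ ((wtOp I p hK τ ^ k) f), ae_restrict_mem hI.measurableSet,
      ae_restrict_of_ae (ae_restrict_sub hI.measurableSet ih τ)] with t h1 h2 h3
    have e : t - ((k + 1 : ℕ) : ℝ) * τ = t - τ - k * τ := by push_cast; ring
    rw [h1, wtFun, wtProd_succ, mul_apply_eq_comp, e]
    by_cases h4 : t - τ ∈ I
    · rw [indicator_of_mem h4, h3 h4]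
    · have h5 : t - τ - k * τ ∉ I := by
        intro h5
        refine h4 (hI.out h5 h2 ⟨?_, by linarith⟩)
        have : 0 ≤ (k : ℝ) * τ := by positivity
        linarith
      simp only [indicator_of_notMem h4, indicator_of_notMem h5, map_zero]

theorem wtOp_pow_norm_le (hK : IsWeight I K C) {τ : ℝ} (hτ : 0 ≤ τ) (k : ℕ) {D : ℝ}
    (h : ∀ t ∈ I, t - k * τ ∈ I → ‖wtProd K τ k t‖ ≤ D) (f : Lp X p (volume.restrict I)) :
    ∀ᵐ t ∂(volume.restrict I), ‖((wtOp I p hK τ ^ k) f : ℝ → X) t‖ ≤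
      D * ‖I.indicator f (t - k * τ)‖ := by
  filter_upwards [wtOp_pow_coeFn hK hτ k f, ae_restrict_mem hI.measurableSet] with t h1 h2
  rw [h1]
  by_cases h3 : t - k * τ ∈ I
  · exact (wtProd K τ k t).le_of_opNorm_le (h t h2 h3) _
  · simp [h3]

/-- The product needs a bound only when both `t` and `t - k * τ` are in `I`, because the translated
function vanishes otherwise. -/
theorem norm_wtOp_pow_le (hK : IsWeight I K C) {τ : ℝ} (hτ : 0 ≤ τ) (k : ℕ) {D : ℝ} (hD : 0 ≤ D)
    (h : ∀ t ∈ I, t - k * τ ∈ I → ‖wtProd K τ k t‖ ≤ D) : ‖(wtOp I p hK τ) ^ k‖ ≤ D := by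
  refine ContinuousLinearMap.opNorm_le_bound _ hD fun f => ?_
  rw [Lp.norm_def, Lp.norm_def, ← ENNReal.toReal_ofReal hD, ← ENNReal.toReal_mul]
  refine ENNReal.toReal_mono (ENNReal.mul_ne_top ENNReal.ofReal_ne_top (Lp.eLpNorm_ne_top f)) ?_
  refine (eLpNorm_le_mul_eLpNorm_of_ae_le_mul (wtOp_pow_norm_le hK hτ k h f) p).trans ?_
  gcongr
  exact eLpNorm_indicator_sub_le hI.measurableSet (Lp.memLp f).1 _ p

end Weighted

/-! ### Weak derivatives and the fundamental theorem of calculus -/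

section WeakDerivative

variable {X : Type*} [NormedAddCommGroup X]

/-- A smooth step from `0` to `1` on `[a, a + 1 / n]`. -/
def smoothStep (n : ℕ) (a r : ℝ) : ℝ := Real.smoothTransition (n * (r - a))

theorem smoothStep_contDiff (n : ℕ) (a : ℝ) {k : ℕ∞} : ContDiff ℝ k (smoothStep n a) :=
  Real.smoothTransition.contDiff.comp (by fun_prop)

theorem smoothStep_of_le (n : ℕ) {a r : ℝ} (h : r ≤ a) : smoothStep n a r = 0 :=
  Real.smoothTransition.zero_of_nonpos (mul_nonpos_of_nonneg_of_nonpos (by positivity)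
    (sub_nonpos.2 h))

theorem smoothStep_of_ge {n : ℕ} {a r : ℝ} (h : 1 ≤ n * (r - a)) : smoothStep n a r = 1 :=
  Real.smoothTransition.one_of_one_le h

theorem smoothStep_nonneg (n : ℕ) (a r : ℝ) : 0 ≤ smoothStep n a r :=
  Real.smoothTransition.nonneg _

theorem smoothStep_le_one (n : ℕ) (a r : ℝ) : smoothStep n a r ≤ 1 :=
  Real.smoothTransition.le_one _

theorem smoothStep_monotone (n : ℕ) (a : ℝ) : Monotone (smoothStep n a) :=
  Real.smoothTransition.monotone.comp fun _ _ h => by gcongr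

theorem deriv_smoothStep_nonneg (n : ℕ) (a r : ℝ) : 0 ≤ deriv (smoothStep n a) r :=
  (smoothStep_monotone n a).deriv_nonneg

theorem continuous_deriv_smoothStep (n : ℕ) (a : ℝ) : Continuous (deriv (smoothStep n a)) :=
  (smoothStep_contDiff n a (k := 1)).continuous_deriv le_rfl

theorem deriv_smoothStep_of_lt (n : ℕ) {a r : ℝ} (h : r < a) : deriv (smoothStep n a) r = 0 := by
  have : smoothStep n a =ᶠ[𝓝 r] fun _ => 0 := by
    filter_upwards [Iio_mem_nhds h] with s hs using smoothStep_of_le n (le_of_lt hs)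
  rw [this.deriv_eq, deriv_const]

theorem deriv_smoothStep_of_gt {n : ℕ} {a r : ℝ} (h : 1 < n * (r - a)) :
    deriv (smoothStep n a) r = 0 := by
  have hc : Continuous fun s : ℝ => (n : ℝ) * (s - a) := by fun_prop
  have : smoothStep n a =ᶠ[𝓝 r] fun _ => 1 := by
    filter_upwards [(isOpen_Ioi.preimage hc).mem_nhds h] with s hs
    exact smoothStep_of_ge (le_of_lt hs)
  rw [this.deriv_eq, deriv_const]

theorem integral_deriv_smoothStep {n : ℕ} {a b : ℝ} (h : 1 ≤ n * (b - a)) :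
    ∫ r in a..b, deriv (smoothStep n a) r = 1 := by
  rw [intervalIntegral.integral_deriv_eq_sub
    (fun r _ => ((smoothStep_contDiff n a (k := 1)).differentiable (by simp)).differentiableAt)
    ((continuous_deriv_smoothStep n a).intervalIntegrable _ _),
    smoothStep_of_ge h, smoothStep_of_le n le_rfl, sub_zero]

/-- The derivatives of the steps form a one-sided approximate identity at `a`: nonnegative, of mass
one, and concentrated on `[a, a + 1 / n]`. -/
theorem tendsto_integral_deriv_smoothStep [NormedSpace ℝ X] [CompleteSpace X] {u : ℝ → X} {a b : ℝ}
    (hab : a < b) (hu : ContinuousOn u (Icc a b)) :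
    Tendsto (fun n : ℕ => ∫ r in a..b, deriv (smoothStep n a) r • u r) atTop (𝓝 (u a)) := by
  rw [Metric.tendsto_nhds]
  intro ε hε
  have h1 := hu a (left_mem_Icc.2 hab.le)
  obtain ⟨δ, hδ, h2⟩ := Metric.continuousWithinAt_iff.1 h1 (ε / 2) (half_pos hε)
  have hn : Tendsto (fun n : ℕ => (n : ℝ) * min (b - a) (δ / 2)) atTop atTop :=
    tendsto_natCast_atTop_atTop.atTop_mul_const (lt_min (sub_pos.2 hab) (half_pos hδ))
  filter_upwards [hn.eventually_ge_atTop 1] with n hn1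
  have hn2 : 1 ≤ (n : ℝ) * (b - a) := hn1.trans (by gcongr; exact min_le_left _ _)
  have hn3 : 1 ≤ (n : ℝ) * (δ / 2) := hn1.trans (by gcongr; exact min_le_right _ _)
  have hc := continuous_deriv_smoothStep n a
  have hci : IntervalIntegrable (deriv (smoothStep n a)) volume a b := hc.intervalIntegrable _ _
  have hui : IntervalIntegrable (fun r => deriv (smoothStep n a) r • u r) volume a b := by
    refine ContinuousOn.intervalIntegrable ?_
    rw [uIcc_of_le hab.le]
    exact hc.continuousOn.smul hu
  have e : (∫ r in a..b, deriv (smoothStep n a) r • u r) - u a =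
      ∫ r in a..b, deriv (smoothStep n a) r • (u r - u a) := by
    simp_rw [smul_sub]
    rw [intervalIntegral.integral_sub hui (hci.smul_continuousOn continuousOn_const),
      intervalIntegral.integral_smul_const, integral_deriv_smoothStep hn2, one_smul]
  have hpt : ∀ r ∈ Ioc a b, ‖deriv (smoothStep n a) r • (u r - u a)‖ ≤
      deriv (smoothStep n a) r * (ε / 2) := by
    intro r hr
    rw [norm_smul, Real.norm_of_nonneg (deriv_smoothStep_nonneg n a r)]
    by_cases h3 : 1 < n * (r - a)
    · rw [deriv_smoothStep_of_gt h3]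
      simp
    · have h4 : r - a < δ := by
        by_contra! h5
        have hn0 : (0 : ℝ) < n := by
          by_contra! h0
          nlinarith
        nlinarith
      have h5 := h2 (Ioc_subset_Icc_self hr) (by
        rw [Real.dist_eq, abs_of_pos (sub_pos.2 hr.1)]
        exact h4)
      rw [dist_eq_norm] at h5
      exact mul_le_mul_of_nonneg_left h5.le (deriv_smoothStep_nonneg n a r)
  rw [dist_eq_norm, e]
  refine (intervalIntegral.norm_integral_le_of_norm_le hab.le
    ((ae_restrict_iff' measurableSet_Ioc).1 ((ae_restrict_mem measurableSet_Ioc).mono hpt))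
    (hci.mul_const _)).trans_lt ?_
  rw [intervalIntegral.integral_mul_const, integral_deriv_smoothStep hn2]
  linarith

end WeakDerivative

/-! ### Behaviour at the missing left end point -/

section LeftEndpoint

/-- A nonempty compact subset of `I` has a minimum, which lies strictly above `sInf I`; so the
sequence leaves every compact subset of `I`. -/
theorem tendsto_apply_of_tendsto_sInf {X : Type*} [NormedAddCommGroup X] {I : Set ℝ}
    (hI : ∀ a, ¬ IsLeast I a) (hb : BddBelow I) (u : C₀(I, X)) {s : ℕ → ℝ} (hs : ∀ n, s n ∈ I)
    (hlim : Tendsto s atTop (𝓝 (sInf I))) : Tendsto (fun n => zext u (s n)) atTop (𝓝 0) := by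
  have h1 : Tendsto (fun n => (⟨s n, hs n⟩ : I)) atTop (cocompact I) := by
    intro S hS
    obtain ⟨K, hK, hKS⟩ := Filter.mem_cocompact.1 hS
    refine Filter.mem_of_superset ?_ (preimage_mono hKS)
    rcases K.eq_empty_or_nonempty with rfl | hne
    · simp
    · obtain ⟨m, hmK, hm⟩ := hK.exists_isLeast hne
      have hlt : sInf I < m := by
        refine lt_of_le_of_ne (csInf_le hb m.2) fun h => hI m ⟨m.2, fun r hr => ?_⟩
        rw [← h]
        exact csInf_le hb hr
      rw [Filter.mem_map]
      filter_upwards [hlim.eventually_lt_const hlt] with n hn hnK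
      exact absurd (hm hnK) (not_le.2 hn)
  refine ((zero_at_infty u).comp h1).congr fun n => ?_
  rw [zext_of_mem u (hs n)]
  rfl

variable {X : Type*} [NormedAddCommGroup X] [NormedSpace ℂ X]
  {I : Set ℝ} [hIc : I.OrdConnected] {p : ℝ≥0∞} [hp : Fact (1 ≤ p)]

theorem locallyIntegrable_indicator_rep (g : Ep X I p) :
    LocallyIntegrable (I.indicator (rep g)) :=
  ((memLp_indicator_iff_restrict hIc.measurableSet).2
    (Lp.memLp (g : Lp X p (volume.restrict I)))).locallyIntegrable hp.out

theorem intervalIntegrable_indicator_rep (g : Ep X I p) (a b : ℝ) :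
    IntervalIntegrable (I.indicator (rep g)) volume a b :=
  ((locallyIntegrable_indicator_rep g).integrableOn_isCompact isCompact_uIcc).intervalIntegrable

end LeftEndpoint

/-! ### The fundamental theorem of calculus for weak derivatives -/

section WeakDerivative2

variable {X : Type*} [NormedAddCommGroup X] [NormedSpace ℂ X] [CompleteSpace X]

/-- Test the weak derivative with `smoothStep n s - smoothStep n t`, a smooth approximation of the
indicator of `(s, t]`. The derivatives of the two steps pick out `u s` and `u t`; the point `t' > t`
leaves room for the second step inside the interior. -/
theorem sub_eq_integral_of_interior {I : Set ℝ} [hI : I.OrdConnected] {f g u : ℝ → X}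
    (hw : IsWeakDeriv I f g) (hfu : f =ᵐ[volume.restrict I] u) (hu : ContinuousOn u I)
    (hg : LocallyIntegrable (I.indicator g)) {s t t' : ℝ} (hs : s ∈ interior I)
    (ht' : t' ∈ interior I) (hst : s < t) (htt : t < t') :
    u t - u s = ∫ r in s..t, I.indicator g r := by
  have hIcc : Icc s t' ⊆ interior I := hI.interior.out hs ht'
  have hIcc' : Icc s t' ⊆ I := hIcc.trans interior_subset
  have hIm := hI.measurableSet
  have hlarge : ∀ᶠ n : ℕ in atTop, 1 ≤ (n : ℝ) * (t' - t) :=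
    (tendsto_natCast_atTop_atTop.atTop_mul_const (sub_pos.2 htt)).eventually_ge_atTop 1
  -- both sides of the definition of the weak derivative
  have hL : ∀ a ∈ Icc s t, Tendsto
      (fun n : ℕ => ∫ r in I, deriv (smoothStep n a) r • u r) atTop (𝓝 (u a)) := by
    intro a ha
    have hat : a < t' := ha.2.trans_lt htt
    have h1 := tendsto_integral_deriv_smoothStep hat
      (hu.mono ((Icc_subset_Icc_left ha.1).trans hIcc'))
    refine h1.congr' ?_
    filter_upwards [hlarge] with n hn
    rw [intervalIntegral.integral_of_le hat.le, ← integral_Icc_eq_integral_Ioc]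
    refine (setIntegral_eq_of_subset_of_forall_sdiff_eq_zero hIm
      ((Icc_subset_Icc_left ha.1).trans hIcc') fun r hr => ?_).symm
    rcases lt_or_ge r a with h | h
    · rw [deriv_smoothStep_of_lt n h, zero_smul]
    · have h2 : t' < r := by
        by_contra! h3
        exact hr.2 ⟨h, h3⟩
      rw [deriv_smoothStep_of_gt, zero_smul]
      have hn0 : (0 : ℝ) < n := by
        by_contra! h0
        nlinarith
      have := ha.2
      nlinarith
  have hφ : ∀ᶠ n : ℕ in atTop, (∫ r in I, deriv (smoothStep n s) r • u r) -
      (∫ r in I, deriv (smoothStep n t) r • u r) =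
      -∫ r in Ioc s t', (smoothStep n s r - smoothStep n t r) • I.indicator g r := by
    filter_upwards [hlarge] with n hn
    set φ : ℝ → ℝ := fun r => smoothStep n s r - smoothStep n t r with hφdef
    have hφ0 : ∀ r, r ∉ Ioc s t' → φ r = 0 := by
      intro r hr
      rcases le_or_gt r s with h | h
      · simp only [hφdef]
        rw [smoothStep_of_le n h, smoothStep_of_le n (h.trans hst.le), sub_zero]
      · have h2 : t' < r := by
          by_contra! h3
          exact hr ⟨h, h3⟩
        have hn0 : (0 : ℝ) < n := by
          by_contra! h0
          nlinarith
        simp only [hφdef]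
        rw [smoothStep_of_ge (by nlinarith), smoothStep_of_ge (by nlinarith), sub_self]
    have hsupp : tsupport φ ⊆ Icc s t' := by
      refine closure_minimal (fun r hr => ?_) isClosed_Icc
      by_contra h
      exact hr (hφ0 r fun h' => h (Ioc_subset_Icc_self h'))
    have hcs : HasCompactSupport φ := isCompact_Icc.of_isClosed_subset (isClosed_tsupport _) hsupp
    have hcd : ContDiff ℝ (⊤ : ℕ∞) φ := (smoothStep_contDiff n s).sub (smoothStep_contDiff n t)
    have h1 := hw φ hcd hcs (hsupp.trans hIcc)
    have e1 : (∫ r in I, deriv φ r • f r) = (∫ r in I, deriv (smoothStep n s) r • u r) -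
        (∫ r in I, deriv (smoothStep n t) r • u r) := by
      have hint : ∀ a ∈ Icc s t, Integrable (fun r => deriv (smoothStep n a) r • u r)
          (volume.restrict I) := by
        intro a ha
        have hco : ContinuousOn (fun r => deriv (smoothStep n a) r • u r) (Icc s t') :=
          (continuous_deriv_smoothStep n a).continuousOn.smul (hu.mono hIcc')
        have h2 := hco.integrableOn_Icc (μ := volume)
        refine (integrableOn_iff_integrable_of_support_subset ?_).1
          (h2.restrict (s := Icc s t') (t := I)) |>.mono_measure le_rfl
        intro r hr
        by_contra h3
        refine hr ?_
        rcases lt_or_ge r a with h | h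
        · simp only [deriv_smoothStep_of_lt n h, zero_smul]
        · have h2 : t' < r := by
            by_contra! h4
            exact h3 ⟨ha.1.trans h, h4⟩
          have hn0 : (0 : ℝ) < n := by
            by_contra! h0
            nlinarith
          have := ha.2
          simp only [deriv_smoothStep_of_gt (n := n) (a := a) (r := r) (by nlinarith), zero_smul]
      rw [← integral_sub (hint s ⟨le_rfl, hst.le⟩) (hint t ⟨hst.le, le_rfl⟩)]
      refine integral_congr_ae ?_
      filter_upwards [hfu] with r hr
      have hd : deriv φ r = deriv (smoothStep n s) r - deriv (smoothStep n t) r :=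
        deriv_fun_sub ((smoothStep_contDiff n s (k := 1)).differentiable (by simp)).differentiableAt
          ((smoothStep_contDiff n t (k := 1)).differentiable (by simp)).differentiableAt
      rw [hr, hd, sub_smul]
    rw [← e1, h1]
    congr 1
    have e2 : (∫ r in I, φ r • g r) = ∫ r in I, φ r • I.indicator g r := by
      refine setIntegral_congr_fun hIm fun r hr => ?_
      simp only [indicator_of_mem hr]
    rw [e2]
    refine setIntegral_eq_of_subset_of_forall_sdiff_eq_zero hIm
      (Ioc_subset_Icc_self.trans hIcc') fun r hr => ?_
    rw [hφ0 r hr.2, zero_smul]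
  have hR : Tendsto (fun n : ℕ => ∫ r in Ioc s t', (smoothStep n s r - smoothStep n t r) •
      I.indicator g r) atTop (𝓝 (∫ r in Ioc s t', (Ioc s t).indicator (I.indicator g) r)) := by
    have hgi : IntegrableOn (I.indicator g) (Ioc s t') :=
      (hg.integrableOn_isCompact isCompact_Icc).mono_set Ioc_subset_Icc_self
    refine tendsto_integral_of_dominated_convergence (fun r => ‖I.indicator g r‖) (fun n => ?_)
      hgi.norm (fun n => ?_) ?_
    · exact (((smoothStep_contDiff n s (k := 0)).continuous.sub
        (smoothStep_contDiff n t (k := 0)).continuous).aestronglyMeasurable).smul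
        hgi.aestronglyMeasurable
    · refine Eventually.of_forall fun r => ?_
      rw [norm_smul]
      refine mul_le_of_le_one_left (norm_nonneg _) ?_
      rw [Real.norm_eq_abs, abs_le]
      constructor <;> linarith [smoothStep_nonneg n s r, smoothStep_nonneg n t r,
        smoothStep_le_one n s r, smoothStep_le_one n t r]
    · filter_upwards [ae_restrict_mem measurableSet_Ioc] with r hr
      have ev : ∀ a < r, ∀ᶠ n : ℕ in atTop, smoothStep n a r = 1 := fun a ha => by
        filter_upwards [(tendsto_natCast_atTop_atTop.atTop_mul_const
          (sub_pos.2 ha)).eventually_ge_atTop (1 : ℝ)] with n hn using smoothStep_of_ge hn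
      refine tendsto_const_nhds.congr' ?_
      rcases le_or_gt r t with h | h
      · filter_upwards [ev s hr.1] with n hn
        rw [hn, smoothStep_of_le n h, sub_zero, one_smul, indicator_of_mem (show r ∈ Ioc s t from ⟨hr.1, h⟩)]
      · filter_upwards [ev s hr.1, ev t h] with n h1 h2
        rw [h1, h2, sub_self, zero_smul, indicator_of_notMem (show r ∉ Ioc s t from fun h3 => h.not_ge h3.2)]
  have h1 := (hL s ⟨le_rfl, hst.le⟩).sub (hL t ⟨hst.le, le_rfl⟩)
  have h2 := tendsto_nhds_unique (h1.congr' hφ) hR.neg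
  rw [setIntegral_indicator measurableSet_Ioc,
    inter_eq_right.2 (Ioc_subset_Ioc_right htt.le)] at h2
  rw [intervalIntegral.integral_of_le hst.le, ← neg_sub, h2, neg_neg]

variable {I : Set ℝ} [hIc : I.OrdConnected] {p : ℝ≥0∞} [hp : Fact (1 ≤ p)]

/-- A point of `I` below `s` makes `s` interior, but `t` may be a right end point of `I`. The
interior formula therefore gives the identity on `(s, t)`, and continuity carries it to `t`. -/
theorem sub_eq_integral_of_mem {f g : Ep X I p}
    (hw : IsWeakDeriv I (rep f) (rep g)) {u : C₀(I, X)} (hu : AEEqC0 I (rep f) u) {s t : ℝ}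
    (hs : s ∈ I) (ht : t ∈ I) (hst : s < t) (hI : ∀ a, ¬ IsLeast I a) :
    zext u t - zext u s = ∫ r in s..t, I.indicator (rep g) r := by
  obtain ⟨s₀, hs₀, hlt⟩ := exists_lt_mem_of_not_isLeast hI hs
  have hint : Ioo s₀ t ⊆ interior I :=
    interior_maximal (fun r hr => hIc.out hs₀ ht ⟨hr.1.le, hr.2.le⟩) isOpen_Ioo
  have hloc := locallyIntegrable_indicator_rep g
  have hJ : ∀ a, ¬ IsLeast (Ioc s t) a := fun a ha => by
    have h1 := ha.1.1
    have h2 : (s + a) / 2 ∈ Ioc s t := ⟨by linarith, by linarith [ha.1.2]⟩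
    linarith [ha.2 h2]
  have hsub : Ioc s t ⊆ I := fun r hr => hIc.out hs ht ⟨hr.1.le, hr.2⟩
  have hprim : Continuous fun r => ∫ x in s..r, I.indicator (rep g) x :=
    intervalIntegral.continuous_primitive (intervalIntegrable_indicator_rep g) s
  have hc : ContinuousOn (fun r => zext u r - ∫ x in s..r, I.indicator (rep g) x) (Ioc s t) :=
    ((continuousOn_zext u).mono hsub).sub hprim.continuousOn
  have key := mem_of_ae_mem ordConnected_Ioc hJ hc (isClosed_singleton (x := zext u s)) (by
    have hne : ∀ᵐ r ∂(volume.restrict (Ioc s t)), r ≠ t :=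
      ae_restrict_of_ae (Measure.ae_ne volume t)
    filter_upwards [ae_restrict_mem measurableSet_Ioc, hne] with r hr hrt
    have hrt' : r < t := lt_of_le_of_ne hr.2 hrt
    have := sub_eq_integral_of_interior hw (aeEqC0_iff.1 hu) (continuousOn_zext u) hloc
      (hint ⟨hlt, hst⟩) (hint (show (r + t) / 2 ∈ Ioo s₀ t from ⟨by linarith [hr.1], by linarith⟩)) hr.1
      (by linarith)
    rw [mem_singleton_iff, ← this, sub_sub_cancel]) (right_mem_Ioc.2 hst)
  rw [mem_singleton_iff] at key
  rw [← key, sub_sub_cancel]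

/-- The fundamental theorem of calculus for functions in `W₀^{1,p}(I, X)`. -/
theorem zext_sub_eq_integral {f g : Ep X I p}
    (hw : IsWeakDeriv I (rep f) (rep g)) {u : C₀(I, X)} (hu : AEEqC0 I (rep f) u)
    (hI : ∀ a, ¬ IsLeast I a) {t : ℝ} (ht : t ∈ I) {τ : ℝ} (hτ : 0 ≤ τ) :
    zext u t - zext u (t - τ) = ∫ r in (t - τ)..t, I.indicator (rep g) r := by
  rcases hτ.eq_or_lt with rfl | hτ
  · simp
  by_cases hc : t - τ ∈ I
  · exact sub_eq_integral_of_mem hw hu hc ht (by linarith) hI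
  -- When `t - τ` is outside `I`, it lies at or below `sInf I`. The identity is then a limit of the
  -- interior one, since `u` vanishes at the left end and the integrand vanishes to the left of `I`.
  have hlow : ∀ s ∈ I, t - τ ≤ s := by
    intro s hs
    by_contra! h
    exact hc (hIc.out hs ht ⟨h.le, by linarith⟩)
  have hb : BddBelow I := ⟨_, hlow⟩
  have hne : I.Nonempty := ⟨t, ht⟩
  have hinf : sInf I ∉ I := fun h => hI _ ⟨h, fun s hs => csInf_le hb hs⟩
  obtain ⟨s, -, hlim, hs⟩ := exists_seq_tendsto_sInf hne hb
  have hlt : sInf I < t := lt_of_le_of_ne (csInf_le hb ht) fun h => hinf (h ▸ ht)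
  have hca : t - τ ≤ sInf I := le_csInf hne hlow
  have hprim : Continuous fun r => ∫ x in r..t, I.indicator (rep g) x := by
    simp_rw [intervalIntegral.integral_symm t]
    exact (intervalIntegral.continuous_primitive (intervalIntegrable_indicator_rep g) t).neg
  have h1 : Tendsto (fun n => zext u t - zext u (s n)) atTop (𝓝 (zext u t - 0)) :=
    (tendsto_apply_of_tendsto_sInf hI hb u hs hlim).const_sub _
  have h2 := (hprim.tendsto (sInf I)).comp hlim
  have h3 := tendsto_nhds_unique (h2.congr' (by
    filter_upwards [hlim.eventually_lt_const hlt] with n hn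
    exact (sub_eq_integral_of_mem hw hu (hs n) ht hn hI).symm)) h1
  rw [zext_of_notMem u hc, ← h3, ← intervalIntegral.integral_add_adjacent_intervals
    (intervalIntegrable_indicator_rep g (t - τ) (sInf I))
    (intervalIntegrable_indicator_rep g (sInf I) t)]
  have h4 : ∫ x in (t - τ)..(sInf I), I.indicator (rep g) x = 0 := by
    refine intervalIntegral.integral_zero_ae (Eventually.of_forall fun x hx => ?_)
    rw [uIoc_of_le hca] at hx
    refine indicator_of_notMem (fun hxI => ?_) _
    exact hinf (le_antisymm hx.2 (csInf_le hb hxI) ▸ hxI)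
  rw [h4, zero_add]

end WeakDerivative2

/-! ### Averages over short intervals -/

section Average

variable {X : Type*} [NormedAddCommGroup X]

/-- The normalized Lebesgue measure on `(0, τ]`. -/
def avgMeasure (τ : ℝ) : Measure ℝ := (ENNReal.ofReal τ)⁻¹ • volume.restrict (Ioc 0 τ)

theorem isProbabilityMeasure_avgMeasure {τ : ℝ} (hτ : 0 < τ) :
    IsProbabilityMeasure (avgMeasure τ) := by
  constructor
  rw [avgMeasure, Measure.smul_apply, Measure.restrict_apply_univ, Real.volume_Ioc, sub_zero,
    smul_eq_mul, ENNReal.inv_mul_cancel]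
  · simpa using hτ
  · exact ENNReal.ofReal_ne_top

theorem lintegral_sub_eq (φ : ℝ → ℝ≥0∞) (t τ : ℝ) :
    ∫⁻ r in Ioc 0 τ, φ (t - r) = ∫⁻ r in Ioc (t - τ) t, φ r := by
  have h1 : ∫⁻ r in Ioc 0 τ, φ (t - r) = ∫⁻ r in Ico (t - τ) t, φ r := by
    rw [← (Measure.measurePreserving_sub_left volume t).setLIntegral_comp_preimage_emb
      (MeasurableEquiv.subLeft t).measurableEmbedding]
    congr 2
    swap
    · ext r
      simp
    ext r
    simp only [mem_Ioc, mem_preimage, mem_Ico]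
    constructor <;> rintro ⟨h1, h2⟩ <;> constructor <;> linarith
  rw [h1]
  exact setLIntegral_congr Ico_ae_eq_Ioc

/-- Averaging contracts `L^p`: for finite `p` by Jensen's inequality for a probability measure,
Tonelli and translation invariance, for `p = ∞` directly. -/
theorem eLpNorm_lintegral_avg_le {f : ℝ → X} (hf : StronglyMeasurable f) {τ : ℝ} (hτ : 0 < τ)
    {p : ℝ≥0∞} (hp : 1 ≤ p) :
    eLpNorm (fun t => ∫⁻ r, ‖f (t - r)‖ₑ ∂(avgMeasure τ)) p volume ≤ eLpNorm f p volume := by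
  have := isProbabilityMeasure_avgMeasure hτ
  have hfm : Measurable fun q : ℝ × ℝ => ‖f (q.1 - q.2)‖ₑ :=
    (hf.comp_measurable (by fun_prop : Measurable fun q : ℝ × ℝ => q.1 - q.2)).enorm
  have hsm : ∀ t, AEStronglyMeasurable (fun r => f (t - r)) (avgMeasure τ) := fun t =>
    (hf.comp_measurable (by fun_prop)).aestronglyMeasurable
  by_cases hp' : p = ⊤
  · subst hp'
    rw [eLpNorm_exponent_top, eLpNorm_exponent_top]
    refine eLpNormEssSup_le_of_ae_enorm_bound (Eventually.of_forall fun t => ?_)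
    rw [enorm_eq_self]
    have h1 : ∀ᵐ r ∂(avgMeasure τ), ‖f (t - r)‖ₑ ≤ eLpNormEssSup f volume := by
      have h2 : ∀ᵐ r : ℝ, ‖f (t - r)‖ₑ ≤ eLpNormEssSup f volume :=
        (Measure.measurePreserving_sub_left volume t).quasiMeasurePreserving.ae
          (ae_le_eLpNormEssSup (f := f))
      exact Measure.ae_smul_measure (ae_restrict_of_ae h2) _
    refine (lintegral_mono_ae h1).trans ?_
    simp
  · have hp0 : p ≠ 0 := (one_pos.trans_le hp).ne'
    have hq : 0 < p.toReal := ENNReal.toReal_pos hp0 hp'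
    rw [eLpNorm_eq_lintegral_rpow_enorm_toReal hp0 hp',
      eLpNorm_eq_lintegral_rpow_enorm_toReal hp0 hp']
    refine ENNReal.rpow_le_rpow ?_ (by positivity)
    have h1 : ∀ t, ‖∫⁻ r, ‖f (t - r)‖ₑ ∂(avgMeasure τ)‖ₑ ^ p.toReal ≤
        ∫⁻ r, ‖f (t - r)‖ₑ ^ p.toReal ∂(avgMeasure τ) := by
      intro t
      have h2 := eLpNorm_le_eLpNorm_of_exponent_le hp (hsm t)
      rw [eLpNorm_one_eq_lintegral_enorm, eLpNorm_eq_lintegral_rpow_enorm_toReal hp0 hp'] at h2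
      have h3 := ENNReal.rpow_le_rpow h2 hq.le
      rwa [← ENNReal.rpow_mul, one_div, inv_mul_cancel₀ hq.ne', ENNReal.rpow_one] at h3
    refine (lintegral_mono h1).trans ?_
    rw [lintegral_lintegral_swap (hfm.pow_const _).aemeasurable]
    have h4 : ∀ r : ℝ, ∫⁻ t, ‖f (t - r)‖ₑ ^ p.toReal = ∫⁻ t, ‖f t‖ₑ ^ p.toReal := fun r =>
      lintegral_sub_right_eq_self (fun t => ‖f t‖ₑ ^ p.toReal) r
    simp_rw [h4]
    simp

theorem enorm_avg_le {f : ℝ → X} {τ : ℝ} (hτ : 0 < τ) (t : ℝ) :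
    ‖τ⁻¹ * ∫ r in (t - τ)..t, ‖f r‖‖ₑ ≤ ∫⁻ r, ‖f (t - r)‖ₑ ∂(avgMeasure τ) := by
  rw [enorm_mul, avgMeasure, lintegral_smul_measure, lintegral_sub_eq (fun r => ‖f r‖ₑ),
    intervalIntegral.integral_of_le (by linarith), smul_eq_mul]
  gcongr
  · rw [Real.enorm_of_nonneg (by positivity), ENNReal.ofReal_inv_of_pos hτ]
  · refine (enorm_integral_le_lintegral_enorm _).trans ?_
    simp

theorem eLpNorm_avg_le {f : ℝ → X} (hf : AEStronglyMeasurable f volume) {τ : ℝ} (hτ : 0 < τ)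
    {p : ℝ≥0∞} (hp : 1 ≤ p) :
    eLpNorm (fun t => τ⁻¹ * ∫ r in (t - τ)..t, ‖f r‖) p volume ≤ eLpNorm f p volume := by
  have e : (fun t => τ⁻¹ * ∫ r in (t - τ)..t, ‖f r‖) =
      fun t => τ⁻¹ * ∫ r in (t - τ)..t, ‖hf.mk f r‖ := by
    ext t
    congr 1
    refine intervalIntegral.integral_congr_ae ?_
    filter_upwards [hf.ae_eq_mk] with r hr _
    rw [hr]
  rw [e, eLpNorm_congr_ae hf.ae_eq_mk]
  exact (eLpNorm_mono_enorm fun t => (enorm_avg_le hτ t).trans_eq (enorm_eq_self _).symm).trans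
    (eLpNorm_lintegral_avg_le hf.stronglyMeasurable_mk hτ hp)

end Average

/-! ### The generator of the translations -/

section Translations

variable {X : Type*} [NormedAddCommGroup X] [NormedSpace ℂ X]

theorem isWeight_one (I : Set ℝ) : IsWeight I (fun _ => (1 : X →L[ℂ] X)) 1 where
  cont _ := continuousOn_const
  nonneg := zero_le_one
  bound _ _ := ContinuousLinearMap.norm_id_le

theorem continuous_avg {φ : ℝ → ℝ} (hφ : ∀ a b, IntervalIntegrable φ volume a b) (τ : ℝ) :
    Continuous fun t => τ⁻¹ * ∫ r in (t - τ)..t, φ r := by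
  have h1 := intervalIntegral.continuous_primitive hφ 0
  have h2 : Continuous fun t : ℝ => ∫ r in (0 : ℝ)..(t - τ), φ r :=
    h1.comp (by fun_prop : Continuous fun t : ℝ => t - τ)
  have e : (fun t => τ⁻¹ * ∫ r in (t - τ)..t, φ r) =
      fun t => τ⁻¹ * ((∫ r in (0 : ℝ)..t, φ r) - ∫ r in (0 : ℝ)..(t - τ), φ r) := by
    ext t
    rw [intervalIntegral.integral_interval_sub_left (hφ _ _) (hφ _ _)]
  rw [e]
  exact continuous_const.mul (h1.sub h2)

variable {I : Set ℝ} [hIc : I.OrdConnected] {p : ℝ≥0∞} [hp : Fact (1 ≤ p)]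

theorem eLpNorm_avg_rep_le (g : Ep X I p) {τ : ℝ} (hτ : 0 < τ) :
    eLpNorm (fun t => τ⁻¹ * ∫ r in (t - τ)..t, ‖I.indicator (rep g) r‖) p (volume.restrict I) ≤
      ENNReal.ofReal ‖g‖ := by
  have hm : AEStronglyMeasurable (rep g) (volume.restrict I) := (Lp.memLp _).1
  refine (eLpNorm_mono_measure _ Measure.restrict_le_self).trans ?_
  refine (eLpNorm_avg_le ((aestronglyMeasurable_indicator_iff hIc.measurableSet).2 hm) hτ
    hp.out).trans ?_
  rw [eLpNorm_indicator_eq_eLpNorm_restrict hIc.measurableSet]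
  change _ ≤ ENNReal.ofReal ‖(g : Lp X p (volume.restrict I))‖
  rw [Lp.norm_def, ENNReal.ofReal_toReal (Lp.eLpNorm_ne_top _)]
  rfl

variable [CompleteSpace X]

/-- By the fundamental theorem of calculus the left side is the norm of the average over `(t - τ,
t]` of `f' - f'(t)`. An auxiliary `h` with derivative `h'`, later chosen close to `f'`, is inserted:
the oscillation of `h` over the interval is at most `∫ ‖h'‖`, and `f' - h` enters once averaged and
once at `t`. -/
theorem difference_pointwise (hI : ∀ a, ¬ IsLeast I a) {f f' h h' : Ep X I p}
    (hf : (f, f') ∈ derivGraph I p) (hh : (h, h') ∈ derivGraph I p) {τ : ℝ} (hτ : 0 < τ) :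
    ∀ᵐ t ∂(volume.restrict I),
      ‖τ⁻¹ • (wtFun I (fun _ => (1 : X →L[ℂ] X)) τ (rep f) t - rep f t) + rep f' t‖ ≤
        (τ⁻¹ * ∫ r in (t - τ)..t, ‖I.indicator (rep (f' - h)) r‖) +
        τ * (τ⁻¹ * ∫ r in (t - τ)..t, ‖I.indicator (rep h') r‖) + ‖rep (f' - h) t‖ := by
  obtain ⟨hfw, u, hu⟩ := hf
  obtain ⟨hhw, v, hv⟩ := hh
  have hu' := aeEqC0_iff.1 hu
  have hv' := aeEqC0_iff.1 hv
  have hIm := hIc.measurableSet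
  have hsub : rep (f' - h) =ᵐ[volume.restrict I] rep f' - rep h :=
    Lp.coeFn_sub (f' : Lp X p (volume.restrict I)) h
  have hind : ∀ᵐ r : ℝ, I.indicator (rep (f' - h)) r =
      I.indicator (rep f') r - zext v r := by
    have h1 := (ae_restrict_iff' hIm).1 hsub
    have h2 := (ae_restrict_iff' hIm).1 hv'
    filter_upwards [h1, h2] with r h1 h2
    by_cases hr : r ∈ I
    · rw [indicator_of_mem hr, indicator_of_mem hr, h1 hr, ← h2 hr, Pi.sub_apply]
    · rw [indicator_of_notMem hr, indicator_of_notMem hr, zext_of_notMem v hr, sub_zero]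
  filter_upwards [ae_restrict_of_ae (ae_restrict_sub hIm hu' τ), hu', hv', hsub,
    ae_restrict_mem hIm] with t h1 h2 h3 h4 ht
  have e1 : I.indicator (rep f) (t - τ) = zext u (t - τ) := by
    by_cases hc : t - τ ∈ I
    · rw [indicator_of_mem hc, h1 hc]
    · rw [indicator_of_notMem hc, zext_of_notMem u hc]
  have hle : t - τ ≤ t := by linarith
  have e2 : wtFun I (fun _ => (1 : X →L[ℂ] X)) τ (rep f) t - rep f t =
      -∫ r in (t - τ)..t, I.indicator (rep f') r := by
    rw [wtFun, one_apply_eq_self, e1, h2, ← zext_sub_eq_integral hfw hu hI ht hτ.le, neg_sub]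
  have hvint : IntervalIntegrable (zext v) volume (t - τ) t := by
    refine (intervalIntegrable_indicator_rep h (t - τ) t).congr_ae ?_
    refine ae_restrict_of_ae ?_
    filter_upwards [(ae_restrict_iff' hIm).1 hv'] with r hr
    by_cases hrI : r ∈ I
    · rw [indicator_of_mem hrI, hr hrI]
    · rw [indicator_of_notMem hrI, zext_of_notMem v hrI]
  have hgint := intervalIntegrable_indicator_rep f' (t - τ) t
  have hnint := (intervalIntegrable_indicator_rep h' (t - τ) t).norm
  set D := ∫ r in (t - τ)..t, ‖I.indicator (rep h') r‖ with hD
  have e3 : ∫ r in (t - τ)..t, I.indicator (rep f') r =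
      (∫ r in (t - τ)..t, I.indicator (rep (f' - h)) r) +
      (∫ r in (t - τ)..t, (zext v r - zext v t)) + τ • zext v t := by
    have e4 : ∫ r in (t - τ)..t, I.indicator (rep (f' - h)) r =
        ∫ r in (t - τ)..t, (I.indicator (rep f') r - zext v r) :=
      intervalIntegral.integral_congr_ae (hind.mono fun r hr _ => hr)
    rw [e4, intervalIntegral.integral_sub hgint hvint,
      intervalIntegral.integral_sub hvint intervalIntegrable_const, intervalIntegral.integral_const,
      sub_sub_cancel]
    abel
  have b1 : ‖∫ r in (t - τ)..t, I.indicator (rep (f' - h)) r‖ ≤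
      ∫ r in (t - τ)..t, ‖I.indicator (rep (f' - h)) r‖ :=
    intervalIntegral.norm_integral_le_integral_norm hle
  have b2 : ‖∫ r in (t - τ)..t, (zext v r - zext v t)‖ ≤ D * τ := by
    have := intervalIntegral.norm_integral_le_of_norm_le_const (a := t - τ) (b := t)
      (f := fun r => zext v r - zext v t) (C := D) (fun r hr => ?_)
    · rwa [sub_sub_cancel, abs_of_pos hτ] at this
    · rw [uIoc_of_le hle] at hr
      have h5 := zext_sub_eq_integral hhw hv hI ht (τ := t - r) (by linarith [hr.2])
      rw [sub_sub_cancel] at h5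
      rw [norm_sub_rev, h5]
      refine (intervalIntegral.norm_integral_le_integral_norm hr.2).trans ?_
      exact intervalIntegral.integral_mono_interval hr.1.le hr.2 le_rfl
        (Eventually.of_forall fun _ => norm_nonneg _) hnint
  have e5 : τ⁻¹ • (wtFun I (fun _ => (1 : X →L[ℂ] X)) τ (rep f) t - rep f t) + rep f' t =
      -(τ⁻¹ • ∫ r in (t - τ)..t, I.indicator (rep (f' - h)) r) -
      (τ⁻¹ • ∫ r in (t - τ)..t, (zext v r - zext v t)) + rep (f' - h) t := by
    rw [e2, e3, h4, Pi.sub_apply, h3, smul_neg, smul_add, smul_add, smul_smul τ⁻¹ τ,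
      inv_mul_cancel₀ hτ.ne', one_smul]
    abel
  rw [e5]
  refine (norm_add_le _ _).trans ?_
  gcongr
  refine (norm_sub_le _ _).trans ?_
  rw [norm_neg, norm_smul, norm_smul, Real.norm_of_nonneg (inv_nonneg.2 hτ.le)]
  refine add_le_add (by gcongr) ?_
  calc τ⁻¹ * ‖∫ r in (t - τ)..t, (zext v r - zext v t)‖ ≤ τ⁻¹ * (D * τ) := by gcongr
    _ = τ * (τ⁻¹ * D) := by ring

theorem norm_difference_le (hI : ∀ a, ¬ IsLeast I a) {f f' h h' : Ep X I p}
    (hf : (f, f') ∈ derivGraph I p) (hh : (h, h') ∈ derivGraph I p) {τ : ℝ} (hτ : 0 < τ) :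
    ‖τ⁻¹ • (wtOp I p (isWeight_one I) τ (f : Lp X p (volume.restrict I)) - f) + f'‖ ≤
      ‖f' - h‖ + τ * ‖h'‖ + ‖f' - h‖ := by
  set F : Lp X p (volume.restrict I) :=
    τ⁻¹ • (wtOp I p (isWeight_one I) τ (f : Lp X p (volume.restrict I)) - f) + f' with hF
  have hae : ∀ᵐ t ∂(volume.restrict I), ‖F t‖ ≤
        (τ⁻¹ * ∫ r in (t - τ)..t, ‖I.indicator (rep (f' - h)) r‖) +
        τ * (τ⁻¹ * ∫ r in (t - τ)..t, ‖I.indicator (rep h') r‖) + ‖rep (f' - h) t‖ := by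
    filter_upwards [difference_pointwise hI hf hh hτ,
      wtOp_coeFn (isWeight_one I) τ (f : Lp X p (volume.restrict I)),
      Lp.coeFn_sub (wtOp I p (isWeight_one I) τ (f : Lp X p (volume.restrict I)))
        (f : Lp X p (volume.restrict I)),
      Lp.coeFn_smul τ⁻¹ (wtOp I p (isWeight_one I) τ (f : Lp X p (volume.restrict I)) -
        (f : Lp X p (volume.restrict I))),
      Lp.coeFn_add (τ⁻¹ • (wtOp I p (isWeight_one I) τ (f : Lp X p (volume.restrict I)) -
        (f : Lp X p (volume.restrict I))))
        (f' : Lp X p (volume.restrict I))] with t h1 h2 h3 h4 h5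
    rw [hF, h5, Pi.add_apply, h4, Pi.smul_apply, h3, Pi.sub_apply, h2]
    exact h1
  have hc1 := continuous_avg (fun a b => (intervalIntegrable_indicator_rep (f' - h) a b).norm) τ
  have hc2 := continuous_avg (fun a b => (intervalIntegrable_indicator_rep h' a b).norm) τ
  have hm3 : AEStronglyMeasurable (fun t => ‖rep (f' - h) t‖) (volume.restrict I) :=
    (Lp.memLp ((f' - h : Ep X I p) : Lp X p (volume.restrict I))).1.norm
  have hmain : eLpNorm F p (volume.restrict I) ≤
      ENNReal.ofReal ‖f' - h‖ + ENNReal.ofReal τ * ENNReal.ofReal ‖h'‖ +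
        ENNReal.ofReal ‖f' - h‖ := by
    refine (eLpNorm_mono_ae_real hae).trans ?_
    refine (eLpNorm_add_le (hc1.aestronglyMeasurable.add
      (continuous_const.mul hc2).aestronglyMeasurable) hm3 hp.out).trans ?_
    refine add_le_add ((eLpNorm_add_le hc1.aestronglyMeasurable
      (continuous_const.mul hc2).aestronglyMeasurable hp.out).trans (add_le_add ?_ ?_)) ?_
    · exact eLpNorm_avg_rep_le (f' - h) hτ
    · refine (eLpNorm_const_smul (c := τ)
        (f := fun t => τ⁻¹ * ∫ r in (t - τ)..t, ‖I.indicator (rep h') r‖) ..).le.trans ?_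
      rw [Real.enorm_of_nonneg hτ.le]
      gcongr
      exact eLpNorm_avg_rep_le h' hτ
    · rw [eLpNorm_norm]
      change _ ≤ ENNReal.ofReal ‖((f' - h : Ep X I p) : Lp X p (volume.restrict I))‖
      rw [Lp.norm_def, ENNReal.ofReal_toReal (Lp.eLpNorm_ne_top _)]
      rfl
  rw [Lp.norm_def]
  refine ENNReal.toReal_le_of_le_ofReal (by positivity) (hmain.trans_eq ?_)
  rw [← ENNReal.ofReal_mul hτ.le, ← ENNReal.ofReal_add (by positivity) (by positivity),
    ← ENNReal.ofReal_add (by positivity) (by positivity)]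

theorem tendsto_difference (hI : ∀ a, ¬ IsLeast I a)
    (hd : Dense {h : Ep X I p | ∃ h', (h, h') ∈ derivGraph I p}) {f f' : Ep X I p}
    (hf : (f, f') ∈ derivGraph I p) :
    Tendsto (fun τ : ℝ => τ⁻¹ • (wtOp I p (isWeight_one I) τ (f : Lp X p (volume.restrict I)) - f))
      (𝓝[>] 0) (𝓝 (-(f' : Lp X p (volume.restrict I)))) := by
  rw [Metric.tendsto_nhds]
  intro ε hε
  obtain ⟨h, ⟨h', hh⟩, hlt⟩ := hd.exists_dist_lt f' (ε := ε / 4) (by positivity)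
  rw [dist_eq_norm] at hlt
  have h1 : Tendsto (fun τ : ℝ => τ * ‖h'‖) (𝓝[>] 0) (𝓝 0) := by
    have : Tendsto (fun τ : ℝ => τ * ‖h'‖) (𝓝 0) (𝓝 (0 * ‖h'‖)) :=
      Continuous.tendsto (by fun_prop) 0
    rw [zero_mul] at this
    exact this.mono_left nhdsWithin_le_nhds
  filter_upwards [h1.eventually_lt_const (half_pos hε), self_mem_nhdsWithin] with τ h2 (hτ : 0 < τ)
  rw [dist_eq_norm, sub_neg_eq_add]
  have := norm_difference_le hI hf hh hτ
  linarith

end Translations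

/-! ### Resolvents of a Kato-stable family -/

section Kato

variable {X : Type*} [NormedAddCommGroup X] [NormedSpace ℂ X]

/-- The resolvent identity, from `(z' - B) P y = y - (z - z') P y`. -/
theorem IsResolventAt.apply_sub {B : X →ₗ.[ℂ] X} {z z' : ℂ} {P Q : X →L[ℂ] X}
    (hP : IsResolventAt B z P) (hQ : IsResolventAt B z' Q) (y : X) :
    Q (y - (z - z') • P y) = P y := by
  obtain ⟨h, hy⟩ := hP.1 y
  have h2 := hQ.2 ⟨P y, h⟩
  have e : z' • P y - B ⟨P y, h⟩ = y - (z - z') • P y := by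
    rw [eq_sub_of_add_eq' (sub_eq_iff_eq_add.1 hy).symm, sub_smul]
    abel
  rwa [← e]

theorem isResolventAt_resolventOf {B : X →ₗ.[ℂ] X} {z : ℂ} (h : z ∈ resolventSetOf B) :
    IsResolventAt B z (resolventOf B z) := by
  obtain ⟨R, hR⟩ := h
  rwa [resolventOf_eq hR]

variable {I : Set ℝ} {A : ℝ → X →ₗ.[ℂ] X} {M w : ℝ}

theorem IsKatoStable.isResolventAt (hA : IsKatoStable I A M w) {t : ℝ} (ht : t ∈ I) {l : ℝ}
    (hl : w < l) : IsResolventAt (A t) l (resolventOf (A t) l) :=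
  isResolventAt_resolventOf (hA.mem_resolventSet t ht l hl)

theorem IsKatoStable.norm_resolvent_le (hA : IsKatoStable I A M w) {t : ℝ} (ht : t ∈ I) {l : ℝ}
    (hl : w < l) : ‖resolventOf (A t) (l : ℂ)‖ ≤ M * (l - w)⁻¹ := by
  simpa using hA.bound l hl [t] (by simpa using ht) (by simp)

theorem IsKatoStable.continuousOn_resolvent (hA : IsKatoStable I A M w) {w' : ℝ} (hw : w < w')
    (hR : ∀ x : X, ContinuousOn (fun t => resolventOf (A t) (w' : ℂ) x) I) {l : ℝ} (hl : w < l)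
    (x : X) : ContinuousOn (fun t => resolventOf (A t) (l : ℂ) x) I := by
  intro t₀ ht₀
  set P : ℝ → X →L[ℂ] X := fun t => resolventOf (A t) (w' : ℂ) with hP
  set Q : ℝ → X →L[ℂ] X := fun t => resolventOf (A t) (l : ℂ) with hQ
  set c : ℂ := (w' : ℂ) - l with hc
  -- This vector satisfies `P t₀ y = Q t₀ x`, whence `Q t x - Q t₀ x = (1 + c Q t)(P t y - P t₀ y)`.
  -- Strong continuity at `w'` passes to any `l > w` at once, by the uniform bound on `Q t`.
  set y := x + c • Q t₀ x with hy
  have e : ∀ t ∈ I, Q t x - Q t₀ x = (P t y - P t₀ y) + c • Q t (P t y - P t₀ y) := by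
    intro t ht
    have h1 : Q t (y - c • P t y) = P t y :=
      (hA.isResolventAt ht hw).apply_sub (hA.isResolventAt ht hl) y
    have h2 : P t₀ y = Q t₀ x := by
      have := (hA.isResolventAt ht₀ hl).apply_sub (hA.isResolventAt ht₀ hw) x
      rw [← neg_sub (w' : ℂ) l, neg_smul, sub_neg_eq_add] at this
      exact this
    have h3 : x = y - c • P t₀ y := by
      rw [h2, hy, add_sub_cancel_right]
    rw [map_sub, map_smul, sub_eq_iff_eq_add] at h1
    have h4 : Q t x = Q t (y - c • P t₀ y) := by rw [← h3]
    rw [h4, ← h2, map_sub, map_smul, h1, map_sub, smul_sub]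
    abel
  have h1 : Tendsto (fun t => P t y - P t₀ y) (𝓝[I] t₀) (𝓝 0) := by
    simpa [hP] using (hR y t₀ ht₀).tendsto.sub_const (P t₀ y)
  have h2 : Tendsto (fun t => c • Q t (P t y - P t₀ y)) (𝓝[I] t₀) (𝓝 0) := by
    refine squeeze_zero_norm' (a := fun t => ‖c‖ * (M * (l - w)⁻¹ * ‖P t y - P t₀ y‖)) ?_ ?_
    · filter_upwards [self_mem_nhdsWithin] with t ht
      rw [norm_smul]
      gcongr
      exact (Q t).le_of_opNorm_le (hA.norm_resolvent_le ht hl) _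
    · simpa using (h1.norm.const_mul (M * (l - w)⁻¹)).const_mul ‖c‖
  have h3 : Tendsto (fun t => Q t x - Q t₀ x) (𝓝[I] t₀) (𝓝 0) := by
    have := h1.add h2
    rw [add_zero] at this
    refine this.congr' ?_
    filter_upwards [self_mem_nhdsWithin] with t ht using (e t ht).symm
  have := h3.add_const (Q t₀ x)
  simpa [ContinuousWithinAt] using this

/-- The operators `(1 - τ A(t))⁻¹ = τ⁻¹ R(τ⁻¹, A(t))`. -/
def eulerWeight (A : ℝ → X →ₗ.[ℂ] X) (τ t : ℝ) : X →L[ℂ] X :=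
  τ⁻¹ • resolventOf (A t) ((τ⁻¹ : ℝ) : ℂ)

/-- The bound `(1 - τ w)⁻¹`. -/
def eulerBound (w τ : ℝ) : ℝ := τ⁻¹ * (τ⁻¹ - w)⁻¹

theorem eulerBound_nonneg {τ : ℝ} (hτ : 0 < τ) (hw : w < τ⁻¹) : 0 ≤ eulerBound w τ :=
  mul_nonneg (inv_nonneg.2 hτ.le) (inv_nonneg.2 (sub_pos.2 hw).le)

theorem IsKatoStable.isWeight (hA : IsKatoStable I A M w) {w' : ℝ} (hw : w < w')
    (hR : ∀ x : X, ContinuousOn (fun t => resolventOf (A t) (w' : ℂ) x) I) {τ : ℝ} (hτ : 0 < τ)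
    (hl : w < τ⁻¹) : IsWeight I (eulerWeight A τ) (M * eulerBound w τ) where
  cont x := (hA.continuousOn_resolvent hw hR hl x).const_smul τ⁻¹
  nonneg := mul_nonneg hA.pos.le (eulerBound_nonneg hτ hl)
  bound t ht := by
    rw [eulerWeight, norm_smul, Real.norm_of_nonneg (inv_nonneg.2 hτ.le), eulerBound]
    calc _ ≤ τ⁻¹ * (M * (τ⁻¹ - w)⁻¹) := by
          gcongr
          exact hA.norm_resolvent_le ht hl
      _ = _ := by ring

theorem prod_map_smul (c : ℝ) (L : ℕ → X →L[ℂ] X) (l : List ℕ) :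
    (l.map fun i => c • L i).prod = c ^ l.length • (l.map L).prod := by
  induction l with
  | nil => simp
  | cons a l ih =>
    rw [List.map_cons, List.prod_cons, ih, List.map_cons, List.prod_cons, List.length_cons,
      smul_mul_smul_comm, pow_succ']

/-- The factors sit at the decreasing times `t, t - τ, …`, which is the order in Kato stability, and
all these times are in `I` since they lie between `t - k * τ` and `t`. -/
theorem IsKatoStable.norm_wtProd_le (hA : IsKatoStable I A M w) [hI : I.OrdConnected] {τ : ℝ}
    (hτ : 0 < τ) (hl : w < τ⁻¹) (k : ℕ) {t : ℝ} (ht : t ∈ I) (ht' : t - k * τ ∈ I) :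
    ‖wtProd (eulerWeight A τ) τ k t‖ ≤ M * eulerBound w τ ^ k := by
  have e : wtProd (eulerWeight A τ) τ k t = (τ⁻¹) ^ k •
      (((List.range k).map fun i : ℕ => t - i * τ).map fun s =>
        resolventOf (A s) ((τ⁻¹ : ℝ) : ℂ)).prod := by
    rw [wtProd, List.map_map]
    have := prod_map_smul τ⁻¹ (fun i : ℕ => resolventOf (A (t - i * τ)) ((τ⁻¹ : ℝ) : ℂ))
      (List.range k)
    rw [List.length_range] at this
    exact this
  have hb := hA.bound τ⁻¹ hl ((List.range k).map fun i : ℕ => t - i * τ) (by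
      intro s hs
      obtain ⟨i, hi, rfl⟩ := List.mem_map.1 hs
      have hik : (i : ℝ) ≤ k := by exact_mod_cast (List.mem_range.1 hi).le
      refine hI.out ht' ht ⟨?_, ?_⟩
      · have := mul_le_mul_of_nonneg_right hik hτ.le
        linarith
      · have : 0 ≤ (i : ℝ) * τ := by positivity
        linarith) (by
      rw [List.pairwise_map]
      refine (List.pairwise_lt_range (n := k)).imp fun {a b} hab => ?_
      have hab' : (a : ℝ) ≤ b := by exact_mod_cast hab.le
      have := mul_le_mul_of_nonneg_right hab' hτ.le
      simp only [ge_iff_le]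
      linarith)
  rw [List.length_map, List.length_range] at hb
  rw [e, norm_smul, norm_pow, Real.norm_of_nonneg (inv_nonneg.2 hτ.le), eulerBound, mul_pow]
  calc _ ≤ τ⁻¹ ^ k * (M * (τ⁻¹ - w)⁻¹ ^ k) := by gcongr
    _ = _ := by ring

/-- The bound is `(1 - wτ)⁻¹`, and `exp(vτ)(1 - wτ) ≥ (1 + vτ)(1 - wτ) ≥ 1` as soon as `v w τ ≤ v -
w` and `wτ < 1`. -/
theorem eventually_eulerBound_le {v : ℝ} (hv : w < v) :
    ∀ᶠ τ in 𝓝[>] (0 : ℝ), 0 < τ ∧ w < τ⁻¹ ∧ eulerBound w τ ≤ Real.exp (v * τ) := by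
  have h1 : Tendsto (fun τ : ℝ => w * τ) (𝓝[>] 0) (𝓝 0) := by
    have : Tendsto (fun τ : ℝ => w * τ) (𝓝 0) (𝓝 (w * 0)) := Continuous.tendsto (by fun_prop) 0
    rw [mul_zero] at this
    exact this.mono_left nhdsWithin_le_nhds
  have h2 : Tendsto (fun τ : ℝ => v * (w * τ)) (𝓝[>] 0) (𝓝 0) := by
    simpa using h1.const_mul v
  filter_upwards [h1.eventually_lt_const one_pos, h2.eventually_lt_const (sub_pos.2 hv),
    self_mem_nhdsWithin] with τ h3 h4 (hτ : 0 < τ)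
  have hl : w < τ⁻¹ := by
    rw [← mul_lt_mul_iff_left₀ hτ, inv_mul_cancel₀ hτ.ne']
    exact h3
  refine ⟨hτ, hl, ?_⟩
  have e : eulerBound w τ = (1 - w * τ)⁻¹ := by
    rw [eulerBound, ← mul_inv, mul_sub, mul_inv_cancel₀ hτ.ne', mul_comm τ w]
  rw [e, inv_le_iff_one_le_mul₀ (by linarith)]
  have h5 := Real.add_one_le_exp (v * τ)
  have h6 : 0 < 1 - w * τ := by linarith
  nlinarith

end Kato

/-! ### The product approximation of the evolution semigroup -/

section Approximation

variable {X : Type*} [NormedAddCommGroup X] [NormedSpace ℂ X]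

open Classical in
/-- The operator `f ↦ (K(t) f(t - τ))ₜ` for a family `K` that is a weight, and `0` otherwise. -/
def stepOp (I : Set ℝ) [I.OrdConnected] (p : ℝ≥0∞) [Fact (1 ≤ p)] (K : ℝ → X →L[ℂ] X) (τ : ℝ) :
    Lp X p (volume.restrict I) →L[ℂ] Lp X p (volume.restrict I) :=
  if h : ∃ C, IsWeight I K C then wtOp I p h.choose_spec τ else 0

variable {I : Set ℝ} [hIc : I.OrdConnected] {p : ℝ≥0∞} [hp : Fact (1 ≤ p)] {K : ℝ → X →L[ℂ] X}
  {C : ℝ}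

theorem stepOp_eq (hK : IsWeight I K C) (τ : ℝ) : stepOp I p K τ = wtOp I p hK τ := by
  have h : ∃ C, IsWeight I K C := ⟨C, hK⟩
  rw [stepOp, dif_pos h]
  ext1 f
  apply Lp.ext
  filter_upwards [wtOp_coeFn h.choose_spec τ f, wtOp_coeFn hK τ f] with t h1 h2
  rw [h1, h2]

theorem wtOp_eq_comp (hK : IsWeight I K C) (τ : ℝ) (f : Lp X p (volume.restrict I)) :
    wtOp I p hK τ f = wtOp I p hK 0 (wtOp I p (isWeight_one I) τ f) := by
  apply Lp.ext
  filter_upwards [wtOp_coeFn hK τ f, wtOp_coeFn hK 0 (wtOp I p (isWeight_one I) τ f),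
    wtOp_coeFn (isWeight_one I) τ f, ae_restrict_mem hIc.measurableSet] with t h1 h2 h3 h4
  rw [h1, h2, wtFun, wtFun, sub_zero, indicator_of_mem h4, h3, wtFun, one_apply_eq_self]

variable {A : ℝ → X →ₗ.[ℂ] X} {M w : ℝ}

theorem IsKatoStable.wtOp_sub_self (hA : IsKatoStable I A M w) {τ : ℝ} (hτ : 0 < τ)
    (hl : w < τ⁻¹) (hK : IsWeight I (eulerWeight A τ) C) {f a : Ep X I p}
    (hf : (f, a) ∈ mulGraph I A p) :
    wtOp I p hK 0 (f : Lp X p (volume.restrict I)) - (f : Lp X p (volume.restrict I)) =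
      τ • wtOp I p hK 0 (a : Lp X p (volume.restrict I)) := by
  have hf' : ∀ᵐ t ∂(volume.restrict I), ∃ h : rep f t ∈ (A t).domain,
    A t ⟨rep f t, h⟩ = rep a t := hf
  apply Lp.ext
  filter_upwards [hf', wtOp_coeFn hK 0 (f : Lp X p (volume.restrict I)),
    wtOp_coeFn hK 0 (a : Lp X p (volume.restrict I)),
    Lp.coeFn_sub (wtOp I p hK 0 (f : Lp X p (volume.restrict I))) (f : Lp X p (volume.restrict I)),
    Lp.coeFn_smul τ (wtOp I p hK 0 (a : Lp X p (volume.restrict I))),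
    ae_restrict_mem hIc.measurableSet] with t ⟨h0, h1⟩ h2 h3 h4 h5 ht
  rw [h4, h5, Pi.sub_apply, Pi.smul_apply, h2, h3, wtFun, wtFun, sub_zero, indicator_of_mem ht,
    indicator_of_mem ht, eulerWeight]
  have h6 := (hA.isResolventAt ht hl).2 ⟨rep f t, h0⟩
  rw [h1, map_sub, map_smul, Complex.coe_smul] at h6
  change τ⁻¹ • resolventOf (A t) _ (rep f t) - rep f t =
    τ • τ⁻¹ • resolventOf (A t) _ (rep a t)
  rw [smul_smul, mul_inv_cancel₀ hτ.ne', one_smul, sub_eq_iff_eq_add, add_comm,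
    ← sub_eq_iff_eq_add]
  exact h6

/-- On the dense domain of `A(·)` the difference from the identity is `τ` times a bounded term, by
`(1 - τA)⁻¹ f - f = τ (1 - τA)⁻¹ A f`. -/
theorem IsKatoStable.tendsto_wtOp_id (hA : IsKatoStable I A M w) {w' : ℝ} (hw : w < w')
    (hR : ∀ x : X, ContinuousOn (fun t => resolventOf (A t) (w' : ℂ) x) I)
    (hd : Dense {f : Ep X I p | ∃ a, (f, a) ∈ mulGraph I A p}) (g : Ep X I p) :
    Tendsto (fun τ => stepOp I p (eulerWeight A τ) 0 (g : Lp X p (volume.restrict I))) (𝓝[>] 0)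
      (𝓝 (g : Lp X p (volume.restrict I))) := by
  have hev := eventually_eulerBound_le hw
  have hexp : ∀ᶠ τ in 𝓝[>] (0 : ℝ), Real.exp (w' * τ) < 2 :=
    (tendsto_exp_one w').eventually_lt_const one_lt_two
  have hbd : ∀ᶠ τ in 𝓝[>] (0 : ℝ), ‖stepOp I p (eulerWeight A τ) 0‖ ≤ M * 2 := by
    filter_upwards [hev, hexp] with τ ⟨hτ, hl, hb⟩ he
    rw [stepOp_eq (hA.isWeight hw hR hτ hl)]
    refine (norm_wtOp_le _ _).trans ?_
    have := hA.pos
    gcongr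
    exact hb.trans he.le
  refine tendsto_of_tendsto_on_dense (C := M * 2)
    (f := fun τ => (stepOp I p (eulerWeight A τ) 0).comp (Ep X I p).subtypeL)
    (g := (Ep X I p).subtypeL) ?_ hd ?_ g
  · filter_upwards [hbd] with τ h
    refine ContinuousLinearMap.opNorm_le_bound _ (by linarith [hA.pos]) fun f => ?_
    exact (stepOp I p (eulerWeight A τ) 0).le_of_opNorm_le h _
  · rintro f ⟨a, hf⟩
    rw [tendsto_iff_norm_sub_tendsto_zero]
    have h0 : Tendsto (fun τ : ℝ => τ * (M * 2 * ‖a‖)) (𝓝[>] 0) (𝓝 0) := by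
      have : Tendsto (fun τ : ℝ => τ * (M * 2 * ‖a‖)) (𝓝 0) (𝓝 (0 * (M * 2 * ‖a‖))) :=
        Continuous.tendsto (by fun_prop) 0
      rw [zero_mul] at this
      exact this.mono_left nhdsWithin_le_nhds
    refine squeeze_zero' (Eventually.of_forall fun _ => norm_nonneg _) ?_ h0
    filter_upwards [hev, hbd] with τ ⟨hτ, hl, _⟩ hb
    have hK := hA.isWeight hw hR hτ hl
    change ‖stepOp I p (eulerWeight A τ) 0 (f : Lp X p (volume.restrict I)) -
      (f : Lp X p (volume.restrict I))‖ ≤ _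
    have e := hA.wtOp_sub_self hτ hl hK hf
    rw [← stepOp_eq hK 0] at e
    rw [e, norm_smul, Real.norm_of_nonneg hτ.le]
    gcongr
    exact (stepOp I p (eulerWeight A τ) 0).le_of_opNorm_le hb _

theorem IsKatoStable.consistent [CompleteSpace X] (hI : ∀ a, ¬ IsLeast I a)
    (hA : IsKatoStable I A M w) {w' : ℝ} (hw : w < w')
    (hR : ∀ x : X, ContinuousOn (fun t => resolventOf (A t) (w' : ℂ) x) I)
    (hd : Dense (Fp I A p : Set (Ep X I p))) {f g : Ep X I p} (hfg : (f, g) ∈ (G0 I A p).graph) :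
    Tendsto (fun τ : ℝ => τ⁻¹ • (stepOp I p (eulerWeight A τ) τ (f : Lp X p (volume.restrict I)) -
      (f : Lp X p (volume.restrict I)))) (𝓝[>] 0) (𝓝 (g : Lp X p (volume.restrict I))) := by
  have hex : ∀ h ∈ Fp I A p, ∃ h' a : Ep X I p, (h, h') ∈ derivGraph I p ∧
      (h, a) ∈ mulGraph I A p := by
    intro h hh
    obtain ⟨h', a, h1, h2, -⟩ := (mem_G0_graph I A p h _).1
      ((G0 I A p).mem_graph ⟨h, hh⟩)
    exact ⟨h', a, h1, h2⟩
  have hd1 : Dense {h : Ep X I p | ∃ h', (h, h') ∈ derivGraph I p} :=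
    hd.mono fun h hh => by
      obtain ⟨h', a, h1, h2⟩ := hex h hh
      exact ⟨h', h1⟩
  have hd2 : Dense {h : Ep X I p | ∃ a, (h, a) ∈ mulGraph I A p} :=
    hd.mono fun h hh => by
      obtain ⟨h', a, h1, h2⟩ := hex h hh
      exact ⟨a, h2⟩
  obtain ⟨f', a, h1, h2, rfl⟩ := (mem_G0_graph I A p f g).1 hfg
  have t1 := tendsto_difference hI hd1 h1
  have t2 := hA.tendsto_wtOp_id hw hR hd2 (-f' + a)
  have hev := eventually_eulerBound_le hw
  have hexp : ∀ᶠ τ in 𝓝[>] (0 : ℝ), Real.exp (w' * τ) < 2 :=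
    (tendsto_exp_one w').eventually_lt_const one_lt_two
  set F : Lp X p (volume.restrict I) := (f : Lp X p (volume.restrict I)) with hF
  set F' : Lp X p (volume.restrict I) := (f' : Lp X p (volume.restrict I)) with hF'
  -- Writing `V = K L` with the multiplication `K` and the translation `L`, the quotient equals
  -- `K(τ⁻¹(L f - f) + f') + K(-f' + a)`. The first term tends to zero, the second to `g`.
  have t3 : Tendsto (fun τ : ℝ => stepOp I p (eulerWeight A τ) 0
      (τ⁻¹ • (wtOp I p (isWeight_one I) τ F - F) + F')) (𝓝[>] 0) (𝓝 0) := by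
    refine squeeze_zero_norm'
      (a := fun τ : ℝ => M * 2 * ‖τ⁻¹ • (wtOp I p (isWeight_one I) τ F - F) + F'‖) ?_ ?_
    · filter_upwards [hev, hexp] with τ ⟨hτ, hl, hb⟩ he
      refine ContinuousLinearMap.le_of_opNorm_le _ ?_ _
      rw [stepOp_eq (hA.isWeight hw hR hτ hl)]
      refine (norm_wtOp_le _ _).trans ?_
      have := hA.pos
      gcongr
      exact hb.trans he.le
    · have := (t1.add_const F').norm.const_mul (M * 2)
      simpa using this
  have t4 := t3.add t2
  rw [zero_add] at t4
  refine t4.congr' ?_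
  filter_upwards [hev] with τ ⟨hτ, hl, _⟩
  have hK := hA.isWeight hw hR hτ hl
  have e := hA.wtOp_sub_self hτ hl hK h2
  rw [stepOp_eq hK, stepOp_eq hK, wtOp_eq_comp hK τ F]
  have e2 : (((-f' + a : Ep X I p)) : Lp X p (volume.restrict I)) =
    -F' + (a : Lp X p (volume.restrict I)) := rfl
  have e3 : wtOp I p hK 0 F = F + τ • wtOp I p hK 0 (a : Lp X p (volume.restrict I)) := by
    rw [← e]
    abel
  rw [e2, ← map_add, add_assoc, add_neg_cancel_left, map_add,
    ContinuousLinearMap.map_smul_of_tower, map_sub, e3, sub_add_eq_sub_sub, smul_sub τ⁻¹ _ (τ • _),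
    smul_smul τ⁻¹ τ, inv_mul_cancel₀ hτ.ne', one_smul, sub_add_cancel]

theorem IsKatoStable.eventually_norm_stepOp_pow_le (hA : IsKatoStable I A M w) {w' : ℝ}
    (hw : w < w') (hR : ∀ x : X, ContinuousOn (fun t => resolventOf (A t) (w' : ℂ) x) I)
    {v : ℝ} (hv : w < v) :
    ∀ᶠ τ in 𝓝[>] (0 : ℝ), ∀ k : ℕ,
      ‖(stepOp I p (eulerWeight A τ) τ) ^ k‖ ≤ M * Real.exp (v * (k * τ)) ∧
      ∀ f : Lp X p (volume.restrict I), ∀ᵐ t ∂(volume.restrict I),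
        ‖(((stepOp I p (eulerWeight A τ) τ) ^ k) f : ℝ → X) t‖ ≤
          M * Real.exp (v * (k * τ)) * ‖I.indicator f (t - k * τ)‖ := by
  filter_upwards [eventually_eulerBound_le hv] with τ ⟨hτ, hl, hb⟩ k
  have hK := hA.isWeight hw hR hτ hl
  have hM := hA.pos
  have hle : M * eulerBound w τ ^ k ≤ M * Real.exp (v * (k * τ)) := by
    have : Real.exp (v * (k * τ)) = Real.exp (v * τ) ^ k := by
      rw [← Real.exp_nat_mul]
      ring_nf
    rw [this]
    have := eulerBound_nonneg hτ hl
    gcongr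
  have hprod : ∀ t ∈ I, t - k * τ ∈ I → ‖wtProd (eulerWeight A τ) τ k t‖ ≤
      M * Real.exp (v * (k * τ)) := fun t ht ht' => (hA.norm_wtProd_le hτ hl k ht ht').trans hle
  rw [stepOp_eq hK]
  exact ⟨norm_wtOp_pow_le hK hτ.le k (by positivity) hprod,
    fun f => wtOp_pow_norm_le hK hτ.le k hprod f⟩

end Approximation

/-! ### Generation on `E_p` -/

section Generation

/-- A pair `(0, y)` in the closed graph has `y` as the limit of quotients of the zero orbit, so `y =
0`. -/
theorem isClosable_of_generator {E : Type*} [NormedAddCommGroup E] [NormedSpace ℂ E]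
    {G : E →ₗ.[ℂ] E} {T : ℝ → E →L[ℂ] E}
    (h : ∀ x y, (x, y) ∈ G.graph.topologicalClosure ↔
      Tendsto (fun σ : ℝ => σ⁻¹ • (T σ x - x)) (𝓝[>] 0) (𝓝 y)) :
    G.IsClosable ∧ IsGeneratorOf G.closure T := by
  have hc : G.IsClosable := by
    refine ⟨G.graph.topologicalClosure.toLinearPMap, ?_⟩
    refine (Submodule.toLinearPMap_graph_eq _ ?_).symm
    rintro ⟨x, y⟩ hxy hx
    change x = 0 at hx
    subst hx
    have h1 := (h 0 y).1 hxy
    simp only [map_zero, sub_zero, smul_zero] at h1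
    exact tendsto_nhds_unique h1 tendsto_const_nhds
  refine ⟨hc, fun x y => ?_⟩
  rw [← hc.graph_closure_eq_closure_graph, h]
  simp only [Complex.coe_smul]

variable {X : Type*} [NormedAddCommGroup X] [NormedSpace ℂ X] [CompleteSpace X]
  {I : Set ℝ} [hIc : I.OrdConnected] {p : ℝ≥0∞} [hp : Fact (1 ≤ p)]
  {A : ℝ → X →ₗ.[ℂ] X} {M w : ℝ}

/-- The pointwise estimate of a semigroup on `E_p` by translates. -/
def IsDominated (I : Set ℝ) (p : ℝ≥0∞) [Fact (1 ≤ p)] (T : ℝ → Ep X I p →L[ℂ] Ep X I p)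
    (M v : ℝ) : Prop :=
  ∀ σ, 0 ≤ σ → ∀ f : Ep X I p, ∀ᵐ t ∂(volume.restrict I),
    ‖rep (T σ f) t‖ ≤ M * Real.exp (v * σ) * ‖I.indicator (rep f) (t - σ)‖

theorem IsKatoStable.exists_semigroup (hI : ∀ a, ¬ IsLeast I a)
    (hA : IsKatoStable I A M w) {w' : ℝ} (hw : w < w')
    (hR : ∀ x : X, ContinuousOn (fun t => resolventOf (A t) (w' : ℂ) x) I)
    (hrange : Dense {g : Ep X I p | ∃ f : (G0 I A p).domain,
      (w' : ℂ) • (f : Ep X I p) - G0 I A p f = g})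
    (hd : Dense (Fp I A p : Set (Ep X I p))) :
    ∃ (T : ℝ → Ep X I p →L[ℂ] Ep X I p) (v : ℝ), IsC0Semigroup T ∧
      (∀ x y, (x, y) ∈ (G0 I A p).graph.topologicalClosure ↔
        Tendsto (fun σ : ℝ => σ⁻¹ • (T σ x - x)) (𝓝[>] 0) (𝓝 y)) ∧
      (∀ t, 0 ≤ t → ∀ x y, (x, y) ∈ (G0 I A p).graph.topologicalClosure →
        (T t x, T t y) ∈ (G0 I A p).graph.topologicalClosure) ∧
      IsDominated I p T M v := by
  have := completeSpace_Ep (X := X) (p := p) hI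
  -- The growth rate must exceed `w` to absorb `(1 - wτ)⁻¹`, yet stay below `w'`, where the range
  -- condition is given.
  set v := (w + w') / 2 with hv
  have hbound := hA.eventually_norm_stepOp_pow_le (p := p) hw hR (v := v) (by linarith)
  obtain ⟨T, hT, hg, hΓ, hprod⟩ := exists_semigroup_of_consistent (Γ₀ := (G0 I A p).graph)
    (i := (Ep X I p).subtypeₗᵢ) (V := fun τ => stepOp I p (eulerWeight A τ) τ) (M := M) (w := v)
    (m := w') (hbound.mono fun τ h k => (h k).1)
    (fun x y hxy => hA.consistent hI hw hR hd hxy)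
    (hd.mono fun x hx => ⟨_, (G0 I A p).mem_graph ⟨x, hx⟩⟩) (by linarith)
    (hrange.mono (by
      rintro z ⟨f, rfl⟩
      refine ⟨f, G0 I A p f, (G0 I A p).mem_graph f, ?_⟩
      rw [Complex.coe_smul]))
  refine ⟨T, v, hT, hg, hΓ, fun σ hσ f => ?_⟩
  rcases hσ.eq_or_lt with rfl | hσ
  · obtain ⟨τ, hτ⟩ := hbound.exists
    have := (hτ 0).2 (f : Lp X p (volume.restrict I))
    rw [hT.map_zero]
    simpa [rep] using this
  · have hev := (IsChernoffFamily.tendsto_div_nat hσ).eventually hbound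
    have hnev : ∀ᶠ n : ℕ in atTop, ∀ᵐ t ∂(volume.restrict I),
        ‖((((stepOp I p (eulerWeight A (σ / n)) (σ / n)) ^ n)
          (f : Lp X p (volume.restrict I)) : Lp X p (volume.restrict I)) : ℝ → X) t‖ ≤
          M * Real.exp (v * σ) * ‖I.indicator (rep f) (t - σ)‖ := by
      filter_upwards [hev, eventually_gt_atTop 0] with n h1 hn
      have hn0 : (n : ℝ) ≠ 0 := by exact_mod_cast hn.ne'
      have h2 := (h1 n).2 (f : Lp X p (volume.restrict I))
      rw [show (n : ℝ) * (σ / n) = σ by field_simp] at h2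
      exact h2
    obtain ⟨N, hN⟩ := eventually_atTop.1 hnev
    -- The pointwise domination of the products survives along an a.e. convergent subsequence.
    obtain ⟨ns, hns, hae⟩ := (tendstoInMeasure_of_tendsto_Lp (hprod σ hσ f)).exists_seq_tendsto_ae
    have hall : ∀ᵐ t ∂(volume.restrict I), ∀ n : ℕ, N ≤ n →
        ‖((((stepOp I p (eulerWeight A (σ / n)) (σ / n)) ^ n)
          (f : Lp X p (volume.restrict I)) : Lp X p (volume.restrict I)) : ℝ → X) t‖ ≤
          M * Real.exp (v * σ) * ‖I.indicator (rep f) (t - σ)‖ :=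
      ae_all_iff.2 fun n => eventually_imp_distrib_left.2 (hN n)
    filter_upwards [hae, hall] with t h1 h2
    refine le_of_tendsto h1.norm ?_
    filter_upwards [hns.tendsto_atTop.eventually_ge_atTop N] with n hn
    exact h2 (ns n) hn

end Generation

/-! ### The domain of the generator consists of continuous functions -/

section SupBound

theorem setLIntegral_Ioc_sub (φ : ℝ → ℝ≥0∞) (a b c : ℝ) :
    ∫⁻ t in Ioc a b, φ (t - c) = ∫⁻ t in Ioc (a - c) (b - c), φ t := by
  rw [← (measurePreserving_sub_right volume c).setLIntegral_comp_preimage_emb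
    (MeasurableEquiv.subRight c).measurableEmbedding φ (Ioc (a - c) (b - c))]
  congr 2
  ext t
  simp

theorem sum_setLIntegral_sub (φ : ℝ → ℝ≥0∞) (b : ℝ) {τ : ℝ} (hτ : 0 ≤ τ) (N : ℕ) :
    ∑ k ∈ Finset.range N, ∫⁻ t in Ioc (b - τ) b, φ (t - k * τ) =
      ∫⁻ t in Ioc (b - N * τ) b, φ t := by
  induction N with
  | zero => simp
  | succ N ih =>
    have hN : 0 ≤ (N : ℝ) * τ := by positivity
    rw [Finset.sum_range_succ, ih, setLIntegral_Ioc_sub]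
    have e : Ioc (b - ((N + 1 : ℕ) : ℝ) * τ) b =
        Ioc (b - N * τ) b ∪ Ioc (b - τ - N * τ) (b - N * τ) := by
      rw [union_comm, Ioc_union_Ioc_eq_Ioc (by linarith) (by linarith)]
      congr 1
      push_cast
      ring
    rw [e, lintegral_union measurableSet_Ioc]
    rw [Set.disjoint_left]
    intro t h1 h2
    exact absurd h1.1 (not_lt.2 h2.2)

section Rep

variable {X : Type*} [NormedAddCommGroup X] [NormedSpace ℂ X]
  {I : Set ℝ} {p : ℝ≥0∞}

theorem rep_sum {ι : Type*} (s : Finset ι) (F : ι → Ep X I p) :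
    rep (∑ k ∈ s, F k) =ᵐ[volume.restrict I] fun t => ∑ k ∈ s, rep (F k) t := by
  classical
  induction s using Finset.induction_on with
  | empty => simp only [Finset.sum_empty]; exact Ep_rep_zero
  | insert a s ha ih =>
    filter_upwards [ih, Ep_rep_add (F a) (∑ k ∈ s, F k)] with t h1 h2
    rw [Finset.sum_insert ha, h2, Pi.add_apply, h1, Finset.sum_insert ha]

theorem rep_real_smul (c : ℝ) (f : Ep X I p) :
    rep (c • f) =ᵐ[volume.restrict I] fun t => c • rep f t :=
  Lp.coeFn_smul c (f : Lp X p (volume.restrict I))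

theorem rep_sub (f g : Ep X I p) :
    rep (f - g) =ᵐ[volume.restrict I] fun t => rep f t - rep g t :=
  Lp.coeFn_sub (f : Lp X p (volume.restrict I)) g

end Rep

variable {X : Type*} [NormedAddCommGroup X] [NormedSpace ℂ X]
  {I : Set ℝ} {p : ℝ≥0∞} [hp : Fact (1 ≤ p)]
  {T : ℝ → Ep X I p →L[ℂ] Ep X I p} {M v : ℝ}

theorem semigroup_telescope {E : Type*} [NormedAddCommGroup E] [NormedSpace ℂ E]
    {T : ℝ → E →L[ℂ] E} (hT : IsC0Semigroup T) {τ : ℝ} (hτ : 0 < τ) (f : E) (n : ℕ) :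
    f = T (n * τ) f - τ • ∑ k ∈ Finset.range n, T (k * τ) (τ⁻¹ • (T τ f - f)) := by
  induction n with
  | zero => simp [hT.map_zero]
  | succ n ih =>
    have h1 : T (((n + 1 : ℕ) : ℝ) * τ) f = T (n * τ) (T τ f) := by
      rw [← ContinuousLinearMap.comp_apply, ← hT.map_add _ _ (by positivity) hτ.le]
      push_cast
      ring_nf
    rw [Finset.sum_range_succ, h1, smul_add, ← ContinuousLinearMap.map_smul_of_tower (T (n * τ)),
      smul_smul, mul_inv_cancel₀ hτ.ne', one_smul, map_sub]
    conv_lhs => rw [ih]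
    abel

/-- A discrete form of `f = T(s)f - ∫₀ˢ T(r) G f dr` averaged over `s ∈ [0, 1]`: the telescoped
identity with step `τ = 1 / N` is estimated by domination for each `n < N`, and the `N` bounds are
averaged. -/
theorem IsDominated.pointwise_le (hdom : IsDominated I p T M v) (hM : 0 ≤ M)
    (hT : IsC0Semigroup T) {N : ℕ} (hN : 0 < N) (f : Ep X I p) :
    ∀ᵐ t ∂(volume.restrict I), ‖rep f t‖ ≤ M * Real.exp |v| * ((N : ℝ)⁻¹ *
      ∑ k ∈ Finset.range N, (‖I.indicator (rep f) (t - k * (N : ℝ)⁻¹)‖ +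
        ‖I.indicator (rep (((N : ℝ)⁻¹)⁻¹ • (T (N : ℝ)⁻¹ f - f))) (t - k * (N : ℝ)⁻¹)‖)) := by
  have hN0 : (0 : ℝ) < N := by exact_mod_cast hN
  set τ := (N : ℝ)⁻¹ with hτdef
  have hτ : 0 < τ := inv_pos.2 hN0
  set h := τ⁻¹ • (T τ f - f) with hh
  set C := M * Real.exp |v| with hC
  have hC0 : 0 ≤ C := by positivity
  have hexp : ∀ k : ℕ, k < N → M * Real.exp (v * (k * τ)) ≤ C := by
    intro k hk
    have h1 : (k : ℝ) * τ ≤ 1 := by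
      have : (k : ℝ) ≤ N := by exact_mod_cast hk.le
      calc (k : ℝ) * τ ≤ N * τ := by gcongr
        _ = 1 := mul_inv_cancel₀ hN0.ne'
    have h2 : 0 ≤ (k : ℝ) * τ := by positivity
    rw [hC]
    gcongr
    calc v * (k * τ) ≤ |v| * (k * τ) := by gcongr; exact le_abs_self v
      _ ≤ |v| * 1 := by gcongr
      _ = |v| := mul_one _
  have hdomk : ∀ g : Ep X I p, ∀ᵐ t ∂(volume.restrict I), ∀ k : ℕ, k < N →
      ‖rep (T (k * τ) g) t‖ ≤ C * ‖I.indicator (rep g) (t - k * τ)‖ := by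
    intro g
    refine ae_all_iff.2 fun k => eventually_imp_distrib_left.2 fun hk => ?_
    filter_upwards [hdom (k * τ) (by positivity) g] with t ht
    exact ht.trans (mul_le_mul_of_nonneg_right (hexp k hk) (norm_nonneg _))
  have htel : ∀ᵐ t ∂(volume.restrict I), ∀ n : ℕ, rep f t =
      rep (T (n * τ) f) t - τ • ∑ k ∈ Finset.range n, rep (T (k * τ) h) t := by
    refine ae_all_iff.2 fun n => ?_
    have e : f = T (n * τ) f - τ • ∑ k ∈ Finset.range n, T (k * τ) h :=
      semigroup_telescope hT hτ f n
    filter_upwards [rep_sub (T (n * τ) f) (τ • ∑ k ∈ Finset.range n, T (k * τ) h),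
      rep_real_smul τ (∑ k ∈ Finset.range n, T (k * τ) h),
      rep_sum (Finset.range n) fun k => T (k * τ) h] with t h1 h2 h3
    conv_lhs => rw [e]
    rw [h1, h2, h3]
  filter_upwards [hdomk f, hdomk h, htel] with t h1 h2 h3
  have hn : ∀ n ∈ Finset.range N, ‖rep f t‖ ≤ C * ‖I.indicator (rep f) (t - n * τ)‖ +
      τ * ∑ k ∈ Finset.range N, C * ‖I.indicator (rep h) (t - k * τ)‖ := by
    intro n hn
    have hn' := Finset.mem_range.1 hn
    rw [h3 n]
    refine (norm_sub_le _ _).trans (add_le_add (h1 n hn') ?_)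
    rw [norm_smul, Real.norm_of_nonneg hτ.le]
    refine mul_le_mul_of_nonneg_left ((norm_sum_le _ _).trans ?_) hτ.le
    refine (Finset.sum_le_sum fun k hk => h2 k ((Finset.mem_range.1 hk).trans hn')).trans ?_
    refine Finset.sum_le_sum_of_subset_of_nonneg (Finset.range_mono hn'.le) fun k _ _ => ?_
    positivity
  have hsum := Finset.sum_le_sum hn
  rw [Finset.sum_const, Finset.sum_add_distrib, Finset.sum_const, Finset.card_range, nsmul_eq_mul,
    nsmul_eq_mul, ← mul_assoc, mul_inv_cancel₀ hN0.ne', one_mul] at hsum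
  calc ‖rep f t‖ = τ * (N * ‖rep f t‖) := by
        rw [← mul_assoc, inv_mul_cancel₀ hN0.ne', one_mul]
    _ ≤ τ * _ := mul_le_mul_of_nonneg_left hsum hτ.le
    _ = _ := by
        rw [← Finset.mul_sum, ← Finset.mul_sum, ← mul_add, ← Finset.sum_add_distrib]
        ring

variable [hIc : I.OrdConnected]

theorem setLIntegral_indicator_rep_le (h : Ep X I p) (b : ℝ) :
    ∫⁻ t in Ioc (b - 1) b, ‖I.indicator (rep h) t‖ₑ ≤ ENNReal.ofReal ‖h‖ := by
  have hm : AEStronglyMeasurable (rep h) (volume.restrict I) := (Lp.memLp _).1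
  have hm' := (aestronglyMeasurable_indicator_iff hIc.measurableSet).2 hm
  have hprob : IsProbabilityMeasure (volume.restrict (Ioc (b - 1) b)) := by
    constructor
    rw [Measure.restrict_apply_univ, Real.volume_Ioc]
    simp
  rw [← eLpNorm_one_eq_lintegral_enorm]
  refine (eLpNorm_le_eLpNorm_of_exponent_le hp.out hm'.restrict).trans ?_
  refine (eLpNorm_mono_measure _ Measure.restrict_le_self).trans ?_
  rw [eLpNorm_indicator_eq_eLpNorm_restrict hIc.measurableSet]
  change _ ≤ ENNReal.ofReal ‖(h : Lp X p (volume.restrict I))‖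
  rw [Lp.norm_def, ENNReal.ofReal_toReal (Lp.eLpNorm_ne_top _)]
  rfl

/-- Integrate `pointwise_le` over `(b - τ, b]` with `τ = 1 / N`. The `N` shifts of this interval
tile `(b - 1, b]`, so the sums become integrals over a unit interval, which `L^p` norms control; the
factor `τ` on both sides cancels. -/
theorem IsDominated.norm_zext_sub_le (hdom : IsDominated I p T M v) (hM : 0 ≤ M)
    (hT : IsC0Semigroup T) {f : Ep X I p} {u : C₀(I, X)} (hu : AEEqC0 I (rep f) u) {N : ℕ}
    (hN : 0 < N) {b ε : ℝ} (hsub : Ioc (b - (N : ℝ)⁻¹) b ⊆ I)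
    (hle : ∀ t ∈ Ioc (b - (N : ℝ)⁻¹) b, ‖zext u b‖ - ε ≤ ‖zext u t‖) :
    ‖zext u b‖ - ε ≤ M * Real.exp |v| *
      (‖f‖ + ‖((N : ℝ)⁻¹)⁻¹ • (T (N : ℝ)⁻¹ f - f)‖) := by
  have hN0 : (0 : ℝ) < N := by exact_mod_cast hN
  set τ := (N : ℝ)⁻¹ with hτdef
  have hτ : 0 < τ := inv_pos.2 hN0
  set h := τ⁻¹ • (T τ f - f) with hh
  set C := M * Real.exp |v| with hC
  have hC0 : 0 ≤ C := by positivity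
  set φ : ℝ → ℝ≥0∞ := fun t => ‖I.indicator (rep f) t‖ₑ + ‖I.indicator (rep h) t‖ₑ with hφ
  have hfm : AEStronglyMeasurable (I.indicator (rep f)) volume :=
    (aestronglyMeasurable_indicator_iff hIc.measurableSet).2 (Lp.memLp _).1
  have hhm : AEStronglyMeasurable (I.indicator (rep h)) volume :=
    (aestronglyMeasurable_indicator_iff hIc.measurableSet).2 (Lp.memLp _).1
  have hφm : AEMeasurable φ volume := hfm.enorm.add hhm.enorm
  have hφsub : ∀ c : ℝ, AEMeasurable (fun t => φ (t - c)) volume := fun c =>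
    hφm.comp_quasiMeasurePreserving (measurePreserving_sub_right volume c).quasiMeasurePreserving
  have hpt : ∀ᵐ t ∂(volume.restrict (Ioc (b - τ) b)), ENNReal.ofReal (‖zext u b‖ - ε) ≤
      ENNReal.ofReal (C * τ) * ∑ k ∈ Finset.range N, φ (t - k * τ) := by
    have h1 := ae_mono (Measure.restrict_mono_set volume hsub) (hdom.pointwise_le hM hT hN f)
    have h2 := ae_mono (Measure.restrict_mono_set volume hsub) (aeEqC0_iff.1 hu)
    filter_upwards [h1, h2, ae_restrict_mem measurableSet_Ioc] with t h1 h2 h3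
    have h4 := (hle t h3).trans ((congrArg norm h2).symm.le.trans h1)
    refine (ENNReal.ofReal_le_ofReal h4).trans_eq ?_
    rw [← mul_assoc, ENNReal.ofReal_mul (by positivity), ENNReal.ofReal_sum_of_nonneg
      (fun k _ => by positivity)]
    congr 1
    refine Finset.sum_congr rfl fun k _ => ?_
    rw [ENNReal.ofReal_add (norm_nonneg _) (norm_nonneg _), ofReal_norm,
      ofReal_norm]
  have hint : ENNReal.ofReal (‖zext u b‖ - ε) * ENNReal.ofReal τ ≤
      ENNReal.ofReal (C * τ) * (ENNReal.ofReal ‖f‖ + ENNReal.ofReal ‖h‖) := by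
    calc ENNReal.ofReal (‖zext u b‖ - ε) * ENNReal.ofReal τ
        = ∫⁻ _ in Ioc (b - τ) b, ENNReal.ofReal (‖zext u b‖ - ε) := by
          rw [setLIntegral_const, Real.volume_Ioc, sub_sub_cancel]
      _ ≤ ∫⁻ t in Ioc (b - τ) b, ENNReal.ofReal (C * τ) *
            ∑ k ∈ Finset.range N, φ (t - k * τ) := lintegral_mono_ae hpt
      _ = ENNReal.ofReal (C * τ) * ∫⁻ t in Ioc (b - N * τ) b, φ t := by
          rw [lintegral_const_mul' _ _ ENNReal.ofReal_ne_top,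
            lintegral_finsetSum' _ fun k _ => (hφsub _).restrict, sum_setLIntegral_sub φ b hτ.le]
      _ ≤ _ := by
          rw [mul_inv_cancel₀ hN0.ne']
          gcongr
          rw [hφ, lintegral_add_left' hfm.enorm.restrict]
          exact add_le_add (setLIntegral_indicator_rep_le f b) (setLIntegral_indicator_rep_le h b)
  rw [← ENNReal.ofReal_add (norm_nonneg _) (norm_nonneg _), ← ENNReal.ofReal_mul' hτ.le,
    ← ENNReal.ofReal_mul (p := C * τ) (by positivity), ENNReal.ofReal_le_ofReal_iff (by positivity)] at hint
  refine le_of_mul_le_mul_right (hint.trans_eq ?_) hτ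
  ring

theorem IsDominated.norm_le_of_aeEqC0 (hI : ∀ a, ¬ IsLeast I a) (hdom : IsDominated I p T M v)
    (hM : 0 ≤ M) (hT : IsC0Semigroup T) {f g : Ep X I p}
    (hfg : Tendsto (fun σ : ℝ => σ⁻¹ • (T σ f - f)) (𝓝[>] 0) (𝓝 g))
    {u : C₀(I, X)} (hu : AEEqC0 I (rep f) u) :
    ‖u‖ ≤ M * Real.exp |v| * (‖f‖ + ‖g‖) := by
  refine norm_le_of_zext (by positivity) fun b hb => ?_
  refine le_of_forall_pos_sub_le fun ε hε => ?_
  have hlim : Tendsto (fun N : ℕ => (N : ℝ)⁻¹) atTop (𝓝[>] 0) := by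
    simpa using IsChernoffFamily.tendsto_div_nat one_pos
  have h1 : Tendsto (fun N : ℕ => M * Real.exp |v| *
      (‖f‖ + ‖((N : ℝ)⁻¹)⁻¹ • (T (N : ℝ)⁻¹ f - f)‖)) atTop
      (𝓝 (M * Real.exp |v| * (‖f‖ + ‖g‖))) :=
    (((hfg.comp hlim).norm).const_add _).const_mul _
  refine ge_of_tendsto h1 ?_
  obtain ⟨s, hs, hsb⟩ := exists_lt_mem_of_not_isLeast hI hb
  obtain ⟨δ, hδ, hd⟩ := Metric.continuousWithinAt_iff.1 (continuousOn_zext u b hb) ε hε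
  have hpos : 0 < min (b - s) δ := lt_min (sub_pos.2 hsb) hδ
  have hsmall := (hlim.mono_right nhdsWithin_le_nhds).eventually_lt_const hpos
  filter_upwards [hsmall, eventually_gt_atTop 0] with N hN hN0
  have hN1 := hN.trans_le (min_le_left _ _)
  have hN2 := hN.trans_le (min_le_right _ _)
  have hsub : Ioc (b - (N : ℝ)⁻¹) b ⊆ I := fun t ht =>
    hIc.out hs hb ⟨by linarith [ht.1], ht.2⟩
  refine hdom.norm_zext_sub_le hM hT hu hN0 hsub fun t ht => ?_
  have h2 := hd (hsub ht) (by
    rw [Real.dist_eq, abs_lt]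
    constructor <;> linarith [ht.1, ht.2])
  rw [dist_eq_norm, norm_sub_rev] at h2
  have := norm_sub_norm_le (zext u b) (zext u t)
  linarith

/-- Every element of the domain of the closure has a representative in `C₀(I, X)`. -/
theorem IsDominated.exists_continuous_rep [CompleteSpace X] (hI : ∀ a, ¬ IsLeast I a)
    (hdom : IsDominated I p T M v) (hM : 0 ≤ M) (hT : IsC0Semigroup T)
    {Γ₀ : Submodule ℂ (Ep X I p × Ep X I p)}
    (hg : ∀ x y, (x, y) ∈ Γ₀ → Tendsto (fun σ : ℝ => σ⁻¹ • (T σ x - x)) (𝓝[>] 0) (𝓝 y))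
    (hc : ∀ x y, (x, y) ∈ Γ₀ → ∃ u : C₀(I, X), AEEqC0 I (rep x) u)
    {q : Ep X I p × Ep X I p} (hq : q ∈ Γ₀.topologicalClosure) :
    ∃ u : C₀(I, X), AEEqC0 I (rep q.1) u := by
  obtain ⟨s, hs, hlim⟩ := mem_closure_iff_seq_limit.1 hq
  choose u hu using fun n => hc (s n).1 (s n).2 (hs n)
  set C := M * Real.exp |v| with hC
  have hC0 : 0 ≤ C := by positivity
  -- The sup norm is controlled by the graph norm, so convergence in the graph forces the
  -- representatives to converge uniformly.
  have hle : ∀ m n, ‖u m - u n‖ ≤ C * (2 * ‖s m - s n‖) := by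
    intro m n
    have hmem : ((s m).1 - (s n).1, (s m).2 - (s n).2) ∈ Γ₀ := Γ₀.sub_mem (hs m) (hs n)
    have hae : AEEqC0 I (rep ((s m).1 - (s n).1)) (u m - u n) := by
      rw [aeEqC0_iff]
      filter_upwards [rep_sub (s m).1 (s n).1, aeEqC0_iff.1 (hu m), aeEqC0_iff.1 (hu n)]
        with t h1 h2 h3
      rw [h1, h2, h3, zext_sub]
    refine (hdom.norm_le_of_aeEqC0 hI hM hT (hg _ _ hmem) hae).trans ?_
    gcongr
    have h1 := norm_fst_le (s m - s n)
    have h2 := norm_snd_le (s m - s n)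
    rw [Prod.fst_sub] at h1
    rw [Prod.snd_sub] at h2
    linarith
  have hcau : CauchySeq u := by
    rw [Metric.cauchySeq_iff]
    intro ε hε
    obtain ⟨N, hN⟩ := Metric.cauchySeq_iff.1 hlim.cauchySeq (ε / (2 * (C + 1))) (by positivity)
    refine ⟨N, fun m hm n hn => ?_⟩
    have h1 := hN m hm n hn
    rw [dist_eq_norm, lt_div_iff₀ (by positivity)] at h1
    rw [dist_eq_norm]
    refine (hle m n).trans_lt (lt_of_le_of_lt ?_ h1)
    nlinarith [norm_nonneg (s m - s n)]
  obtain ⟨w, hw⟩ := cauchySeq_tendsto_of_complete hcau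
  have hfst : Tendsto (fun n => ((s n).1 : Lp X p (volume.restrict I))) atTop
      (𝓝 (q.1 : Lp X p (volume.restrict I))) :=
    (continuous_subtype_val.comp continuous_fst).continuousAt.tendsto.comp hlim
  exact ⟨w, aeEqC0_of_tendsto hfst hw hu⟩

end SupBound

/-! ### Evolution families from semigroups of continuous functions -/

section Evaluation

theorem isLocallyClosed_of_ordConnected {I : Set ℝ} (hI : I.OrdConnected) : IsLocallyClosed I := by
  rcases hI.isPreconnected.mem_intervals with h | h | h | h | h | h | h | h | h | h <;> rw [h]
  exacts [isLocallyClosed_Icc, isLocallyClosed_Ico, isLocallyClosed_Ioc, isLocallyClosed_Ioo,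
    isLocallyClosed_Ici, isLocallyClosed_Ioi, isLocallyClosed_Iic, isLocallyClosed_Iio,
    isClosed_univ.isLocallyClosed, isClosed_empty.isLocallyClosed]

variable {X : Type*} [NormedAddCommGroup X] {I : Set ℝ}

theorem continuousOn_zext_comp {α : Type*} [TopologicalSpace α] {D : Set α} {F : α → C₀(I, X)}
    {φ : α → ℝ} (hF : ContinuousOn F D) (hφ : ContinuousOn φ D) (hm : ∀ a ∈ D, φ a ∈ I) :
    ContinuousOn (fun a => zext (F a) (φ a)) D := by
  intro a ha
  rw [ContinuousWithinAt, tendsto_iff_norm_sub_tendsto_zero]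
  have h1 : Tendsto (fun b => ‖F b - F a‖) (𝓝[D] a) (𝓝 0) :=
    tendsto_iff_norm_sub_tendsto_zero.1 (hF a ha)
  have h2 : Tendsto (fun b => ‖zext (F a) (φ b) -
      zext (F a) (φ a)‖) (𝓝[D] a) (𝓝 0) :=
    tendsto_iff_norm_sub_tendsto_zero.1 (((continuousOn_zext (F a)).comp hφ hm) a ha)
  refine squeeze_zero (fun _ => norm_nonneg _) (fun b => ?_) (by simpa using h1.add h2)
  refine (norm_sub_le_norm_sub_add_norm_sub _ (zext (F a) (φ b)) _).trans ?_
  gcongr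
  rw [← zext_sub]
  exact norm_zext_le _ _

theorem exists_zext_eq [NormedSpace ℂ X] (hI : I.OrdConnected) {s : ℝ} (hs : s ∈ I) (x : X) :
    ∃ u : C₀(I, X), zext u s = x := by
  have := (isLocallyClosed_of_ordConnected hI).locallyCompactSpace
  obtain ⟨φ, h1, -, hc, -⟩ := exists_continuous_one_zero_of_isCompact
    (isCompact_singleton (x := (⟨s, hs⟩ : I))) isClosed_empty (disjoint_empty _)
  have h2 : φ ⟨s, hs⟩ = 1 := h1 rfl
  refine ⟨⟨⟨fun t => (φ t : ℂ) • x, by fun_prop⟩, ?_⟩, ?_⟩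
  · have h3 : HasCompactSupport fun t : I => (φ t : ℂ) • x :=
      hc.mono (fun t ht => by
        simp only [Function.mem_support] at ht ⊢
        contrapose! ht
        simp [ht])
    exact h3.is_zero_at_infty
  · rw [zext_of_mem _ hs]
    change (φ ⟨s, hs⟩ : ℂ) • x = x
    simp [h2]

end Evaluation

/-! ### Evolution families built from point values -/

section Family

variable {X : Type*} [NormedAddCommGroup X] [NormedSpace ℂ X] {I : Set ℝ}
  {V : Type*} [AddCommGroup V] [Module ℂ V]

/-- The evaluation at `t` of the functions `W q`. -/
def evalAt (W : V →ₗ[ℂ] C₀(I, X)) (t : ℝ) : V →ₗ[ℂ] X where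
  toFun q := zext (W q) t
  map_add' q r := by rw [map_add, zext_add]
  map_smul' c q := by rw [map_smul, zext_smul, RingHom.id_apply]

theorem evalAt_apply (W : V →ₗ[ℂ] C₀(I, X)) (t : ℝ) (q : V) : evalAt W t q = zext (W q) t := rfl

theorem exists_evolutionFamily [CompleteSpace X] {S : ℝ → V →ₗ[ℂ] V} {W : V →ₗ[ℂ] C₀(I, X)}
    {M v : ℝ} (hM : 0 ≤ M) (hS0 : S 0 = LinearMap.id)
    (hS : ∀ σ τ : ℝ, 0 ≤ σ → 0 ≤ τ → ∀ q, S (σ + τ) q = S σ (S τ q))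
    (hcont : ∀ q, ContinuousOn (fun σ => W (S σ q)) (Ici 0))
    (hle : ∀ q, ∀ t ∈ I, ∀ s ∈ I, s ≤ t →
      ‖zext (W (S (t - s) q)) t‖ ≤ M * Real.exp (v * (t - s)) * ‖zext (W q) s‖)
    (hdense : ∀ s ∈ I, DenseRange (evalAt W s)) :
    ∃ U : ℝ → ℝ → X →L[ℂ] X, IsEvolutionFamily I U ∧
      (∀ t ∈ I, ∀ s ∈ I, s ≤ t → ∀ q, U t s (zext (W q) s) = zext (W (S (t - s) q)) t) := by
  -- By `hle` the value of `W (S (t - s) q)` at `t` depends only on that of `W q` at `s`, boundedly;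
  -- since those values are dense in `X`, the assignment extends to all of `X`.
  set U : ℝ → ℝ → X →L[ℂ] X := fun t s =>
    LinearMap.extendOfNorm (evalAt W t ∘ₗ S (t - s)) (evalAt W s) with hU
  have hUle : ∀ t ∈ I, ∀ s ∈ I, s ≤ t → ∀ x, ‖U t s x‖ ≤ M * Real.exp (v * (t - s)) * ‖x‖ :=
    fun t ht s hs hst x => LinearMap.norm_extendOfNorm_apply_le (hdense s hs) _
      (fun q => hle q t ht s hs hst) x
  have hUeq : ∀ t ∈ I, ∀ s ∈ I, s ≤ t → ∀ q, U t s (zext (W q) s) = zext (W (S (t - s) q)) t :=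
    fun t ht s hs hst q => LinearMap.extendOfNorm_eq (hdense s hs)
      ⟨_, fun q => hle q t ht s hs hst⟩ q
  refine ⟨U, ⟨fun t ht => ?_, fun t ht r hr s hs hsr hrt => ?_, fun x => ?_,
    ⟨M, v, fun t ht s hs hst => ?_⟩⟩, hUeq⟩
  · refine ContinuousLinearMap.coeFn_injective ?_
    refine (hdense t ht).equalizer (U t t).continuous continuous_id (funext fun q => ?_)
    change U t t (zext (W q) t) = zext (W q) t
    rw [hUeq t ht t ht le_rfl, sub_self, hS0, LinearMap.id_apply]
  · refine ContinuousLinearMap.coeFn_injective ?_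
    refine (hdense s hs).equalizer ((U t r).comp (U r s)).continuous (U t s).continuous
      (funext fun q => ?_)
    change U t r (U r s (zext (W q) s)) = U t s (zext (W q) s)
    rw [hUeq r hr s hs hsr, hUeq t ht r hr hrt, hUeq t ht s hs (hsr.trans hrt),
      ← hS _ _ (sub_nonneg.2 hrt) (sub_nonneg.2 hsr), sub_add_sub_cancel]
  · intro a ha
    obtain ⟨ht, hs, hst⟩ := ha
    set D : Set (ℝ × ℝ) := {q | q.1 ∈ I ∧ q.2 ∈ I ∧ q.2 ≤ q.1} with hD
    rw [Metric.continuousWithinAt_iff']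
    intro ε hε
    set K : ℝ × ℝ → ℝ := fun b => M * Real.exp (v * (b.1 - b.2)) with hK
    have hK0 : ∀ b, 0 ≤ K b := fun b => by positivity
    obtain ⟨q, hq⟩ := (hdense a.2 hs).exists_dist_lt x (ε := ε / (2 * (K a + 1)))
      (by have := hK0 a; positivity)
    have hWc : ContinuousOn (fun b : ℝ × ℝ => zext (W (S (b.1 - b.2) q)) b.1) D :=
      continuousOn_zext_comp ((hcont q).comp (by fun_prop) fun b hb => sub_nonneg.2 hb.2.2)
        continuousOn_fst fun b hb => hb.1
    have hec : ContinuousOn (fun b : ℝ × ℝ => zext (W q) b.2) D :=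
      (continuousOn_zext (W q)).comp continuousOn_snd fun b hb => hb.2.1
    have hb : ContinuousOn (fun b : ℝ × ℝ => K b * ‖x - zext (W q) b.2‖ +
        ‖zext (W (S (b.1 - b.2) q)) b.1 - zext (W (S (a.1 - a.2) q)) a.1‖ +
        K a * ‖zext (W q) a.2 - x‖) D := by
      refine ((ContinuousOn.mul (by fun_prop) (continuousOn_const.sub hec).norm).add
        (hWc.sub continuousOn_const).norm).add continuousOn_const
    have hsmall : K a * ‖x - zext (W q) a.2‖ +
        ‖zext (W (S (a.1 - a.2) q)) a.1 - zext (W (S (a.1 - a.2) q)) a.1‖ +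
        K a * ‖zext (W q) a.2 - x‖ < ε := by
      rw [dist_eq_norm, evalAt_apply, lt_div_iff₀ (by have := hK0 a; positivity)] at hq
      rw [sub_self, norm_zero, norm_sub_rev (zext (W q) a.2) x]
      have := norm_nonneg (x - zext (W q) a.2)
      nlinarith
    filter_upwards [(hb a ⟨ht, hs, hst⟩).eventually_lt_const hsmall, self_mem_nhdsWithin]
      with b h1 h2
    obtain ⟨ht', hs', hst'⟩ := h2
    refine lt_of_le_of_lt ?_ h1
    rw [dist_eq_norm]
    -- The vector `x` is compared at `b` with the value of `W q` at the moving point `b.2`, where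
    -- `U` is explicit; the middle term is then a difference of values of continuous functions.
    have e : U b.1 b.2 x - U a.1 a.2 x = U b.1 b.2 (x - zext (W q) b.2) +
        (zext (W (S (b.1 - b.2) q)) b.1 - zext (W (S (a.1 - a.2) q)) a.1) +
        U a.1 a.2 (zext (W q) a.2 - x) := by
      rw [map_sub, map_sub, hUeq _ ht' _ hs' hst', hUeq _ ht _ hs hst]
      abel
    rw [e]
    exact norm_add₃_le.trans (add_le_add (add_le_add (hUle _ ht' _ hs' hst' _) le_rfl)
      (hUle _ ht _ hs hst _))
  · exact LinearMap.opNorm_extendOfNorm_le (hdense s hs) (by positivity)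
      fun q => hle q t ht s hs hst

end Family

/-! ### The evolution family of the semigroup -/

section Construction

variable {X : Type*} [NormedAddCommGroup X] [NormedSpace ℂ X]
  {I : Set ℝ} [hIc : I.OrdConnected] {p : ℝ≥0∞}

/-- If all elements of a graph `Γ` have representatives in `C₀(I, X)`, then these depend linearly
on the element. -/
theorem exists_linear_rep (hI : ∀ a, ¬ IsLeast I a) {Γ : Submodule ℂ (Ep X I p × Ep X I p)}
    (h : ∀ q ∈ Γ, ∃ u : C₀(I, X), AEEqC0 I (rep q.1) u) :
    ∃ W : Γ →ₗ[ℂ] C₀(I, X), ∀ q : Γ, AEEqC0 I (rep (q : Ep X I p × Ep X I p).1) (W q) := by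
  choose u hu using fun q : Γ => h q q.2
  refine ⟨⟨⟨u, fun q r => ?_⟩, fun c q => ?_⟩, hu⟩
  · refine zext_eq_of_aeEqC0 hI (hu (q + r)) (aeEqC0_iff.2 ?_)
    filter_upwards [Ep_rep_add (q : Ep X I p × Ep X I p).1 (r : Ep X I p × Ep X I p).1,
      aeEqC0_iff.1 (hu q), aeEqC0_iff.1 (hu r)] with t h1 h2 h3
    rw [Submodule.coe_add, Prod.fst_add, h1, Pi.add_apply, h2, h3, zext_add]
  · refine zext_eq_of_aeEqC0 hI (hu (c • q)) (aeEqC0_iff.2 ?_)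
    filter_upwards [Ep_rep_smul c (q : Ep X I p × Ep X I p).1, aeEqC0_iff.1 (hu q)] with t h1 h2
    rw [Submodule.coe_smul, Prod.smul_fst, h1, Pi.smul_apply, h2, RingHom.id_apply, zext_smul]

variable [hp : Fact (1 ≤ p)] {T : ℝ → Ep X I p →L[ℂ] Ep X I p} {M v : ℝ}

theorem IsDominated.norm_zext_le (hI : ∀ a, ¬ IsLeast I a) (hdom : IsDominated I p T M v)
    {f : Ep X I p} {u u' : C₀(I, X)} {σ : ℝ} (hσ : 0 ≤ σ) (hu : AEEqC0 I (rep f) u)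
    (hu' : AEEqC0 I (rep (T σ f)) u') {t : ℝ} (ht : t ∈ I) (hs : t - σ ∈ I) :
    ‖zext u' t‖ ≤ M * Real.exp (v * σ) * ‖zext u (t - σ)‖ := by
  set J : Set ℝ := {r | r ∈ I ∧ r - σ ∈ I} with hJ
  have hJc : J.OrdConnected := ⟨fun a ha b hb c hc =>
    ⟨hIc.out ha.1 hb.1 hc, hIc.out ha.2 hb.2 ⟨by linarith [hc.1], by linarith [hc.2]⟩⟩⟩
  -- The overlap of `I` and its translate inherits the missing left end point, so the a.e.
  -- domination of continuous functions holds at each of its points.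
  have hJl : ∀ a, ¬ IsLeast J a := by
    rintro a ⟨ha, hmin⟩
    obtain ⟨b, hb, hba⟩ := exists_lt_mem_of_not_isLeast hI ha.2
    have h1 : b + σ ∈ J := ⟨hIc.out hb ha.1 ⟨by linarith, by linarith⟩, by
      rwa [add_sub_cancel_right]⟩
    linarith [hmin h1]
  have hc : ContinuousOn (fun r => ‖zext u' r‖ - M * Real.exp (v * σ) * ‖zext u (r - σ)‖) J :=
    ((continuousOn_zext u').mono fun r hr => hr.1).norm.sub (continuousOn_const.mul
      ((continuousOn_zext u).comp (by fun_prop) fun r hr => hr.2).norm)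
  have hsub : J ⊆ I := fun r hr => hr.1
  have h := mem_of_ae_mem hJc hJl hc (isClosed_Iic (a := (0 : ℝ))) (by
    filter_upwards [ae_mono (Measure.restrict_mono_set volume hsub) (hdom σ hσ f),
      ae_mono (Measure.restrict_mono_set volume hsub) (aeEqC0_iff.1 hu'),
      ae_restrict_of_ae (ae_restrict_sub hIc.measurableSet (aeEqC0_iff.1 hu) σ),
      ae_restrict_mem hJc.measurableSet] with r h1 h2 h3 h4
    rw [indicator_of_mem h4.2, h3 h4.2, h2] at h1
    exact sub_nonpos.2 h1) (show t ∈ J from ⟨ht, hs⟩)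
  exact sub_nonpos.1 h

/-- A semigroup with a pointwise estimate by translates is given by an evolution family, if there
are sufficiently many continuous functions in the domain of its generator. -/
theorem IsDominated.exists_evolutionFamily [CompleteSpace X] (hI : ∀ a, ¬ IsLeast I a)
    (hdom : IsDominated I p T M v) (hM : 0 ≤ M) (hT : IsC0Semigroup T)
    {Γ : Submodule ℂ (Ep X I p × Ep X I p)}
    (hg : ∀ x y, (x, y) ∈ Γ → Tendsto (fun σ : ℝ => σ⁻¹ • (T σ x - x)) (𝓝[>] 0) (𝓝 y))
    (hΓ : ∀ t, 0 ≤ t → ∀ x y, (x, y) ∈ Γ → (T t x, T t y) ∈ Γ)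
    (hc : ∀ q ∈ Γ, ∃ u : C₀(I, X), AEEqC0 I (rep q.1) u)
    (hd : Dense {f : Ep X I p | ∃ g, (f, g) ∈ Γ})
    (hdC : Dense {u : C₀(I, X) | ∃ q ∈ Γ, AEEqC0 I (rep q.1) u}) :
    ∃ U : ℝ → ℝ → X →L[ℂ] X, IsEvolutionFamily I U ∧ IsGivenBy I p T U := by
  obtain ⟨W, hW⟩ := exists_linear_rep hI hc
  -- The absolute value only makes `S` total, since `hΓ` requires nonnegative times.
  set S : ℝ → Γ →ₗ[ℂ] Γ := fun σ =>
    ((T |σ|).prodMap (T |σ|) : (Ep X I p × Ep X I p) →ₗ[ℂ] (Ep X I p × Ep X I p)).restrict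
      (p := Γ) (q := Γ) fun q hq => hΓ |σ| (abs_nonneg σ) q.1 q.2 hq with hSdef
  have hSv : ∀ σ, 0 ≤ σ → ∀ q : Γ, ((S σ q : Γ) : Ep X I p × Ep X I p) =
      (T σ (q : Ep X I p × Ep X I p).1, T σ (q : Ep X I p × Ep X I p).2) := fun σ hσ q => by
    rw [hSdef]
    simp [abs_of_nonneg hσ]
  have hSr : ∀ σ, 0 ≤ σ → ∀ q : Γ, AEEqC0 I (rep (T σ (q : Ep X I p × Ep X I p).1)) (W (S σ q)) :=
    fun σ hσ q => by
      have := hW (S σ q)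
      rwa [hSv σ hσ] at this
  -- `W` is bounded for the graph norm, so strong continuity of `T` on both components gives
  -- sup-norm continuity of `σ ↦ W (S σ q)`.
  have hWle : ∀ q : Γ, ‖W q‖ ≤ M * Real.exp |v| *
      (‖(q : Ep X I p × Ep X I p).1‖ + ‖(q : Ep X I p × Ep X I p).2‖) := fun q =>
    hdom.norm_le_of_aeEqC0 hI hM hT (hg _ _ q.2) (hW q)
  have hzle : ∀ q : Γ, ∀ t ∈ I, ∀ s ∈ I, s ≤ t →
      ‖zext (W (S (t - s) q)) t‖ ≤ M * Real.exp (v * (t - s)) * ‖zext (W q) s‖ := by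
    intro q t ht s hs hst
    have := hdom.norm_zext_le hI (sub_nonneg.2 hst) (hW q) (hSr _ (sub_nonneg.2 hst) q) ht
      (by rwa [sub_sub_cancel])
    rwa [sub_sub_cancel] at this
  obtain ⟨U, hU, hUeq⟩ := EvolutionSemigroup.exists_evolutionFamily (S := S) (W := W) hM
    (LinearMap.ext fun q => Subtype.ext (by rw [hSv 0 le_rfl, hT.map_zero]; rfl))
    (fun σ τ hσ hτ q => Subtype.ext (by
      rw [hSv _ (add_nonneg hσ hτ), hSv σ hσ, hSv τ hτ, hT.map_add σ τ hσ hτ]; rfl))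
    (fun q σ₀ hσ₀ => by
      rw [ContinuousWithinAt, tendsto_iff_norm_sub_tendsto_zero]
      have h1 := tendsto_iff_norm_sub_tendsto_zero.1
        (hT.strong_cont (q : Ep X I p × Ep X I p).1 σ₀ hσ₀)
      have h2 := tendsto_iff_norm_sub_tendsto_zero.1
        (hT.strong_cont (q : Ep X I p × Ep X I p).2 σ₀ hσ₀)
      refine squeeze_zero' (Eventually.of_forall fun _ => norm_nonneg _) ?_
        (by simpa using (h1.add h2).const_mul (M * Real.exp |v|))
      filter_upwards [self_mem_nhdsWithin] with σ hσ
      rw [← map_sub]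
      refine (hWle _).trans_eq ?_
      rw [Submodule.coe_sub, hSv σ hσ, hSv σ₀ hσ₀]
      rfl)
    hzle
    (fun s hs => by
      rw [Metric.denseRange_iff]
      intro x ε hε
      obtain ⟨u, rfl⟩ := exists_zext_eq hIc hs x
      obtain ⟨u', ⟨q, hq, hqu⟩, hu'⟩ := hdC.exists_dist_lt u hε
      refine ⟨⟨q, hq⟩, lt_of_le_of_lt ?_ hu'⟩
      rw [evalAt_apply, zext_eq_of_aeEqC0 hI (hW ⟨q, hq⟩) hqu, dist_eq_norm, dist_eq_norm,
        ← zext_sub]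
      exact EvolutionSemigroup.norm_zext_le _ _)
  refine ⟨U, hU, fun σ hσ f => ?_⟩
  obtain ⟨f', hf', hlim⟩ := mem_closure_iff_seq_limit.1 (hd f)
  choose g hgΓ using hf'
  have hTlim : Tendsto (fun n => ((T σ (f' n) : Ep X I p) : Lp X p (volume.restrict I))) atTop
      (𝓝 (T σ f : Ep X I p)) :=
    (continuous_subtype_val.comp (T σ).continuous).continuousAt.tendsto.comp hlim
  -- For general `f`, approximation from the domain and two successive subsequences make both `T σ
  -- (f' n)` and `f' n` converge a.e., so the formula passes to the limit.
  obtain ⟨ns, hns, hae⟩ := (tendstoInMeasure_of_tendsto_Lp hTlim).exists_seq_tendsto_ae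
  have hlim' : Tendsto (fun n => ((f' (ns n) : Ep X I p) : Lp X p (volume.restrict I))) atTop
      (𝓝 (f : Lp X p (volume.restrict I))) :=
    (continuous_subtype_val.continuousAt.tendsto.comp hlim).comp hns.tendsto_atTop
  obtain ⟨ms, hms, hae'⟩ := (tendstoInMeasure_of_tendsto_Lp hlim').exists_seq_tendsto_ae
  have hrep : ∀ᵐ t ∂(volume.restrict I), ∀ n, rep (f' n) t = zext (W ⟨_, hgΓ n⟩) t :=
    ae_all_iff.2 fun n => aeEqC0_iff.1 (hW ⟨_, hgΓ n⟩)
  have hTrep : ∀ᵐ t ∂(volume.restrict I), ∀ n,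
      rep (T σ (f' n)) t = zext (W (S σ ⟨_, hgΓ n⟩)) t :=
    ae_all_iff.2 fun n => aeEqC0_iff.1 (hSr σ hσ ⟨_, hgΓ n⟩)
  filter_upwards [hdom σ hσ f, hae, hTrep, ae_restrict_mem hIc.measurableSet,
    ae_restrict_of_ae (ae_restrict_sub hIc.measurableSet (hae'.and hrep) σ)] with t h1 h2 h3 h4 h5
  split_ifs with ht
  · obtain ⟨h6, h7⟩ := h5 ht
    refine tendsto_nhds_unique (h2.comp hms.tendsto_atTop)
      ((((U t (t - σ)).continuous.tendsto _).comp h6).congr fun n => ?_)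
    change U t (t - σ) (rep (f' (ns (ms n))) (t - σ)) = rep (T σ (f' (ns (ms n)))) t
    rw [h7, h3, hUeq t h4 (t - σ) ht (by linarith), sub_sub_cancel]
  -- Outside `I` the domination by the translate already forces the value zero.
  · rw [indicator_of_notMem ht, norm_zero, mul_zero] at h1
    exact norm_le_zero_iff.1 h1

end Construction

end EvolutionSemigroup

end


theorem mainTheorem6 {X : Type*} [NormedAddCommGroup X] [NormedSpace ℂ X] [CompleteSpace X]
    (I : Set ℝ) [I.OrdConnected] (hI : ∀ a : ℝ, ¬ IsLeast I a)
    (p : ℝ≥0∞) [Fact (1 ≤ p)]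
    (A : ℝ → X →ₗ.[ℂ] X) (M w w' : ℝ)
    (hA : EvolutionSemigroup.IsKatoStable I A M w) (hw : w < w')
    (hR : ∀ x : X, ContinuousOn (fun t => EvolutionSemigroup.resolventOf (A t) (w' : ℂ) x) I)
    (hrange : Dense {g : EvolutionSemigroup.Ep X I p |
      ∃ f : (EvolutionSemigroup.G0 I A p).domain,
        (w' : ℂ) • (f : EvolutionSemigroup.Ep X I p) - EvolutionSemigroup.G0 I A p f = g})
    (hFp : Dense (EvolutionSemigroup.Fp I A p : Set (EvolutionSemigroup.Ep X I p)))
    (hFinf : Dense {u : C₀(I, X) |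
      ∃ f ∈ EvolutionSemigroup.Fp I A p, EvolutionSemigroup.AEEqC0 I (EvolutionSemigroup.rep f) u}) :
    (EvolutionSemigroup.G0 I A p).IsClosable ∧
      ∃ (T : ℝ → EvolutionSemigroup.Ep X I p →L[ℂ] EvolutionSemigroup.Ep X I p)
        (U : ℝ → ℝ → X →L[ℂ] X),
        EvolutionSemigroup.IsC0Semigroup T ∧
        EvolutionSemigroup.IsGeneratorOf (EvolutionSemigroup.G0 I A p).closure T ∧
        EvolutionSemigroup.IsEvolutionFamily I U ∧
        EvolutionSemigroup.IsGivenBy I p T U := by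
  obtain ⟨T, v, hT, hg, hΓ, hdom⟩ := hA.exists_semigroup hI hw hR hrange hFp
  obtain ⟨hcl, hgen⟩ := EvolutionSemigroup.isClosable_of_generator hg
  have hmem : ∀ f ∈ EvolutionSemigroup.Fp I A p,
      ∃ g, (f, g) ∈ (EvolutionSemigroup.G0 I A p).graph := fun f hf =>
    ⟨_, (EvolutionSemigroup.G0 I A p).mem_graph ⟨f, hf⟩⟩
  have hle := (EvolutionSemigroup.G0 I A p).graph.le_topologicalClosure
  obtain ⟨U, hU, hgiven⟩ := hdom.exists_evolutionFamily hI hA.pos.le hT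
    (fun x y h => (hg x y).1 h) hΓ
    (fun q hq => hdom.exists_continuous_rep hI hA.pos.le hT
      (fun x y h => (hg x y).1 (hle h))
      (fun x y h => by
        obtain ⟨f', a, hf', -, -⟩ := (EvolutionSemigroup.mem_G0_graph I A p x y).1 h
        exact hf'.2) hq)
    (hFp.mono fun f hf => (hmem f hf).imp fun g h => hle h)
    (hFinf.mono (by
      rintro u ⟨f, hf, hu⟩
      obtain ⟨g, h⟩ := hmem f hf
      exact ⟨(f, g), hle h, hu⟩))
  exact ⟨hcl, T, U, hT, hgen, hU, hgiven⟩
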